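/- All graphs are finite, simple and undirected. For $r\in\mathbb N$ (with $0\in\mathbb N$) a graph $H$ is a depth-$r$ minor of $G$, written $H\preccurlyeq_r G$, if there are pairwise vertex-disjoint connected subgraphs $(M_i)_{i\in V(H)}$ of $G$, each of radius at most $r$, such that whenever $ij\in E(H)$ some edge of $G$ joins $M_i$ to $M_j$. A class $\mathcal C$ of graphs is nowhere dense if there is a function $f:\mathbb N\to\mathbb N$ with $K_{f(r)}\not\preccurlyeq_r G$ for all $r\in\mathbb N$ and $G\in\mathcal C$. A set $B$ of vertices is $r$-independent in a graph if any two distinct vertices of $B$ have distance greater than $r$ in it. **Theorem.** Let $\mathcal C$ be a nowhere dense class of graphs. For every $r\in\mathbb N$ there are a polynomial $p_r$ (with coefficients in $\mathbb N$) and a constant $s(r)\in\mathbb N$ such that the following hold. 1. For all $r,m\in\mathbb N$, all $G\in\mathcal C$ and all $A\subseteq V(G)$ with $|A|\ge p_r(m)$, there are $S\subseteq V(G)$ with $|S|\le s(r)$ and $B\subseteq A\setminus S$ with $|B|\ge m$ such that $B$ is $r$-independent in $G-S$. 2. For all $r,c\in\mathbb N$, if $K_c\not\preccurlyeq_r G$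 for all $G\in\mathcal C$, then $s(r)\le c$. 3. There is an algorithm such that for every $\epsilon>0$ there is a constant $K$ (depending only on $\mathcal C$ and $\epsilon$) with the following property. For all $r,c\in\mathbb N$ such that $K_c\not\preccurlyeq_r G$ for all $G\in\mathcal C$, all $G\in\mathcal C$ with $n=|V(G)|$, and all $m\in\mathbb N$ and $A\subseteq V(G)$ with $|A|\ge p_r(m)$: given $G$ (as adjacency lists, with the vertices numbered and the lists ordered arbitrarily), $r$ and $A$, the algorithm computes sets $S$ with $|S|\le s(r)$ and $B\subseteq A\setminus S$ with $|B|\ge m$, such that $B$ is $r$-independent in $G-S$, in at most $K\cdot\max(r,1)\cdot c\cdot|A|^{c+1}\cdot n^{1+\epsilon}$ steps. Here an algorithm is a fixed program of a random access machine with registers and arrays holding natural numbers, with assignments, addition, truncated subtraction, indexed array access, comparisons, branching and loops, in which every assignment and every test costs one step. -/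

import Mathlib

universe u

/-! ### Shallow minors, nowhere dense classes, independence at distance `r` -/

/-- `H` is a depth-`r` minor of `G`: there are pairwise vertex-disjoint connected subgraphs
`M i` of `G`, one for each vertex `i` of `H`, each of radius at most `r` (measured inside `M i`),
such that whenever `i`, `j` are adjacent in `H`, some edge of `G` joins `M i` to `M j`. -/
def IsDepthMinor {W V : Type*} (H : SimpleGraph W) (G : SimpleGraph V) (r : ℕ) : Prop :=
  ∃ M : W → G.Subgraph,
    (Pairwise fun i j => Disjoint (M i).verts (M j).verts) ∧
    (∀ i, (M i).Connected ∧ (M i).coe.radius ≤ (r : ℕ∞)) ∧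
    ∀ i j, H.Adj i j → ∃ x ∈ (M i).verts, ∃ y ∈ (M j).verts, G.Adj x y

/-- A class of graphs; only its finite members are ever considered. -/
abbrev GraphClass := ∀ V : Type u, SimpleGraph V → Prop

/-- No (finite) graph of the class `C` has the complete graph `K_c` as a depth-`r` minor. -/
def ExcludesClique (C : GraphClass.{u}) (c r : ℕ) : Prop :=
  ∀ (V : Type u) [Fintype V] (G : SimpleGraph V), C V G →
    ¬ IsDepthMinor (⊤ : SimpleGraph (Fin c)) G r

/-- `C` is nowhere dense. -/
def NowhereDense (C : GraphClass.{u}) : Prop :=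
  ∃ f : ℕ → ℕ, ∀ r, ExcludesClique C (f r) r

/-- Any two distinct vertices of `B` have distance greater than `r` in `G`
(the distance is `⊤` between different components). -/
def RIndependent {V : Type*} (G : SimpleGraph V) (r : ℕ) (B : Set V) : Prop :=
  B.Pairwise fun x y => (r : ℕ∞) < G.edist x y

/-- `B` consists of vertices of `G - S` and is `r`-independent in `G - S`. -/
def RIndependentAfterDeleting {V : Type*} (G : SimpleGraph V) (S : Finset V) (r : ℕ)
    (B : Finset V) : Prop :=
  Disjoint B S ∧
    RIndependent (G.induce {x : V | x ∉ S}) r {x | (x : V) ∈ B}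

/-! ### A random access machine with unit costs

Programs of a random access machine with scalar registers `0, 1, 2, …` and arrays `0, 1, 2, …`
(indexed by natural numbers), all holding natural numbers. The only arithmetic operations are
addition and truncated subtraction, so that each elementary step costs one unit. -/

namespace RAM

/-- A memory state: `reg x` is the content of register `x`, and `arr a i` is entry `i` of
array `a`. -/
structure State where
  reg : ℕ → ℕ
  arr : ℕ → ℕ → ℕ

/-- Programs. Register and array numbers are fixed in the program text, so that a program uses
only finitely many registers and arrays; array positions are read from registers. -/
inductive Prog : Type
  /-- `reg x := k` -/
  | const (x k : ℕ)
  /-- `reg x := reg y + reg z` -/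
  | add (x y z : ℕ)
  /-- `reg x := reg y - reg z` (truncated) -/
  | sub (x y z : ℕ)
  /-- `reg x := arr a (reg y)` -/
  | load (x a y : ℕ)
  /-- `arr a (reg y) := reg x` -/
  | store (a y x : ℕ)
  /-- first `P`, then `Q` -/
  | seq (P Q : Prog)
  /-- if `reg x < reg y` then `P` else `Q` -/
  | ite (x y : ℕ) (P Q : Prog)
  /-- while `reg x < reg y` do `P` -/
  | loop (x y : ℕ) (P : Prog)

/-- Assignment to a register. -/
def State.setReg (σ : State) (x v : ℕ) : State :=
  { σ with reg := Function.update σ.reg x v }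

/-- Assignment to an array entry. -/
def State.setArr (σ : State) (a i v : ℕ) : State :=
  { σ with arr := Function.update σ.arr a (Function.update (σ.arr a) i v) }

/-- `Runs P σ τ t`: started in state `σ`, the program `P` halts in state `τ` after exactly `t`
steps. Every assignment and every evaluation of a test is one step. -/
inductive Runs : Prog → State → State → ℕ → Prop
  | const (σ : State) (x k : ℕ) : Runs (.const x k) σ (σ.setReg x k) 1
  | add (σ : State) (x y z : ℕ) :
      Runs (.add x y z) σ (σ.setReg x (σ.reg y + σ.reg z)) 1
  | sub (σ : State) (x y z : ℕ) :
      Runs (.sub x y z) σ (σ.setReg x (σ.reg y - σ.reg z)) 1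
  | load (σ : State) (x a y : ℕ) :
      Runs (.load x a y) σ (σ.setReg x (σ.arr a (σ.reg y))) 1
  | store (σ : State) (a y x : ℕ) :
      Runs (.store a y x) σ (σ.setArr a (σ.reg y) (σ.reg x)) 1
  | seq {P Q : Prog} {σ τ ρ : State} {t t' : ℕ} :
      Runs P σ τ t → Runs Q τ ρ t' → Runs (.seq P Q) σ ρ (t + t')
  | ite_true {x y : ℕ} {P Q : Prog} {σ τ : State} {t : ℕ} :
      σ.reg x < σ.reg y → Runs P σ τ t → Runs (.ite x y P Q) σ τ (1 + t)
  | ite_false {x y : ℕ} {P Q : Prog} {σ τ : State} {t : ℕ} :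
      ¬ σ.reg x < σ.reg y → Runs Q σ τ t → Runs (.ite x y P Q) σ τ (1 + t)
  | loop_true {x y : ℕ} {P : Prog} {σ τ ρ : State} {t t' : ℕ} :
      σ.reg x < σ.reg y → Runs P σ τ t → Runs (.loop x y P) τ ρ t' →
        Runs (.loop x y P) σ ρ (1 + t + t')
  | loop_false {x y : ℕ} {P : Prog} {σ : State} :
      ¬ σ.reg x < σ.reg y → Runs (.loop x y P) σ σ 1

/-- The first `k` entries of the array `f` list the set `X` of vertices, each vertex once and in
any order, the vertices being numbered by `e`. -/
def Lists {V : Type*} {n : ℕ} (e : V ≃ Fin n) (f : ℕ → ℕ) (k : ℕ) (X : Set V) : Prop :=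
  Set.BijOn f (Set.Iio k) ((fun v => (e v : ℕ)) '' X)

/-- `σ` is an initial memory content that represents the input consisting of the graph `G`, the
vertex set `A` and the number `r`, where the vertices of `G` are numbered `0, …, n - 1` by `e`.
Registers `0, 1, 2` hold `n`, `r`, `|A|`. The graph is given by adjacency lists: the neighbours
of vertex number `i`, each once and in any order, are the entries of array `1` at the positions
from `arr 0 i` up to, but excluding, `arr 0 (i + 1)`. The first `|A|` entries of array `2`
list `A`. All other registers and array entries are zero. -/
structure IsInput {V : Type*} {n : ℕ} (e : V ≃ Fin n) (G : SimpleGraph V) (A : Finset V)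
    (r : ℕ) (σ : State) : Prop where
  reg_zero : σ.reg 0 = n
  reg_one : σ.reg 1 = r
  reg_two : σ.reg 2 = A.card
  reg_rest : ∀ x, 3 ≤ x → σ.reg x = 0
  start_zero : σ.arr 0 0 = 0
  start_le : ∀ i, i < n → σ.arr 0 i ≤ σ.arr 0 (i + 1)
  neighbors : ∀ v : V, Set.BijOn (σ.arr 1)
    (Set.Ico (σ.arr 0 (e v)) (σ.arr 0 ((e v : ℕ) + 1)))
    ((fun w => (e w : ℕ)) '' G.neighborSet v)
  list_A : Lists e (σ.arr 2) A.card (A : Set V)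
  start_rest : ∀ i, n < i → σ.arr 0 i = 0
  neighbors_rest : ∀ i, σ.arr 0 n ≤ i → σ.arr 1 i = 0
  list_A_rest : ∀ i, A.card ≤ i → σ.arr 2 i = 0
  arr_rest : ∀ a i, 3 ≤ a → σ.arr a i = 0

/-- The memory content `τ` represents the output `(S, B)`: registers `0` and `1` hold `|S|` and
`|B|`, and initial segments of arrays `3` and `4` list `S` and `B`. -/
structure IsOutput {V : Type*} {n : ℕ} (e : V ≃ Fin n) (S B : Finset V) (τ : State) : Prop where
  reg_zero : τ.reg 0 = S.card
  reg_one : τ.reg 1 = B.card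
  list_S : Lists e (τ.arr 3) S.card (S : Set V)
  list_B : Lists e (τ.arr 4) B.card (B : Set V)

end RAM

/-! Let `B` be independent at distance `k - 1` in `G - S`, put `h = k / 2`, and let `D` be the
largest number of elements of `B` within distance `h` of a single vertex. Call two distinct elements
at distance at most `k` in conflict. A connecting walk has a middle vertex; giving every vertex to
the nearby element for which it is the midpoint of most conflicts loses a factor of at most `D`. For
any `T ⊆ B` this turns the remaining conflicts into arcs of a shallow minor with vertex set `T`
(`exists_minor_of_conflicts`). Shallow minors of graphs in the class satisfy `arcs ^ 2 ≤ K * n ^ 3`,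
so some element of `T` has at most `√(K D² |T|)` conflicts (`exists_few_conflicts`). Greedy
selection then yields a set `I`, independent at distance `k`, with `|B| ≤ |I| (√(K D² |B|) + 1)`.
With `M = max(D, |I|)` this gives `|B| ≤ (2K + 2) M ^ 4`. Hence one of two replacements for `B` is
polynomially large: the set `I`, or the set of elements near one vertex, a hub, which is then
deleted before the same distance is tried again.

Hubs are few. Each hub deleted at distance `k` has a neighbour in the ball of radius `h - 1` around
every surviving element, and these balls are disjoint. Joining `c` hubs to `c` balls one by one
gives `K_c` as a shallow minor (`minor_clique_of_touches`), so there are fewer than `c` hubs for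
each `k`. After all distances up to `r`, at most `r c` vertices have been deleted.

To get below `c` deletions in total, the deleted vertices are reconsidered one at a time. If fewer
than half of `B` is within distance `r / 2` of `v`, then `v` is returned to the graph and these
elements are dropped (`Pruning.drop`); otherwise only these elements are kept (`Pruning.keep`). In
the end every deleted vertex touches a ball around every element of `B`, and the clique argument
applies once more (`Pruning.card_lt`). There are at most `2 r c` rounds, each costing at most a
fourth power up to the constant, so `|A| ≤ ((2K + 2) |B|) ^ 4 ^ (2 r c)`.

The density bound `exists_density_bound` is proved by induction on `k`: a graph with more than about
`n ^ (1 + 1 / k)` arcs contracts, at depth one, to a minor on few vertices that still has linearly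
many arcs in terms of the original order, and is thus denser in terms of its own. The case `k = 2`
controls conflicts; large `k` bounds the input size by `n ^ (1 + ε)`.

The procedure is one fixed program that does not know `c`, `m` or `K`. It needs `O(|A| ^ 2)`
breadth-first searches per round. The existence statement is obtained by running it. -/

namespace QuasiWide

open Finset
open scoped Classical

/-! ### Balls inside a vertex set -/

section Balls

variable {V : Type*} {G : SimpleGraph V} {X Y : Set V} {u v w : V} {a b k l : ℕ}

/-- The vertices that can be reached from `u` by a walk of length at most `k` inside `X`. -/
def ballIn (G : SimpleGraph V) (X : Set V) : ℕ → V → Set V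
  | 0, u => {w | w = u ∧ u ∈ X}
  | k + 1, u => ballIn G X k u ∪ {w | w ∈ X ∧ ∃ v ∈ ballIn G X k u, G.Adj v w}

lemma mem_ballIn_zero : w ∈ ballIn G X 0 u ↔ w = u ∧ u ∈ X := Iff.rfl

lemma mem_ballIn_succ : w ∈ ballIn G X (k + 1) u ↔
    w ∈ ballIn G X k u ∨ w ∈ X ∧ ∃ v ∈ ballIn G X k u, G.Adj v w := Iff.rfl

lemma ballIn_subset : ballIn G X k u ⊆ X := by
  induction k with
  | zero => rintro w ⟨rfl, h⟩; exact h
  | succ k ih =>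
    rintro w (h | h)
    · exact ih h
    · exact h.1

lemma mem_ballIn_self (h : u ∈ X) : u ∈ ballIn G X k u := by
  induction k with
  | zero => exact ⟨rfl, h⟩
  | succ k ih => exact Or.inl ih

lemma ballIn_mono (hXY : X ⊆ Y) (hkl : k ≤ l) : ballIn G X k u ⊆ ballIn G Y l u := by
  have h1 : ∀ k, ballIn G X k u ⊆ ballIn G Y k u := by
    intro k
    induction k with
    | zero => rintro w ⟨rfl, h⟩; exact ⟨rfl, hXY h⟩
    | succ k ih =>
      rintro w (h | ⟨h, v, hv, hvw⟩)
      · exact Or.inl (ih h)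
      · exact Or.inr ⟨hXY h, v, ih hv, hvw⟩
  refine (h1 k).trans ?_
  induction hkl with
  | refl => exact subset_rfl
  | step _ ih => exact ih.trans fun _ h => Or.inl h

lemma ballIn_trans (h₁ : v ∈ ballIn G X a u) (h₂ : w ∈ ballIn G X b v) :
    w ∈ ballIn G X (a + b) u := by
  induction b generalizing w with
  | zero => rw [mem_ballIn_zero] at h₂; rw [h₂.1]; exact h₁
  | succ b ih =>
    rcases h₂ with h | ⟨h, x, hx, hxw⟩
    · exact Or.inl (ih h)
    · exact Or.inr ⟨h, x, ih hx, hxw⟩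

lemma ballIn_adj (h : v ∈ ballIn G X a u) (hw : w ∈ X) (hvw : G.Adj v w) :
    w ∈ ballIn G X (a + 1) u := Or.inr ⟨hw, v, h, hvw⟩

lemma mem_ballIn_symm (h : w ∈ ballIn G X k u) : u ∈ ballIn G X k w := by
  induction k generalizing w with
  | zero => obtain ⟨rfl, h⟩ := h; exact ⟨rfl, h⟩
  | succ k ih =>
    rcases h with h | ⟨h, x, hx, hxw⟩
    · exact Or.inl (ih h)
    · have h1 : x ∈ ballIn G X 1 w :=
        ballIn_adj (mem_ballIn_self (k := 0) h) (ballIn_subset hx) hxw.symm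
      rw [add_comm]
      exact ballIn_trans h1 (ih hx)

lemma mem_ballIn_comm : w ∈ ballIn G X k u ↔ u ∈ ballIn G X k w :=
  ⟨mem_ballIn_symm, mem_ballIn_symm⟩

lemma exists_mem_ballIn_of_add (h : w ∈ ballIn G X (a + b) u) :
    ∃ v ∈ ballIn G X a u, w ∈ ballIn G X b v := by
  induction b generalizing w with
  | zero => exact ⟨w, h, mem_ballIn_self (ballIn_subset h)⟩
  | succ b ih =>
    rcases h with h | ⟨h, x, hx, hxw⟩
    · obtain ⟨v, hv, hw⟩ := ih h
      exact ⟨v, hv, Or.inl hw⟩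
    · obtain ⟨v, hv, hw⟩ := ih hx
      exact ⟨v, hv, Or.inr ⟨h, x, hw, hxw⟩⟩

/-- Every vertex on a walk of length at most `k` from `u` is itself within distance `k` of `u`.
Balls can therefore serve as connected branch sets of bounded radius. -/
lemma ballIn_subset_ballIn_self : ballIn G X k u ⊆ ballIn G (ballIn G X k u) k u := by
  have key : ∀ l ≤ k, ballIn G X l u ⊆ ballIn G (ballIn G X k u) l u := by
    intro l
    induction l with
    | zero => rintro _ w ⟨rfl, h⟩; exact ⟨rfl, mem_ballIn_self h⟩
    | succ l ih =>
      intro hl w hw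
      rcases hw with h | ⟨h, x, hx, hxw⟩
      · exact Or.inl (ih (by omega) h)
      · exact Or.inr ⟨ballIn_mono subset_rfl hl (ballIn_adj hx h hxw), x, ih (by omega) hx, hxw⟩
  exact key k le_rfl

lemma ballIn_subset_diff (h : v ∉ ballIn G X k u) :
    ballIn G X k u ⊆ ballIn G (X \ {v}) k u := by
  refine ballIn_subset_ballIn_self.trans (ballIn_mono ?_ le_rfl)
  exact fun w hw => ⟨ballIn_subset hw, fun e => h (e ▸ hw)⟩

/-- Stop a shortest walk from `u` just before it reaches `v`: what remains avoids `v`. This is how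
being near a vertex becomes touching it after its deletion. -/
lemma exists_adj_of_mem_ballIn (h : v ∈ ballIn G X k u) (hne : v ≠ u) :
    ∃ w ∈ ballIn G (X \ {v}) (k - 1) u, G.Adj w v := by
  induction k with
  | zero => exact absurd h.1 hne
  | succ k ih =>
    by_cases hk : v ∈ ballIn G X k u
    · obtain ⟨w, hw, hwv⟩ := ih hk
      exact ⟨w, ballIn_mono subset_rfl (by omega) hw, hwv⟩
    · rcases h with h | ⟨_, x, hx, hxv⟩
      · exact absurd h hk
      · exact ⟨x, ballIn_subset_diff hk hx, hxv⟩

lemma mem_ballIn_of_edist_le {X : Set V} (x y : X) (r : ℕ)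
    (h : (G.induce X).edist x y ≤ r) : (y : V) ∈ ballIn G X r x := by
  have hw : ∀ (x y : X) (p : (G.induce X).Walk x y), (y : V) ∈ ballIn G X p.length x := by
    intro x y p
    induction p with
    | nil => exact mem_ballIn_self (Subtype.property _)
    | @cons x z y hxz p ih =>
      rw [SimpleGraph.Walk.length_cons, add_comm]
      exact ballIn_trans (ballIn_adj (mem_ballIn_self (k := 0) x.2) z.2 hxz) ih
  have hne : (G.induce X).edist x y ≠ ⊤ := by
    intro h'
    rw [h'] at h
    exact absurd h (by simp)
  obtain ⟨p, hp⟩ := SimpleGraph.exists_walk_of_edist_ne_top hne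
  rw [← hp] at h
  exact ballIn_mono subset_rfl (by exact_mod_cast h) (hw x y p)

/-- Any two distinct vertices of `B` are joined by no walk of length at most `k` inside `X`. -/
def IndepIn (G : SimpleGraph V) (X : Set V) (k : ℕ) (B : Finset V) : Prop :=
  ∀ x ∈ B, ∀ y ∈ B, y ∈ ballIn G X k x → x = y

lemma IndepIn.mono {B B' : Finset V} (h : IndepIn G X k B) (hXY : Y ⊆ X) (hlk : l ≤ k)
    (hB : B' ⊆ B) : IndepIn G Y l B' :=
  fun x hx y hy hxy => h x (hB hx) y (hB hy) (ballIn_mono hXY hlk hxy)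

lemma IndepIn.rIndependentAfterDeleting {S B : Finset V} {r : ℕ}
    (hBS : ∀ b ∈ B, b ∉ S) (h : IndepIn G {x | x ∉ S} r B) :
    RIndependentAfterDeleting G S r B := by
  refine ⟨Finset.disjoint_left.2 hBS, ?_⟩
  intro x hx y hy hxy
  by_contra hle
  exact hxy (Subtype.ext (h x hx y hy (mem_ballIn_of_edist_le x y r (not_lt.1 hle))))

end Balls

/-! ### Shallow minors -/

section Minors

variable {U W V : Type*} {J : SimpleGraph U} {H : SimpleGraph W} {G : SimpleGraph V} {r s : ℕ}

/-- `H` is a depth-`r` minor of `G`, given by branch sets and centres. -/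
def Minor (H : SimpleGraph W) (G : SimpleGraph V) (r : ℕ) : Prop :=
  ∃ (B : W → Set V) (c : W → V),
    (∀ i j x, x ∈ B i → x ∈ B j → i = j) ∧
    (∀ i, c i ∈ B i) ∧
    (∀ i, ∀ x ∈ B i, x ∈ ballIn G (B i) r (c i)) ∧
    ∀ i j, H.Adj i j → ∃ x ∈ B i, ∃ y ∈ B j, G.Adj x y

lemma Minor.mono (h : Minor H G r) (hrs : r ≤ s) : Minor H G s := by
  obtain ⟨B, c, h1, h2, h3, h4⟩ := h
  exact ⟨B, c, h1, h2, fun i x hx => ballIn_mono subset_rfl hrs (h3 i x hx), h4⟩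

/-- The subgraphs of `G` induced on the branch sets are the required connected subgraphs. Only this
direction matters, since clique minors are constructed only to contradict their exclusion. -/
lemma Minor.isDepthMinor (h : Minor H G r) : IsDepthMinor H G r := by
  obtain ⟨B, c, h1, h2, h3, h4⟩ := h
  have hd : ∀ (i : W) (k : ℕ) (x : V) (hx : x ∈ B i), x ∈ ballIn G (B i) k (c i) →
      ((⊤ : G.Subgraph).induce (B i)).coe.edist ⟨c i, h2 i⟩ ⟨x, hx⟩ ≤ k := by
    intro i k
    induction k with
    | zero =>
      rintro x hx ⟨rfl, -⟩
      simp
    | succ k ih =>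
      intro x hx hxk
      rcases hxk with h | ⟨-, y, hy, hyx⟩
      · exact (ih x hx h).trans (by exact_mod_cast Nat.le_succ k)
      · have hyB := ballIn_subset hy
        refine (SimpleGraph.edist_triangle (v := ⟨y, hyB⟩)).trans ?_
        have h1 : ((⊤ : G.Subgraph).induce (B i)).coe.edist ⟨y, hyB⟩ ⟨x, hx⟩ ≤ 1 := by
          rw [SimpleGraph.edist_eq_one_iff_adj.2]
          simp [hyx, hyB, hx]
        push_cast
        exact add_le_add (ih y hyB hy) h1
  refine ⟨fun i => (⊤ : G.Subgraph).induce (B i), ?_, ?_, ?_⟩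
  · intro i j hij
    rw [Set.disjoint_left]
    exact fun x hx hy => hij (h1 i j x hx hy)
  · intro i
    have hd' : ∀ x : B i, ((⊤ : G.Subgraph).induce (B i)).coe.edist ⟨c i, h2 i⟩ x ≤ r :=
      fun x => hd i r x x.2 (h3 i x x.2)
    constructor
    · rw [SimpleGraph.Subgraph.connected_iff']
      refine SimpleGraph.Connected.mk (nonempty := ⟨⟨c i, h2 i⟩⟩) fun x y => ?_
      have hr : ∀ x : B i, ((⊤ : G.Subgraph).induce (B i)).coe.Reachable ⟨c i, h2 i⟩ x := by
        intro x
        apply SimpleGraph.reachable_of_edist_ne_top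
        intro h
        have := hd' x
        rw [h] at this
        exact absurd this (by simp)
      exact (hr x).symm.trans (hr y)
    · refine (iInf_le _ (⟨c i, h2 i⟩ : B i)).trans ?_
      exact iSup_le hd'
  · intro i j hij
    exact h4 i j hij

lemma Minor.comap (h : Minor H G r) (f : U → W) (hf : Function.Injective f)
    (hadj : ∀ i j, J.Adj i j → H.Adj (f i) (f j)) : Minor J G r := by
  obtain ⟨B, c, h1, h2, h3, h4⟩ := h
  exact ⟨fun i => B (f i), fun i => c (f i), fun i j x hx hy => hf (h1 _ _ x hx hy),
    fun i => h2 _, fun i => h3 _, fun i j hij => h4 _ _ (hadj i j hij)⟩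

lemma minor_induce (X : Set V) : Minor (G.induce X) G 0 :=
  ⟨fun x => {(x : V)}, fun x => x,
    fun _ _ _ hx hy => Subtype.ext ((Set.mem_singleton_iff.1 hx).symm.trans hy),
    fun _ => rfl, fun _ _ hx => ⟨hx, rfl⟩, fun i j hij => ⟨i, rfl, j, rfl, hij⟩⟩

/-- One step between adjacent centres of `H` costs `2 * b + 1` edges of `G`: out of one branch set,
across, and in to the next centre. At most `a` such steps are followed by a walk of length `b`
inside the last branch set. -/
lemma Minor.trans {a b : ℕ} (h₁ : Minor J H a) (h₂ : Minor H G b) :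
    Minor J G ((2 * b + 1) * a + b) := by
  obtain ⟨B, c, hB1, hB2, hB3, hB4⟩ := h₁
  obtain ⟨B', c', hC1, hC2, hC3, hC4⟩ := h₂
  refine ⟨fun j => {x | ∃ i ∈ B j, x ∈ B' i}, fun j => c' (c j), ?_, ?_, ?_, ?_⟩
  · rintro i j x ⟨p, hp, hxp⟩ ⟨q, hq, hxq⟩
    obtain rfl := hC1 p q x hxp hxq
    exact hB1 i j p hp hq
  · exact fun j => ⟨c j, hB2 j, hC2 _⟩
  · intro j
    have hsub : ∀ i ∈ B j, B' i ⊆ {x | ∃ i ∈ B j, x ∈ B' i} := fun i hi x hx => ⟨i, hi, hx⟩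
    have key : ∀ k, ∀ i ∈ ballIn H (B j) k (c j),
        c' i ∈ ballIn G {x | ∃ i ∈ B j, x ∈ B' i} ((2 * b + 1) * k) (c' (c j)) := by
      intro k
      induction k with
      | zero =>
        rintro i ⟨rfl, h⟩
        exact mem_ballIn_self ⟨_, h, hC2 _⟩
      | succ k ih =>
        rintro i (h | ⟨h, p, hp, hpi⟩)
        · exact ballIn_mono subset_rfl (by gcongr; omega) (ih i h)
        · obtain ⟨x, hx, y, hy, hxy⟩ := hC4 p i hpi
          have e1 := ballIn_trans (ih p hp)
            (ballIn_mono (hsub p (ballIn_subset hp)) le_rfl (hC3 p x hx))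
          have e2 := ballIn_adj e1 (hsub i h hy) hxy
          have e3 := ballIn_trans e2
            (ballIn_mono (hsub i h) le_rfl (mem_ballIn_symm (hC3 i y hy)))
          exact ballIn_mono subset_rfl (by ring_nf; omega) e3
    rintro x ⟨i, hi, hx⟩
    exact ballIn_trans (key a i (hB3 j i hi)) (ballIn_mono (hsub i hi) le_rfl (hC3 i x hx))
  · intro i j hij
    obtain ⟨p, hp, q, hq, hpq⟩ := hB4 i j hij
    obtain ⟨x, hx, y, hy, hxy⟩ := hC4 p q hpq
    exact ⟨x, ⟨p, hp, hx⟩, y, ⟨q, hq, hy⟩, hxy⟩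

end Minors

/-! ### The edge density of graphs without shallow clique minors -/

section Density

/-- The degree of `v`. -/
noncomputable def deg {V : Type*} [Fintype V] (G : SimpleGraph V) (v : V) : ℕ :=
  #{w | G.Adj v w}

/-- The number of ordered pairs of adjacent vertices. -/
noncomputable def arcs {V : Type*} [Fintype V] (G : SimpleGraph V) : ℕ := ∑ v, deg G v

variable {V : Type*} {G : SimpleGraph V}

lemma arcs_lt_arcs [Fintype V] {H : SimpleGraph V} (hle : G ≤ H) {a b : V}
    (hG : ¬ G.Adj a b) (hH : H.Adj a b) : arcs G < arcs H := by
  refine Finset.sum_lt_sum (fun v _ => ?_) ⟨a, Finset.mem_univ _, ?_⟩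
  · exact Finset.card_le_card fun w hw => by
      simp only [Finset.mem_filter, Finset.mem_univ, true_and] at hw ⊢
      exact hle hw
  · refine Finset.card_lt_card ⟨fun w hw => ?_, fun h => hG ?_⟩
    · simp only [Finset.mem_filter, Finset.mem_univ, true_and] at hw ⊢
      exact hle hw
    · simpa using h (show b ∈ _ by simpa using hH)

/-- Greedy choice with the potential `∑ v, (t - |N(v) ∩ A|)`, truncated at zero. It starts at `t *
n`, and as long as more than half of the vertices are deficient, some new vertex lowers it by at
least `δ / 4`. -/
lemma exists_sparse_set_with_many_neighbors [Fintype V] {t δ : ℕ} (hδ : 2 * t ≤ δ) (hδ0 : 0 < δ)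
    (hdeg : ∀ v, δ ≤ deg G v) :
    ∃ A D : Finset V, #A * δ ≤ 4 * t * Fintype.card V + δ ∧
      (∀ v, v ∉ D → t ≤ #{w ∈ A | G.Adj v w}) ∧ 2 * #D ≤ Fintype.card V := by
  set n := Fintype.card V with hn
  have key : ∀ k : ℕ, ∃ A : Finset V, #A ≤ k ∧
      (2 * #{v | #{w ∈ A | G.Adj v w} < t} ≤ n ∨
        4 * ∑ v, (t - #{w ∈ A | G.Adj v w}) + k * δ ≤ 4 * t * n) := by
    intro k
    induction k with
    | zero =>
      refine ⟨∅, by simp, Or.inr ?_⟩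
      simp [← hn]
      apply le_of_eq; ring
    | succ k ih =>
      obtain ⟨A, hA, h | h⟩ := ih
      · exact ⟨A, by omega, Or.inl h⟩
      by_cases hd : 2 * #{v | #{w ∈ A | G.Adj v w} < t} ≤ n
      · exact ⟨A, by omega, Or.inl hd⟩
      set D : Finset V := {v | #{w ∈ A | G.Adj v w} < t} with hD
      -- Double counting: each deficient vertex has fewer than `t ≤ δ / 2` neighbours in `A`, hence
      -- at least `δ / 2` outside, and more than half of all vertices are deficient.
      obtain ⟨w, hwA, hw⟩ : ∃ w, w ∉ A ∧ δ ≤ 4 * #{v ∈ D | G.Adj v w} := by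
        by_contra! hcon
        have h1 : ∑ w ∈ Aᶜ, 4 * #{v ∈ D | G.Adj v w} ≤ n * δ := by
          calc ∑ w ∈ Aᶜ, 4 * #{v ∈ D | G.Adj v w} ≤ ∑ w ∈ Aᶜ, δ :=
                Finset.sum_le_sum fun w hw => (hcon w (by simpa using hw)).le
            _ ≤ n * δ := by
                rw [Finset.sum_const, smul_eq_mul]
                exact Nat.mul_le_mul_right _ (Finset.card_le_univ _)
        have h2 : ∑ w ∈ Aᶜ, #{v ∈ D | G.Adj v w} = ∑ v ∈ D, #{w ∈ Aᶜ | G.Adj v w} := by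
          simp only [Finset.card_filter]
          exact Finset.sum_comm
        have h3 : ∑ v ∈ D, δ ≤ ∑ v ∈ D, 2 * #{w ∈ Aᶜ | G.Adj v w} := by
          refine Finset.sum_le_sum fun v hv => ?_
          have hv' : #{w ∈ A | G.Adj v w} < t := by simpa [hD] using hv
          have h4 : deg G v = #{w ∈ A | G.Adj v w} + #{w ∈ Aᶜ | G.Adj v w} := by
            rw [deg, ← Finset.card_union_of_disjoint]
            · congr 1; ext w; by_cases hw : w ∈ A <;> simp [hw]
            · rw [Finset.disjoint_left]; intro w hw hw'
              simp at hw hw'; tauto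
          have := hdeg v
          omega
        rw [← Finset.mul_sum, h2] at h1
        rw [← Finset.mul_sum, Finset.sum_const, smul_eq_mul] at h3
        have h5 : n * δ < 2 * #D * δ := Nat.mul_lt_mul_of_pos_right (by omega) hδ0
        nlinarith
      refine ⟨insert w A, (Finset.card_insert_le _ _).trans (by omega), Or.inr ?_⟩
      have h6 : ∑ v, (t - #{x ∈ insert w A | G.Adj v x}) + #{v ∈ D | G.Adj v w} ≤
          ∑ v, (t - #{x ∈ A | G.Adj v x}) := by
        have e : #{v ∈ D | G.Adj v w} = ∑ v, if v ∈ D ∧ G.Adj v w then 1 else 0 := by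
          rw [← Finset.card_filter]
          congr 1; ext v; simp
        rw [e, ← Finset.sum_add_distrib]
        refine Finset.sum_le_sum fun v _ => ?_
        rw [Finset.filter_insert]
        by_cases hvw : G.Adj v w
        · have hw' : w ∉ ({x ∈ A | G.Adj v x} : Finset V) := by simp [hwA]
          rw [if_pos hvw, Finset.card_insert_of_notMem hw']
          by_cases hv : v ∈ D
          · have hv' : #{w ∈ A | G.Adj v w} < t := by simpa [hD] using hv
            rw [if_pos ⟨hv, hvw⟩]; omega
          · rw [if_neg (by tauto)]; omega
        · rw [if_neg hvw, if_neg (by tauto)]; omega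
      rw [add_mul]
      omega
  -- One step more than the potential allows, so the second alternative is impossible.
  obtain ⟨A, hA, h | h⟩ := key (4 * t * n / δ + 1)
  · refine ⟨A, ({v | #{w ∈ A | G.Adj v w} < t} : Finset V), ?_, fun v hv => by simpa using hv, h⟩
    calc #A * δ ≤ (4 * t * n / δ + 1) * δ := Nat.mul_le_mul_right _ hA
      _ = 4 * t * n / δ * δ + δ := by ring
      _ ≤ _ := Nat.add_le_add_right (Nat.div_mul_le_self _ _) _
  · exfalso
    have := Nat.lt_div_mul_add (a := 4 * t * n) hδ0
    rw [add_mul] at h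
    omega

/-- Contract each `u ∈ U` into `φ u`: the branch sets are stars centred in `A`, and an edge of `G`
from `u` to another vertex of `A` becomes an edge of the minor. -/
lemma minor_of_subdivision {A : Finset V} {H : SimpleGraph A} {U : Finset V} {φ : V → V}
    (hAU : Disjoint A U) (hφ : ∀ u ∈ U, G.Adj u (φ u))
    (hH : ∀ a b : A, H.Adj a b →
      ∃ u ∈ U, φ u = a ∧ G.Adj u b ∨ φ u = b ∧ G.Adj u a) : Minor H G 1 := by
  have hd := Finset.disjoint_left.1 hAU
  refine ⟨fun a => {x | x = a ∨ x ∈ U ∧ φ x = a}, fun a => a, ?_, fun a => Or.inl rfl, ?_, ?_⟩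
  · rintro a b x (rfl | ⟨hx, hxa⟩) (hb | ⟨hx', hxb⟩)
    · exact Subtype.ext hb
    · exact absurd hx' (hd a.2)
    · exact absurd hx (by rw [hb]; exact hd b.2)
    · exact Subtype.ext (hxa.symm.trans hxb)
  · rintro a x hx
    rcases id hx with rfl | ⟨hxU, hxa⟩
    · exact mem_ballIn_self hx
    · refine Or.inr ⟨hx, a, ⟨rfl, Or.inl rfl⟩, ?_⟩
      rw [← hxa]
      exact (hφ x hxU).symm
  · intro a b hab
    obtain ⟨u, hu, ⟨h1, h2⟩ | ⟨h1, h2⟩⟩ := hH a b hab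
    · exact ⟨u, Or.inr ⟨hu, h1⟩, b, Or.inl rfl, h2⟩
    · exact ⟨a, Or.inl rfl, u, Or.inr ⟨hu, h1⟩, h2.symm⟩

lemma minor_clique_of_pairwise {W : Type*} {H : SimpleGraph W} {t : ℕ} {r : ℕ} (h : Minor H G r)
    (N : Finset W) (hN : t ≤ #N) (hadj : ∀ a ∈ N, ∀ b ∈ N, a ≠ b → H.Adj a b) :
    Minor (⊤ : SimpleGraph (Fin t)) G r := by
  let f : Fin t → W := fun i => (N.equivFin.symm (Fin.castLE hN i) : N)
  have hf : Function.Injective f := fun i j hij =>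
    Fin.castLE_injective hN (N.equivFin.symm.injective (Subtype.ext hij))
  refine h.comap f hf fun i j hij => hadj _ (Subtype.property _) _ (Subtype.property _) ?_
  exact fun e => hij (hf e)

/-- The vertices of `U` are contracted one at a time, each creating a new edge on `A`. This never
gets stuck: if the neighbours of `u` in `A` were already pairwise adjacent in the current minor,
they would give `K_t`. -/
lemma exists_minor_on_dominators {A U : Finset V} {t : ℕ} (hAU : Disjoint A U)
    (hU : ∀ u ∈ U, t ≤ #{w ∈ A | G.Adj u w})
    (hK : ¬ Minor (⊤ : SimpleGraph (Fin t)) G 1) :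
    ∃ H : SimpleGraph A, Minor H G 1 ∧ #U ≤ arcs H := by
  suffices h : ∀ U' ⊆ U, ∃ (H : SimpleGraph A) (φ : V → V), (∀ u ∈ U', G.Adj u (φ u)) ∧
      (∀ a b : A, H.Adj a b → ∃ u ∈ U', φ u = a ∧ G.Adj u b ∨ φ u = b ∧ G.Adj u a) ∧
      #U' ≤ arcs H by
    obtain ⟨H, φ, h1, h2, h3⟩ := h U subset_rfl
    exact ⟨H, minor_of_subdivision hAU h1 h2, h3⟩
  intro U'
  induction U' using Finset.induction_on with
  | empty => exact fun _ => ⟨⊥, id, by simp, by simp, by simp⟩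
  | insert u U' hu ih =>
    intro hsub
    obtain ⟨hu', hsub'⟩ := Finset.insert_subset_iff.1 hsub
    obtain ⟨H, φ, h1, h2, h3⟩ := ih hsub'
    have hM : Minor H G 1 := minor_of_subdivision (Finset.disjoint_of_subset_right hsub' hAU) h1 h2
    have hcard : t ≤ #{a : A | G.Adj u a} := by
      refine (hU u hu').trans (Finset.card_le_card_of_surjOn (fun a : A => (a : V)) ?_)
      intro w hw
      simp only [Finset.coe_filter, Set.mem_ofPred_eq] at hw
      exact ⟨⟨w, hw.1⟩, by simpa using hw.2, rfl⟩
    obtain ⟨a, ha, b, hb, hab, hnadj⟩ : ∃ a : A, G.Adj u a ∧ ∃ b : A, G.Adj u b ∧ a ≠ b ∧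
        ¬ H.Adj a b := by
      by_contra! hcon
      refine hK (minor_clique_of_pairwise hM _ hcard fun a ha b hb hab => ?_)
      simp only [Finset.mem_filter, Finset.mem_univ, true_and] at ha hb
      exact hcon a ha b hb hab
    refine ⟨H ⊔ SimpleGraph.edge a b, Function.update φ u a, ?_, ?_, ?_⟩
    · intro x hx
      rcases Finset.mem_insert.1 hx with rfl | hx
      · simpa using ha
      · rw [Function.update_of_ne (ne_of_mem_of_not_mem hx hu)]
        exact h1 x hx
    · intro x y hxy
      rw [SimpleGraph.sup_adj, SimpleGraph.edge_adj] at hxy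
      rcases hxy with hxy | ⟨⟨rfl, rfl⟩ | ⟨rfl, rfl⟩, -⟩
      · obtain ⟨z, hz, hz'⟩ := h2 x y hxy
        refine ⟨z, Finset.mem_insert_of_mem hz, ?_⟩
        rwa [Function.update_of_ne (ne_of_mem_of_not_mem hz hu)]
      · exact ⟨u, Finset.mem_insert_self _ _, Or.inl ⟨by simp, hb⟩⟩
      · exact ⟨u, Finset.mem_insert_self _ _, Or.inr ⟨by simp, hb⟩⟩
    · rw [Finset.card_insert_of_notMem hu]
      have := arcs_lt_arcs (G := H) (H := H ⊔ SimpleGraph.edge a b) le_sup_left hnadj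
        (by rw [SimpleGraph.sup_adj, SimpleGraph.edge_adj]; exact Or.inr ⟨Or.inl ⟨rfl, rfl⟩, hab⟩)
      omega

/-- In a smallest nonempty set whose average degree is at least that of `G`, no vertex has less than
half that average, since removing it would not lower the average. -/
lemma exists_large_min_degree [Fintype V] (hE : 0 < arcs G) :
    ∃ X : Finset V, X.Nonempty ∧
      ∀ v ∈ X, arcs G ≤ 2 * #{w ∈ X | G.Adj v w} * Fintype.card V := by
  set n := Fintype.card V with hn
  let a : Finset V → ℕ := fun X => ∑ v ∈ X, #{w ∈ X | G.Adj v w}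
  let F : Finset (Finset V) := {X | X.Nonempty ∧ arcs G * #X ≤ a X * n}
  have hne : (Finset.univ : Finset V).Nonempty := by
    rw [Finset.nonempty_iff_ne_empty]
    intro h
    simp [arcs, h] at hE
  have hF : F.Nonempty := by
    refine ⟨Finset.univ, ?_⟩
    simp only [F, Finset.mem_filter, Finset.mem_univ, true_and]
    exact ⟨hne, by simp [a, arcs, deg, hn]⟩
  obtain ⟨X, hX, hmin⟩ := Finset.exists_min_image F Finset.card hF
  simp only [F, Finset.mem_filter, Finset.mem_univ, true_and] at hX hmin
  refine ⟨X, hX.1, fun v hv => ?_⟩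
  by_contra! hlt
  -- Removing `v` loses its own arcs and at most as many arcs ending in `v`.
  have h1 : a X ≤ a (X.erase v) + 2 * #{w ∈ X | G.Adj v w} := by
    have e1 : a X = ∑ x ∈ X.erase v, #{w ∈ X | G.Adj x w} + #{w ∈ X | G.Adj v w} :=
      (Finset.sum_erase_add X (fun x => #{w ∈ X | G.Adj x w}) hv).symm
    have e2 : ∑ x ∈ X.erase v, #{w ∈ X | G.Adj x w} ≤
        ∑ x ∈ X.erase v, (#{w ∈ X.erase v | G.Adj x w} + if G.Adj v x then 1 else 0) := by
      refine Finset.sum_le_sum fun x _ => ?_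
      have hsub : ({w ∈ X | G.Adj x w} : Finset V) ⊆
          {w ∈ X.erase v | G.Adj x w} ∪ (if G.Adj v x then {v} else ∅) := by
        intro w hw
        simp only [Finset.mem_filter] at hw
        by_cases hwv : w = v
        · subst hwv
          rw [if_pos hw.2.symm]
          simp
        · simp [hw, hwv]
      refine (Finset.card_le_card hsub).trans ((Finset.card_union_le _ _).trans ?_)
      gcongr
      split_ifs <;> simp
    rw [Finset.sum_add_distrib] at e2
    have e3 : (∑ x ∈ X.erase v, if G.Adj v x then 1 else 0) ≤ #{w ∈ X | G.Adj v w} := by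
      rw [← Finset.card_filter]
      exact Finset.card_le_card (Finset.filter_subset_filter _ (Finset.erase_subset _ _))
    simp only [a] at e1 ⊢
    omega
  have h2 : #X = #(X.erase v) + 1 := (Finset.card_erase_add_one hv).symm
  have h3 : arcs G * #(X.erase v) < a (X.erase v) * n := by
    have := hX.2
    rw [h2] at this
    nlinarith
  have h4 : (X.erase v).Nonempty := by
    rw [Finset.nonempty_iff_ne_empty]
    intro h
    simp [h, a] at h3
  have := hmin _ ⟨h4, h3.le⟩
  omega

lemma card_induce_filter (X : Finset V) (v : X) :
    deg (G.induce (X : Set V)) v = #{w ∈ X | G.Adj v w} := by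
  rw [deg]
  refine Finset.card_bij (fun w _ => (w : V)) ?_ ?_ ?_
  · intro w hw
    have := w.2
    simpa using hw
  · exact fun a _ b _ h => Subtype.ext h
  · intro b hb
    rw [Finset.mem_filter] at hb
    exact ⟨⟨b, hb.1⟩, by simpa using hb.2, rfl⟩

lemma arcs_le_sq [Fintype V] : arcs G ≤ Fintype.card V ^ 2 := by
  calc arcs G ≤ ∑ _v : V, Fintype.card V := Finset.sum_le_sum fun v _ => Finset.card_le_univ _
    _ = _ := by simp [sq]

/-- One step of the density increment: `n ^ k * arcs ≤ …` for a minor on few vertices. -/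
lemma density_step {k t d K : ℕ}
    (ih : ∀ (V : Type u) [Fintype V] (G : SimpleGraph V),
      ¬ Minor (⊤ : SimpleGraph (Fin t)) G d → arcs G ^ k ≤ K * Fintype.card V ^ (k + 1))
    (V : Type u) [Fintype V] (G : SimpleGraph V)
    (hG : ¬ Minor (⊤ : SimpleGraph (Fin t)) G (3 * d + 1)) :
    arcs G ^ (k + 1) ≤
      ((40 * t) ^ (k + 1) + 4 ^ k * K * (10 * t) ^ (k + 1)) * Fintype.card V ^ (k + 2) := by
  set n := Fintype.card V with hn
  rcases Nat.eq_zero_or_pos (arcs G) with hE | hE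
  · rw [hE]; simp
  obtain ⟨X, hX, hdegX⟩ := exists_large_min_degree hE
  have hn0 : 0 < n := Fintype.card_pos_iff.2 ⟨hX.choose⟩
  obtain ⟨v₀, hv₀, hv₀min⟩ := Finset.exists_min_image X (fun v => #{w ∈ X | G.Adj v w}) hX
  set δ := #{w ∈ X | G.Adj v₀ w} with hδ
  have hEδ : arcs G ≤ 2 * δ * n := hdegX v₀ hv₀
  -- For bounded `δ` the number of arcs is linear in `n`. Otherwise `δ > 20 * t` makes the sparse
  -- set `A` contain at most a quarter of the vertices.
  by_cases hsmall : δ ≤ 20 * t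
  · calc arcs G ^ (k + 1) ≤ (40 * t * n) ^ (k + 1) := by
          gcongr
          calc arcs G ≤ 2 * δ * n := hEδ
            _ ≤ 2 * (20 * t) * n := by gcongr
            _ = _ := by ring
      _ = (40 * t) ^ (k + 1) * n ^ (k + 1) := mul_pow _ _ _
      _ ≤ (40 * t) ^ (k + 1) * n ^ (k + 2) := by gcongr; omega
      _ ≤ _ := by gcongr; exact Nat.le_add_right _ _
  push Not at hsmall
  set G' := G.induce (X : Set V) with hG'
  set N := Fintype.card (X : Set V) with hN
  have hNX : N = #X := by simp [hN]
  have hδN : δ ≤ N := hNX ▸ Finset.card_le_card (Finset.filter_subset _ _)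
  have hNn : N ≤ n := hNX ▸ Finset.card_le_univ _
  obtain ⟨A, D, hA1, hAD, hA2⟩ := exists_sparse_set_with_many_neighbors (G := G') (t := t) (δ := δ)
    (by omega) (by omega) fun v => by
      rw [hG', card_induce_filter X v]; exact hv₀min v v.2
  rw [← hN] at hA1 hA2
  -- For `t = 0` the empty clique is trivially a minor.
  have ht : 0 < t := by
    rcases Nat.eq_zero_or_pos t with rfl | h
    · exact absurd ⟨fun i => i.elim0, fun i => i.elim0, fun i => i.elim0, fun i => i.elim0,
        fun i => i.elim0, fun i => i.elim0⟩ hG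
    · exact h
  have hAδ : #A * δ ≤ 5 * t * N := by nlinarith
  have hAN : 4 * #A ≤ N := by
    have : #A * (20 * t) ≤ 5 * t * N := (Nat.mul_le_mul_left _ hsmall.le).trans hAδ
    nlinarith
  have hcomp : ¬ Minor (⊤ : SimpleGraph (Fin t)) G' (3 * d + 1) := fun h => by
    have := h.trans (minor_induce (G := G) (X : Set V))
    simp only [mul_zero, zero_add, one_mul, add_zero] at this
    exact hG this
  let U : Finset (X : Set V) := {v | v ∉ D ∧ v ∉ A}
  obtain ⟨H, hH1, hH2⟩ := exists_minor_on_dominators (G := G') (A := A) (U := U) (t := t)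
    (Finset.disjoint_left.2 fun x hx hxU => by simp [U] at hxU; exact hxU.2 hx)
    (fun u hu => by simp only [U, Finset.mem_filter] at hu; exact hAD u hu.2.1)
    (fun h => hcomp (h.mono (by omega)))
  -- At most half of the vertices lie in `D` and at most a quarter in `A`.
  have hU : N ≤ 4 * #U := by
    have hcov : (Finset.univ : Finset (X : Set V)) ⊆ D ∪ A ∪ U := by
      intro v _
      simp only [U, Finset.mem_union, Finset.mem_filter, Finset.mem_univ, true_and]
      tauto
    have h1 := (Finset.card_le_card hcov).trans (Finset.card_union_le _ _)
    have h2 := Finset.card_union_le D A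
    rw [Finset.card_univ, ← hN] at h1
    omega
  have hHk := ih A H fun h => by
    have := h.trans hH1
    exact hcomp (this.mono (by omega))
  rw [Fintype.card_coe] at hHk
  have hN0 : 0 < N := by omega
  have h1 : N ^ k ≤ 4 ^ k * (K * #A ^ (k + 1)) := by
    calc N ^ k ≤ (4 * arcs H) ^ k := by gcongr; omega
      _ = 4 ^ k * arcs H ^ k := mul_pow _ _ _
      _ ≤ _ := by gcongr
  have h2 : #A * arcs G ≤ 10 * t * N * n := by
    calc #A * arcs G ≤ #A * (2 * δ * n) := by gcongr
      _ = #A * δ * (2 * n) := by ring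
      _ ≤ 5 * t * N * (2 * n) := by gcongr
      _ = _ := by ring
  -- The minor `H` has at least `N / 4` arcs on only about `t N / δ` vertices. Multiplying its
  -- density bound by `arcs G ^ (k + 1)` allows `#A * arcs G` to be replaced by the bound `h2`, in
  -- which `δ` has cancelled.
  have h3 : N ^ k * arcs G ^ (k + 1) ≤
      N ^ k * (4 ^ k * K * (10 * t) ^ (k + 1) * n ^ (k + 2)) := by
    calc N ^ k * arcs G ^ (k + 1) ≤ 4 ^ k * (K * #A ^ (k + 1)) * arcs G ^ (k + 1) := by gcongr
      _ = 4 ^ k * K * (#A * arcs G) ^ (k + 1) := by ring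
      _ ≤ 4 ^ k * K * (10 * t * N * n) ^ (k + 1) := by gcongr
      _ = N ^ k * (4 ^ k * K * (10 * t) ^ (k + 1) * (N * n ^ (k + 1))) := by ring
      _ ≤ N ^ k * (4 ^ k * K * (10 * t) ^ (k + 1) * (n * n ^ (k + 1))) := by gcongr
      _ = _ := by ring
  refine (Nat.le_of_mul_le_mul_left h3 (by positivity)).trans ?_
  gcongr
  exact Nat.le_add_left _ _

/-- Graphs without a clique as a shallow minor have `O(n ^ (1 + 1 / k))` edges. -/
theorem exists_density_bound (k : ℕ) (hk : 1 ≤ k) : ∃ d : ℕ, ∀ t : ℕ, ∃ K : ℕ,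
    ∀ (V : Type u) [Fintype V] (G : SimpleGraph V),
      ¬ Minor (⊤ : SimpleGraph (Fin t)) G d → arcs G ^ k ≤ K * Fintype.card V ^ (k + 1) := by
  induction k, hk using Nat.le_induction with
  | base =>
    refine ⟨0, fun t => ⟨1, fun V _ G _ => ?_⟩⟩
    simpa using arcs_le_sq
  | succ k _ ih =>
    obtain ⟨d, hd⟩ := ih
    -- A depth-`d` minor of a depth-one minor has depth `(2 * 1 + 1) * d + 1`.
    refine ⟨3 * d + 1, fun t => ?_⟩
    obtain ⟨K, hK⟩ := hd t
    exact ⟨_, fun V _ G hG => density_step hK V G hG⟩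

end Density

/-! ### Independent sets and hubs -/

section Hubs

variable {V : Type*} {G : SimpleGraph V} {X : Set V}

lemma arcs_eq_card [Fintype V] : arcs G = #{q : V × V | G.Adj q.1 q.2} := by
  simp only [arcs, deg, Finset.card_filter]
  rw [← Finset.univ_product_univ, Finset.sum_product]

/-- `v` has a neighbour at distance at most `k` from `b`, measured inside `X`. -/
def Touches (G : SimpleGraph V) (X : Set V) (k : ℕ) (v b : V) : Prop :=
  ∃ u ∈ ballIn G X k b, G.Adj u v

lemma Touches.mono {Y : Set V} {k : ℕ} {v b : V} (h : Touches G X k v b) (hXY : X ⊆ Y) :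
    Touches G Y k v b := by
  obtain ⟨u, hu, huv⟩ := h
  exact ⟨u, ballIn_mono hXY le_rfl hu, huv⟩

/-- Pair the elements of `B` with the hubs in `T`; a branch set is a ball of radius `h - 1` together
with its hub. The balls are disjoint by independence at distance `2 * h - 2`, the hubs lie outside
`X`, and every hub is adjacent to every ball. -/
lemma minor_clique_of_touches {B T : Finset V} {h t : ℕ} (hh : 1 ≤ h)
    (hB : IndepIn G X (2 * h - 2) B) (hBX : ∀ b ∈ B, b ∈ X) (hTX : ∀ v ∈ T, v ∉ X)
    (htouch : ∀ v ∈ T, ∀ b ∈ B, Touches G X (h - 1) v b) (htB : t ≤ #B) (htT : t ≤ #T) :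
    Minor (⊤ : SimpleGraph (Fin t)) G h := by
  let b : Fin t → V := fun i => (B.equivFin.symm (Fin.castLE htB i) : B)
  let v : Fin t → V := fun i => (T.equivFin.symm (Fin.castLE htT i) : T)
  have hb : Function.Injective b := fun i j hij =>
    Fin.castLE_injective htB (B.equivFin.symm.injective (Subtype.ext hij))
  have hv : Function.Injective v := fun i j hij =>
    Fin.castLE_injective htT (T.equivFin.symm.injective (Subtype.ext hij))
  have hbB : ∀ i, b i ∈ B := fun i => Subtype.property _
  have hvT : ∀ i, v i ∈ T := fun i => Subtype.property _
  refine ⟨fun i => {x | x ∈ ballIn G X (h - 1) (b i) ∨ x = v i}, b, ?_, ?_, ?_, ?_⟩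
  · rintro i j x (hx | rfl) (hx' | hx')
    · refine hb (hB _ (hbB i) _ (hbB j) ?_)
      exact ballIn_mono subset_rfl (by omega) (ballIn_trans hx (mem_ballIn_symm hx'))
    · exact absurd (ballIn_subset hx) (hx' ▸ hTX _ (hvT j))
    · exact absurd (ballIn_subset hx') (hTX _ (hvT i))
    · exact hv hx'
  · exact fun i => Or.inl (mem_ballIn_self (hBX _ (hbB i)))
  · intro i
    have hsub : ballIn G X (h - 1) (b i) ⊆
        ballIn G {x | x ∈ ballIn G X (h - 1) (b i) ∨ x = v i} (h - 1) (b i) :=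
      ballIn_subset_ballIn_self.trans (ballIn_mono (fun _ hx => Or.inl hx) le_rfl)
    rintro x (hx | rfl)
    · exact ballIn_mono subset_rfl (by omega) (hsub hx)
    · obtain ⟨u, hu, huv⟩ := htouch _ (hvT i) _ (hbB i)
      have := ballIn_adj (hsub hu) (w := v i) (Or.inr rfl) huv
      rwa [Nat.sub_add_cancel hh] at this
  · intro i j _
    obtain ⟨u, hu, huv⟩ := htouch _ (hvT i) _ (hbB j)
    exact ⟨v i, Or.inr rfl, u, Or.inl hu, huv.symm⟩

/-! ### Conflicts between elements and greedy sparsity -/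

/-- The elements of `B` at distance at most `h` from `v`. -/
noncomputable def near (G : SimpleGraph V) (X : Set V) (h : ℕ) (B : Finset V) (v : V) :
    Finset V := {b ∈ B | v ∈ ballIn G X h b}

lemma mem_near {h : ℕ} {B : Finset V} {v b : V} :
    b ∈ near G X h B v ↔ b ∈ B ∧ v ∈ ballIn G X h b := Finset.mem_filter

lemma near_insert {B : Finset V} {h : ℕ} {b v : V} (hb : b ∉ B) (X : Set V) :
    #(near G X h (insert b B) v) = #(near G X h B v) + if v ∈ ballIn G X h b then 1 else 0 := by
  rw [near, Finset.filter_insert]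
  split_ifs with hv
  · rw [Finset.card_insert_of_notMem fun hb' => hb (Finset.mem_filter.1 hb').1]
    rfl
  · rfl

/-- The ordered conflict pairs are covered by a shallow minor on `T`. -/
lemma exists_minor_of_conflicts [Fintype V] {T : Finset V} {h g D : ℕ} (hgh : g ≤ h)
    (hhg : h ≤ g + 1) (hT : IndepIn G X (g + h) T) (hTX : ∀ b ∈ T, b ∈ X)
    (hD : ∀ v, #(near G X h T v) ≤ D) :
    ∃ H : SimpleGraph T, Minor H G h ∧
      ∑ b ∈ T, #{b' ∈ T | b' ≠ b ∧ b' ∈ ballIn G X (h + 1 + g) b} ≤ D * arcs H := by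
  have hmid : ∀ p : V × V, p.2 ∈ ballIn G X (h + 1 + g) p.1 → ∃ v ∈ ballIn G X h p.1,
      ∃ w ∈ ballIn G X g p.2, v = w ∨ G.Adj v w := by
    intro p hp
    obtain ⟨w, hw, hw'⟩ := exists_mem_ballIn_of_add hp
    rcases hw with hw | ⟨-, v, hv, hvw⟩
    · exact ⟨w, hw, w, mem_ballIn_symm hw', Or.inl rfl⟩
    · exact ⟨v, hv, w, mem_ballIn_symm hw', Or.inr hvw⟩
  let mid : V × V → V := fun p =>
    if hp : p.2 ∈ ballIn G X (h + 1 + g) p.1 then (hmid p hp).choose else p.1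
  have hmid1 : ∀ p : V × V, p.2 ∈ ballIn G X (h + 1 + g) p.1 → mid p ∈ ballIn G X h p.1 := by
    intro p hp
    simp only [mid, dif_pos hp]
    exact (hmid p hp).choose_spec.1
  have hmid2 : ∀ p : V × V, p.2 ∈ ballIn G X (h + 1 + g) p.1 →
      ∃ w ∈ ballIn G X g p.2, mid p = w ∨ G.Adj (mid p) w := by
    intro p hp
    simp only [mid, dif_pos hp]
    exact (hmid p hp).choose_spec.2
  let P : Finset (V × V) := {p ∈ T ×ˢ T | p.2 ≠ p.1 ∧ p.2 ∈ ballIn G X (h + 1 + g) p.1}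
  let cnt : V → V → ℕ := fun v b => #{p ∈ P | mid p = v ∧ p.1 = b}
  -- Each vertex is assigned to the nearby element from which most conflict pairs with this midpoint
  -- start.
  have hφ : ∀ v, ∃ b, ∀ b' ∈ near G X h T v, cnt v b' ≤ cnt v b := by
    intro v
    rcases (near G X h T v).eq_empty_or_nonempty with he | hne
    · exact ⟨v, by simp [he]⟩
    · obtain ⟨b, -, hb⟩ := Finset.exists_max_image _ (cnt v) hne
      exact ⟨b, hb⟩
  choose φ hφ using hφ
  -- The inner balls of radius `g` are disjoint from each other and from the other elements' balls
  -- of radius `h`, because `T` is independent at distance `g + h`. Only vertices outside the inner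
  -- balls are really shared, and `φ` distributes these.
  let M : T → Set V := fun b => {x | x ∈ ballIn G X g b ∨ x ∈ ballIn G X h b ∧ φ x = b}
  let H : SimpleGraph T := SimpleGraph.fromRel fun b b' => ∃ x ∈ M b, ∃ y ∈ M b', G.Adj x y
  refine ⟨H, ⟨M, fun b => b, ?_, ?_, ?_, ?_⟩, ?_⟩
  · rintro b b' x (hx | ⟨hx, hxb⟩) (hx' | ⟨hx', hxb'⟩)
    · refine Subtype.ext (hT b b.2 b' b'.2 ?_)
      exact ballIn_mono subset_rfl (by omega) (ballIn_trans hx (mem_ballIn_symm hx'))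
    · exact Subtype.ext (hT b b.2 b' b'.2 (ballIn_trans hx (mem_ballIn_symm hx')))
    · refine Subtype.ext (hT b b.2 b' b'.2 ?_)
      rw [add_comm]
      exact ballIn_trans hx (mem_ballIn_symm hx')
    · exact Subtype.ext (hxb.symm.trans hxb')
  · exact fun b => Or.inl (mem_ballIn_self (hTX b b.2))
  · intro b
    have hsub : ballIn G X g b ⊆ ballIn G (M b) g b :=
      ballIn_subset_ballIn_self.trans (ballIn_mono (fun _ hx => Or.inl hx) le_rfl)
    intro x hx
    by_cases hxg : x ∈ ballIn G X g b
    · exact ballIn_mono subset_rfl hgh (hsub hxg)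
    · have hxh : x ∈ ballIn G X h b := (hx.resolve_left hxg).1
      obtain rfl : h = g + 1 := by
        by_contra hne
        exact hxg (ballIn_mono subset_rfl (by omega) hxh)
      rcases hxh with hxh | ⟨-, y, hy, hyx⟩
      · exact absurd hxh hxg
      · exact ballIn_adj (hsub hy) hx hyx
  · intro b b' hbb'
    rw [SimpleGraph.fromRel_adj] at hbb'
    rcases hbb'.2 with h | ⟨x, hx, y, hy, hxy⟩
    · exact h
    · exact ⟨y, hy, x, hx, hxy.symm⟩
  · have e1 : ∑ b ∈ T, #{b' ∈ T | b' ≠ b ∧ b' ∈ ballIn G X (h + 1 + g) b} = #P := by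
      simp only [P, Finset.card_filter, Finset.sum_product]
    have e2 : #P = ∑ v, #{p ∈ P | mid p = v} :=
      Finset.card_eq_sum_card_fiberwise fun p _ => Finset.mem_univ _
    -- At most `D` elements can start a conflict pair with midpoint `v`, and `φ v` starts the most.
    have e3 : ∀ v, #{p ∈ P | mid p = v} ≤ D * cnt v (φ v) := by
      intro v
      have hmaps : Set.MapsTo Prod.fst (({p ∈ P | mid p = v} : Finset (V × V)) : Set (V × V))
          ((near G X h T v : Finset V) : Set V) := by
        intro p hp
        simp only [P, Finset.coe_filter, Finset.mem_filter, Finset.mem_product,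
          Set.mem_ofPred_eq] at hp
        exact Finset.mem_coe.2 (mem_near.2 ⟨hp.1.1.1, hp.2 ▸ hmid1 p hp.1.2.2⟩)
      rw [Finset.card_eq_sum_card_fiberwise hmaps]
      calc _ ≤ ∑ _b ∈ near G X h T v, cnt v (φ v) := Finset.sum_le_sum fun b hb => by
              rw [Finset.filter_filter]
              exact hφ v b hb
        _ = #(near G X h T v) * cnt v (φ v) := by rw [Finset.sum_const, smul_eq_mul]
        _ ≤ _ := Nat.mul_le_mul_right _ (hD v)
    have e4 : ∑ v, cnt v (φ v) = #{p ∈ P | φ (mid p) = p.1} := by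
      rw [Finset.card_eq_sum_card_fiberwise (t := Finset.univ) (f := mid)
        fun p _ => Finset.mem_univ _]
      refine Finset.sum_congr rfl fun v _ => ?_
      simp only [cnt, Finset.filter_filter]
      congr 1
      ext p
      simp only [Finset.mem_filter]
      constructor
      · rintro ⟨h1, rfl, h2⟩; exact ⟨h1, h2.symm, rfl⟩
      · rintro ⟨h1, h2, rfl⟩; exact ⟨h1, rfl, h2.symm⟩
    have e5 : #{p ∈ P | φ (mid p) = p.1} ≤ arcs H := by
      rw [arcs_eq_card]
      refine Finset.card_le_card_of_surjOn (fun q : T × T => ((q.1 : V), (q.2 : V))) ?_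
      rintro ⟨b, b'⟩ hp
      simp only [P, Finset.coe_filter, Finset.mem_filter, Finset.mem_product,
          Set.mem_ofPred_eq] at hp
      obtain ⟨⟨⟨hb, hb'⟩, hne, hball⟩, hφb⟩ := hp
      refine ⟨(⟨b, hb⟩, ⟨b', hb'⟩), ?_, rfl⟩
      simp only [Finset.coe_filter, Finset.mem_univ, true_and, Set.mem_ofPred_eq]
      rw [SimpleGraph.fromRel_adj]
      refine ⟨fun e => hne (congrArg Subtype.val e).symm, Or.inl ?_⟩
      obtain ⟨w, hw, hvw⟩ := hmid2 (b, b') hball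
      have hm := hmid1 (b, b') hball
      rcases hvw with hvw | hvw
      -- If the two halves meet in one vertex, the elements are within distance `g + h`, contrary to
      -- independence.
      · rw [← hvw] at hw
        refine absurd (hT b hb b' hb' ?_) (Ne.symm hne)
        rw [add_comm]
        exact ballIn_trans hm (mem_ballIn_symm hw)
      · exact ⟨mid (b, b'), Or.inr ⟨hm, hφb⟩, w, Or.inl hw, hvw⟩
    rw [e1, e2]
    calc _ ≤ ∑ v, D * cnt v (φ v) := Finset.sum_le_sum fun v _ => e3 v
      _ = D * #{p ∈ P | φ (mid p) = p.1} := by rw [← Finset.mul_sum, e4]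
      _ ≤ _ := Nat.mul_le_mul_left _ e5

/-- If shallow minors are sparse and no vertex is near many elements of `T`, then some element of
`T` is in conflict with few others. -/
lemma exists_few_conflicts [Fintype V] {T : Finset V} {k D K r : ℕ} (hk : 1 ≤ k) (hkr : k ≤ r)
    (hT : IndepIn G X (k - 1) T) (hTX : ∀ b ∈ T, b ∈ X)
    (hD : ∀ v, #(near G X (k / 2) T v) ≤ D) (hne : T.Nonempty)
    (hK : ∀ H : SimpleGraph T, Minor H G r → arcs H ^ 2 ≤ K * #T ^ 3) :
    ∃ b ∈ T, #{b' ∈ T | b' ∈ ballIn G X k b} ≤ Nat.sqrt (K * D ^ 2 * #T) + 1 := by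
  set h := k / 2 with hh
  -- With `g = k - 1 - h` the two radii differ by at most one, and `g + h` is exactly the distance
  -- `k - 1` of the known independence.
  obtain ⟨H, hH, hsum⟩ := exists_minor_of_conflicts (G := G) (X := X) (T := T) (h := h)
    (g := k - 1 - h) (D := D) (by omega) (by omega)
    (by rwa [show k - 1 - h + h = k - 1 by omega]) hTX hD
  rw [show h + 1 + (k - 1 - h) = k by omega] at hsum
  obtain ⟨b, hb, hmin⟩ := Finset.exists_min_image T
    (fun b => #{b' ∈ T | b' ≠ b ∧ b' ∈ ballIn G X k b}) hne
  refine ⟨b, hb, ?_⟩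
  set d := #{b' ∈ T | b' ≠ b ∧ b' ∈ ballIn G X k b} with hd
  have h1 : #T * d ≤ D * arcs H := by
    refine le_trans ?_ hsum
    rw [← smul_eq_mul]
    exact Finset.card_nsmul_le_sum _ _ _ hmin
  have h2 := hK H (hH.mono (by omega))
  have hTpos : 0 < #T := hne.card_pos
  have h3 : d ^ 2 ≤ K * D ^ 2 * #T := by
    have : #T ^ 2 * d ^ 2 ≤ #T ^ 2 * (K * D ^ 2 * #T) := by
      calc #T ^ 2 * d ^ 2 = (#T * d) ^ 2 := by ring
        _ ≤ (D * arcs H) ^ 2 := by gcongr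
        _ = D ^ 2 * arcs H ^ 2 := by ring
        _ ≤ D ^ 2 * (K * #T ^ 3) := by gcongr
        _ = _ := by ring
    exact Nat.le_of_mul_le_mul_left this (by positivity)
  -- The extra one counts `b` itself, which lies in its own ball.
  have h4 : #{b' ∈ T | b' ∈ ballIn G X k b} ≤ d + 1 := by
    rw [← Finset.card_insert_of_notMem (a := b)
      (s := ({b' ∈ T | b' ≠ b ∧ b' ∈ ballIn G X k b} : Finset V)) (by simp)]
    refine Finset.card_le_card fun x hx => ?_
    simp only [Finset.mem_filter, Finset.mem_insert] at hx ⊢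
    tauto
  have h5 : d ≤ Nat.sqrt (K * D ^ 2 * #T) := by
    rw [Nat.le_sqrt']; exact h3
  omega

/-- Square the hypothesis and cancel one factor `N`. Here `M` stands for the larger of the hub
degree and the size of the selected set. -/
lemma card_le_of_mul_sqrt {N M K : ℕ} (h : N ≤ M * (Nat.sqrt (K * M ^ 2 * N) + 1)) :
    N ≤ (2 * K + 2) * M ^ 4 := by
  rcases Nat.eq_zero_or_pos N with rfl | hN
  · exact Nat.zero_le _
  have hM : 0 < M := by
    rcases Nat.eq_zero_or_pos M with rfl | hM
    · simp at h; omega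
    · exact hM
  set s := Nat.sqrt (K * M ^ 2 * N) with hs
  have hs2 : s ^ 2 ≤ K * M ^ 2 * N := Nat.sqrt_le' _
  have h1 : (s + 1) ^ 2 ≤ 2 * s ^ 2 + 2 := by nlinarith [sq_nonneg ((s : ℤ) - 1)]
  have h2 : 2 ≤ 2 * (M ^ 2 * N) := by nlinarith [Nat.pow_pos (n := 2) hM]
  have h3 : N * N ≤ N * ((2 * K + 2) * M ^ 4) := by
    calc N * N ≤ (M * (s + 1)) * (M * (s + 1)) := Nat.mul_le_mul h h
      _ = M ^ 2 * (s + 1) ^ 2 := by ring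
      _ ≤ M ^ 2 * (2 * (K * M ^ 2 * N) + 2 * (M ^ 2 * N)) := by
          refine Nat.mul_le_mul_left _ ?_
          omega
      _ = _ := by ring
  exact Nat.le_of_mul_le_mul_left h3 hN

/-- Deleting a vertex that is near to at least two elements. -/
lemma notMem_ballIn_of_near {B : Finset V} {v : V} {h : ℕ}
    (hB : IndepIn G X (2 * h - 1) B) (hn : 2 ≤ #(near G X h B v)) (hh : 1 ≤ h) {b : V}
    (hb : b ∈ near G X h B v) : v ∉ ballIn G X (h - 1) b := by
  intro hv
  obtain ⟨b', hb', hne⟩ := Finset.exists_mem_ne (by omega : 1 < #(near G X h B v)) b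
  rw [mem_near] at hb hb'
  refine hne (hB _ hb.1 _ hb'.1 ?_).symm
  exact ballIn_mono subset_rfl (by omega) (ballIn_trans hv (mem_ballIn_symm hb'.2))

/-- The elements near to `v` are far apart only for even distances. -/
lemma two_le_near_imp {B : Finset V} {v : V} {k : ℕ} (hk : 1 ≤ k)
    (hB : IndepIn G X (k - 1) B) (hn : 2 ≤ #(near G X (k / 2) B v)) : k = 2 * (k / 2) := by
  by_contra hne
  obtain ⟨b, hb, b', hb', hbb⟩ := Finset.one_lt_card.1 (by omega : 1 < #(near G X (k / 2) B v))
  rw [mem_near] at hb hb'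
  refine hbb (hB _ hb.1 _ hb'.1 ?_)
  exact ballIn_mono subset_rfl (by omega) (ballIn_trans hb.2 (mem_ballIn_symm hb'.2))

/-! ### Deleting hubs at a fixed distance -/

/-- The state of the algorithm while it makes `B` independent at distance `k`: the set `T` of
hubs has been deleted since the distance `k` was reached. -/
structure Stage (G : SimpleGraph V) (k : ℕ) (S B T : Finset V) : Prop where
  disj : ∀ b ∈ B, b ∉ S
  indep : IndepIn G {x | x ∉ S} (k - 1) B
  sub : T ⊆ S
  even : T.Nonempty → k = 2 * (k / 2)
  touch : ∀ v ∈ T, ∀ b ∈ B, Touches G {x | x ∉ S} (k / 2 - 1) v b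

/-- Two elements near `v` force `k` to be even and put `v` at distance exactly `k / 2` from all
elements near it. So the balls of radius `k / 2 - 1` around the survivors avoid `v` and are
unchanged by its deletion. Earlier hubs keep touching them, and `v` itself touches them as the last
vertex of a shortest walk. -/
lemma Stage.insert_hub {k : ℕ} {S B T : Finset V} (hk : 1 ≤ k) (hs : Stage G k S B T) {v : V}
    (hn : 2 ≤ #(near G {x | x ∉ S} (k / 2) B v)) :
    v ∉ S ∧ Stage G k (insert v S) (near G {x | x ∉ S} (k / 2) B v) (insert v T) := by
  have hev := two_le_near_imp hk hs.indep hn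
  have hh : 1 ≤ k / 2 := by omega
  have hnb : ∀ b ∈ near G {x | x ∉ S} (k / 2) B v,
      v ∉ ballIn G {x | x ∉ S} (k / 2 - 1) b := fun b hb =>
    notMem_ballIn_of_near (by rw [← hev]; exact hs.indep) hn hh hb
  have hX : ({x | x ∉ S} \ {v} : Set V) = {x | x ∉ insert v S} := by
    ext x; simp [and_comm]
  have hball : ∀ b ∈ near G {x | x ∉ S} (k / 2) B v,
      ballIn G {x | x ∉ S} (k / 2 - 1) b ⊆ ballIn G {x | x ∉ insert v S} (k / 2 - 1) b :=
    fun b hb => hX ▸ ballIn_subset_diff (hnb b hb)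
  obtain ⟨b₀, hb₀⟩ : (near G {x | x ∉ S} (k / 2) B v).Nonempty :=
    Finset.card_pos.1 (by omega)
  have hvS : v ∉ S := ballIn_subset (mem_near.1 hb₀).2
  refine ⟨hvS, ⟨?_, ?_, ?_, fun _ => hev, ?_⟩⟩
  · intro b hb hbS
    rcases Finset.mem_insert.1 hbS with rfl | hbS
    · exact hnb b hb (mem_ballIn_self hvS)
    · exact hs.disj b (mem_near.1 hb).1 hbS
  · exact hs.indep.mono (fun x hx => fun hxS => hx (Finset.mem_insert_of_mem hxS)) le_rfl
      fun b hb => (mem_near.1 hb).1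
  · exact Finset.insert_subset_insert _ hs.sub
  · intro w hw b hb
    rcases Finset.mem_insert.1 hw with rfl | hw
    · have hne : w ≠ b := fun e => hnb b hb (e ▸ mem_ballIn_self (e ▸ hvS))
      obtain ⟨u, hu, huv⟩ := exists_adj_of_mem_ballIn (mem_near.1 hb).2 hne
      exact ⟨u, hX ▸ hu, huv⟩
    · obtain ⟨u, hu, huw⟩ := hs.touch w hw b (mem_near.1 hb).1
      exact ⟨u, hball b hb hu, huw⟩

/-- With `c` hubs and `c` surviving elements, `minor_clique_of_touches` applies with radius
parameter `k / 2`. -/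
lemma Stage.card_lt {k r c : ℕ} {S B T : Finset V} (hs : Stage G k S B T) (hk : 1 ≤ k)
    (hkr : k ≤ r) (hG : ¬ Minor (⊤ : SimpleGraph (Fin c)) G r) (hcB : c ≤ #B) (hc : 1 ≤ c) :
    #T < c := by
  by_contra! hcT
  have hev := hs.even (Finset.card_pos.1 (by omega))
  refine hG ((minor_clique_of_touches (X := {x | x ∉ S}) (h := k / 2) (by omega) ?_ ?_ ?_ hs.touch
    hcB hcT).mono (by omega))
  · exact hs.indep.mono subset_rfl (by omega) subset_rfl
  · exact hs.disj
  · exact fun v hv hvS => hvS (hs.sub hv)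

/-! ### Returning superfluous vertices -/

/-- The state of the algorithm while it returns superfluous vertices to the graph: all vertices of
`S` outside `R` are known to be needed. -/
structure Pruning (G : SimpleGraph V) (r : ℕ) (S B R : Finset V) : Prop where
  disj : ∀ b ∈ B, b ∉ S
  indep : IndepIn G {x | x ∉ S} r B
  touch : ∀ v ∈ S, v ∉ R → ∀ b ∈ B, 1 ≤ r / 2 ∧ Touches G {x | x ∉ S} (r / 2 - 1) v b

/-- A retained element is within distance `r / 2` of `v` once `v` is back, so the vertex before `v`
on a shortest walk shows that `v` touches the ball of radius `r / 2 - 1` in the graph without `v`.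
-/
lemma Pruning.keep {r : ℕ} {S B R : Finset V} (hs : Pruning G r S B R) {v : V} :
    Pruning G r S {b ∈ B | b ∈ ballIn G {x | x ∉ S.erase v} (r / 2) v} (R.erase v) := by
  refine ⟨fun b hb => hs.disj b (Finset.mem_filter.1 hb).1,
    hs.indep.mono subset_rfl le_rfl (Finset.filter_subset _ _), ?_⟩
  intro w hw hwR b hb
  rw [Finset.mem_filter] at hb
  by_cases hwv : w = v
  · subst hwv
    have hne : w ≠ b := fun e => hs.disj b hb.1 (e ▸ hw)
    have hw' := mem_ballIn_symm hb.2
    obtain ⟨u, hu, huw⟩ := exists_adj_of_mem_ballIn hw' hne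
    refine ⟨?_, u, ballIn_mono ?_ le_rfl hu, huw⟩
    · by_contra h0
      rw [show r / 2 = 0 by omega] at hw'
      exact hne hw'.1
    · rintro x ⟨hx, hxw⟩ hxS
      exact hx (Finset.mem_erase.2 ⟨hxw, hxS⟩)
  · exact hs.touch w hw (fun h => hwR (Finset.mem_erase.2 ⟨hwv, h⟩)) b hb.1

/-- A walk of length at most `r` that appears when `v` returns must pass through `v`. Both of its
parts are longer than `r / 2`, since their ends were not dropped, so its length exceeds `r`. -/
lemma Pruning.drop {r : ℕ} {S B R : Finset V} (hs : Pruning G r S B R) {v : V} :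
    Pruning G r (S.erase v) {b ∈ B | b ∉ ballIn G {x | x ∉ S.erase v} (r / 2) v}
      (R.erase v) := by
  have hsub : {x | x ∉ S} ⊆ {x | x ∉ S.erase v} := fun x hx h => hx (Finset.mem_of_mem_erase h)
  refine ⟨fun b hb h => hs.disj b (Finset.mem_filter.1 hb).1 (Finset.mem_of_mem_erase h), ?_, ?_⟩
  · intro x hx y hy hxy
    rw [Finset.mem_filter] at hx hy
    by_contra hne
    have hlen : ∀ k ≤ r, y ∈ ballIn G {z | z ∉ S.erase v} k x →
        ∃ a b, a + b = k ∧ v ∈ ballIn G {z | z ∉ S.erase v} a x ∧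
          y ∈ ballIn G {z | z ∉ S.erase v} b v := by
      intro k hk hyk
      by_contra hcon
      push Not at hcon
      refine hne (hs.indep x hx.1 y hy.1 ?_)
      -- If no split at `v` exists, every vertex of the walk differs from `v`, and the walk already
      -- lives in `G - S`.
      have : ∀ l ≤ k, ∀ z ∈ ballIn G {z | z ∉ S.erase v} l x,
          y ∈ ballIn G {z | z ∉ S.erase v} (k - l) z → z ∈ ballIn G {z | z ∉ S} l x := by
        intro l
        induction l with
        | zero =>
          rintro _ z ⟨rfl, -⟩ -
          exact mem_ballIn_self (hs.disj z hx.1)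
        | succ l ih =>
          intro hl z hz hyz
          have hzv : z ≠ v := by
            rintro rfl
            exact hcon (l + 1) (k - (l + 1)) (by omega) hz hyz
          rcases hz with hz | ⟨hzS, w, hw, hwz⟩
          · exact Or.inl (ih (by omega) z hz (ballIn_mono subset_rfl (by omega) hyz))
          · refine Or.inr ⟨fun h => hzS (Finset.mem_erase.2 ⟨hzv, h⟩), w, ih (by omega) w hw ?_,
              hwz⟩
            rw [show k - l = 1 + (k - (l + 1)) by omega]
            exact ballIn_trans (ballIn_adj (mem_ballIn_self (k := 0) (ballIn_subset hw)) hzS hwz)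
              hyz
      have hlast := this k le_rfl y hyk (mem_ballIn_self (ballIn_subset hyk))
      exact ballIn_mono subset_rfl hk hlast
    obtain ⟨a, b, hab, ha, hb⟩ := hlen r le_rfl hxy
    have h1 : r / 2 < a := by
      by_contra! h
      exact hx.2 (ballIn_mono subset_rfl h (mem_ballIn_symm ha))
    have h2 : r / 2 < b := by
      by_contra! h
      exact hy.2 (ballIn_mono subset_rfl h hb)
    omega
  · intro w hw hwR b hb
    obtain ⟨hwv, hwS⟩ := Finset.mem_erase.1 hw
    have := hs.touch w hwS (fun h => hwR (Finset.mem_erase.2 ⟨hwv, h⟩)) b (Finset.mem_filter.1 hb).1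
    exact ⟨this.1, this.2.mono hsub⟩

/-- Once nothing is left to treat, all of `S` touches balls around all of `B`; this is the hub
argument again, now for the whole deleted set at distance `r`. -/
lemma Pruning.card_lt {r c : ℕ} {S B : Finset V} (hs : Pruning G r S B ∅)
    (hG : ¬ Minor (⊤ : SimpleGraph (Fin c)) G r) (hcB : c ≤ #B) (hc : 1 ≤ c) : #S < c := by
  by_contra! hcS
  obtain ⟨b, hb⟩ := Finset.card_pos.1 (by omega : 0 < #B)
  obtain ⟨v, hv⟩ := Finset.card_pos.1 (by omega : 0 < #S)
  have hr := (hs.touch v hv (by simp) b hb).1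
  refine hG ((minor_clique_of_touches (X := {x | x ∉ S}) (h := r / 2) hr ?_ hs.disj ?_
    (fun v hv b hb => (hs.touch v hv (by simp) b hb).2) hcB hcS).mono (by omega))
  · exact hs.indep.mono subset_rfl (by omega) subset_rfl
  · exact fun v hv hvS => hvS hv

end Hubs

open RAM

/-! ### Weakest preconditions for the random access machine -/

section Machine

/-- Started in state `σ` with time `t` on the clock, `P` halts with `Q` true of the final state
and the final time. -/
def wp (P : Prog) (σ : State) (t : ℕ) (Q : State → ℕ → Prop) : Prop :=
  ∃ τ t', Runs P σ τ t' ∧ Q τ (t + t')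

variable {σ τ : State} {t : ℕ} {Q R : State → ℕ → Prop} {P P' : Prog} {x y z a k : ℕ}

@[simp] lemma wp_const : wp (.const x k) σ t Q ↔ Q (σ.setReg x k) (t + 1) :=
  ⟨fun ⟨_, _, h, hQ⟩ => by cases h; exact hQ, fun h => ⟨_, _, .const .., h⟩⟩

@[simp] lemma wp_add :
    wp (.add x y z) σ t Q ↔ Q (σ.setReg x (σ.reg y + σ.reg z)) (t + 1) :=
  ⟨fun ⟨_, _, h, hQ⟩ => by cases h; exact hQ, fun h => ⟨_, _, .add .., h⟩⟩

@[simp] lemma wp_sub :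
    wp (.sub x y z) σ t Q ↔ Q (σ.setReg x (σ.reg y - σ.reg z)) (t + 1) :=
  ⟨fun ⟨_, _, h, hQ⟩ => by cases h; exact hQ, fun h => ⟨_, _, .sub .., h⟩⟩

@[simp] lemma wp_load :
    wp (.load x a y) σ t Q ↔ Q (σ.setReg x (σ.arr a (σ.reg y))) (t + 1) :=
  ⟨fun ⟨_, _, h, hQ⟩ => by cases h; exact hQ, fun h => ⟨_, _, .load .., h⟩⟩

@[simp] lemma wp_store :
    wp (.store a y x) σ t Q ↔ Q (σ.setArr a (σ.reg y) (σ.reg x)) (t + 1) :=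
  ⟨fun ⟨_, _, h, hQ⟩ => by cases h; exact hQ, fun h => ⟨_, _, .store .., h⟩⟩

@[simp] lemma wp_seq :
    wp (.seq P P') σ t Q ↔ wp P σ t fun τ t' => wp P' τ t' Q := by
  constructor
  · rintro ⟨_, _, h, hQ⟩
    cases h with
    | seq h1 h2 => exact ⟨_, _, h1, _, _, h2, by rwa [add_assoc]⟩
  · rintro ⟨_, _, h1, _, _, h2, hQ⟩
    exact ⟨_, _, .seq h1 h2, by rwa [← add_assoc]⟩

@[simp] lemma wp_ite :
    wp (.ite x y P P') σ t Q ↔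
      if σ.reg x < σ.reg y then wp P σ (t + 1) Q else wp P' σ (t + 1) Q := by
  constructor
  · rintro ⟨_, _, h, hQ⟩
    cases h with
    | ite_true hc h => rw [if_pos hc]; exact ⟨_, _, h, by rwa [add_assoc]⟩
    | ite_false hc h => rw [if_neg hc]; exact ⟨_, _, h, by rwa [add_assoc]⟩
  · intro h
    split_ifs at h with hc
    · obtain ⟨_, _, h, hQ⟩ := h
      exact ⟨_, _, .ite_true hc h, by rwa [← add_assoc]⟩
    · obtain ⟨_, _, h, hQ⟩ := h
      exact ⟨_, _, .ite_false hc h, by rwa [← add_assoc]⟩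

lemma wp.mono (h : wp P σ t Q) (hQR : ∀ τ t', Q τ t' → R τ t') : wp P σ t R := by
  obtain ⟨τ, t', h1, h2⟩ := h
  exact ⟨τ, t', h1, hQR _ _ h2⟩

/-- `N` is only an upper bound for the number of iterations: the invariant may permit an earlier
exit, and must forbid the test from succeeding at `N`. -/
lemma wp_loop (N : ℕ) (Inv : ℕ → State → ℕ → Prop) (h0 : Inv 0 σ t)
    (hstep : ∀ j τ t', j < N → Inv j τ t' → τ.reg x < τ.reg y → wp P τ (t' + 1) (Inv (j + 1)))
    (hN : ∀ τ t', Inv N τ t' → ¬ τ.reg x < τ.reg y)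
    (hQ : ∀ j τ t', j ≤ N → Inv j τ t' → ¬ τ.reg x < τ.reg y → Q τ (t' + 1)) :
    wp (.loop x y P) σ t Q := by
  have key : ∀ m j, j + m = N → ∀ τ t', Inv j τ t' → wp (.loop x y P) τ t' Q := by
    intro m
    induction m with
    | zero =>
      rintro j rfl τ t' h
      exact ⟨τ, 1, .loop_false (hN τ t' h), hQ _ τ t' le_rfl h (hN τ t' h)⟩
    | succ m ih =>
      intro j hj τ t' h
      by_cases hc : τ.reg x < τ.reg y
      · obtain ⟨τ₁, t₁, hr, hI⟩ := hstep j τ t' (by omega) h hc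
        obtain ⟨τ₂, t₂, hr', hI'⟩ := ih (j + 1) (by omega) τ₁ _ hI
        refine ⟨τ₂, _, .loop_true hc hr hr', ?_⟩
        rwa [show t' + (1 + t₁ + t₂) = t' + 1 + t₁ + t₂ by ring]
      · exact ⟨τ, 1, .loop_false hc, hQ j τ t' (by omega) h hc⟩
  exact key N 0 (by simp) σ t h0

/-! ### Which registers and arrays a program leaves unchanged -/

/-- The registers that a program writes to. -/
def wregs : Prog → List ℕ
  | .const x _ => [x]
  | .add x _ _ => [x]
  | .sub x _ _ => [x]
  | .load x _ _ => [x]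
  | .store _ _ _ => []
  | .seq P Q => wregs P ++ wregs Q
  | .ite _ _ P Q => wregs P ++ wregs Q
  | .loop _ _ P => wregs P

/-- The arrays that a program writes to. -/
def warrs : Prog → List ℕ
  | .const _ _ => []
  | .add _ _ _ => []
  | .sub _ _ _ => []
  | .load _ _ _ => []
  | .store a _ _ => [a]
  | .seq P Q => warrs P ++ warrs Q
  | .ite _ _ P Q => warrs P ++ warrs Q
  | .loop _ _ P => warrs P

/-- The states `σ` and `τ` agree outside the registers `rs` and the arrays `as`. -/
structure Frame (rs as : List ℕ) (σ τ : State) : Prop where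
  reg : ∀ x, x ∉ rs → τ.reg x = σ.reg x
  arr : ∀ a, a ∉ as → τ.arr a = σ.arr a

lemma Frame.refl {rs as : List ℕ} : Frame rs as σ σ := ⟨fun _ _ => rfl, fun _ _ => rfl⟩

lemma Frame.trans {rs as rs' as' rs'' as'' : List ℕ} {ρ : State} (h : Frame rs as σ τ)
    (h' : Frame rs' as' τ ρ) (h1 : rs ⊆ rs'') (h2 : rs' ⊆ rs'') (h3 : as ⊆ as'')
    (h4 : as' ⊆ as'') : Frame rs'' as'' σ ρ :=
  ⟨fun x hx => (h'.reg x fun hh => hx (h2 hh)).trans (h.reg x fun hh => hx (h1 hh)),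
    fun x hx => (h'.arr x fun hh => hx (h4 hh)).trans (h.arr x fun hh => hx (h3 hh))⟩

@[simp] lemma setReg_reg (x v y : ℕ) :
    (σ.setReg x v).reg y = if y = x then v else σ.reg y := by
  simp [State.setReg, Function.update_apply]

@[simp] lemma setReg_arr (x v : ℕ) : (σ.setReg x v).arr = σ.arr := rfl

@[simp] lemma setArr_reg (a i v : ℕ) : (σ.setArr a i v).reg = σ.reg := rfl

@[simp] lemma setArr_arr (a i v b : ℕ) :
    (σ.setArr a i v).arr b = if b = a then Function.update (σ.arr a) i v else σ.arr b := by
  simp [State.setArr, Function.update_apply]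

lemma frame_setReg (x v : ℕ) : Frame [x] [] σ (σ.setReg x v) :=
  ⟨fun y hy => by rw [setReg_reg, if_neg (by simpa using hy)], fun _ _ => rfl⟩

lemma frame_setArr (a i v : ℕ) : Frame [] [a] σ (σ.setArr a i v) :=
  ⟨fun _ _ => rfl, fun y hy => by rw [setArr_arr, if_neg (by simpa using hy)]⟩

/-- The sets of written registers and arrays are syntactic, so preservation of anything else by a
concrete program reduces to a membership test on lists of numerals. -/
lemma runs_frame {n : ℕ} (h : Runs P σ τ n) : Frame (wregs P) (warrs P) σ τ := by
  induction h with
  | const => exact frame_setReg _ _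
  | add => exact frame_setReg _ _
  | sub => exact frame_setReg _ _
  | load => exact frame_setReg _ _
  | store => exact frame_setArr _ _ _
  | seq _ _ ih1 ih2 =>
    exact ih1.trans ih2 (List.subset_append_left _ _) (List.subset_append_right _ _)
      (List.subset_append_left _ _) (List.subset_append_right _ _)
  | ite_true _ _ ih =>
    exact ih.trans Frame.refl (List.subset_append_left _ _) (List.nil_subset _)
      (List.subset_append_left _ _) (List.nil_subset _)
  | ite_false _ _ ih =>
    exact ih.trans Frame.refl (List.subset_append_right _ _) (List.nil_subset _)
      (List.subset_append_right _ _) (List.nil_subset _)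
  | loop_true _ _ _ ih1 ih2 =>
    exact ih1.trans ih2 (List.Subset.refl _) (List.Subset.refl _) (List.Subset.refl _)
      (List.Subset.refl _)
  | loop_false => exact Frame.refl

lemma wp.frame (h : wp P σ t Q) :
    wp P σ t fun τ t' => Q τ t' ∧ Frame (wregs P) (warrs P) σ τ := by
  obtain ⟨τ, t', h1, h2⟩ := h
  exact ⟨τ, t', h1, h2, runs_frame h1⟩

/-! ### Counting loops -/

/-- Repeat `P` with register `i` running up to (but excluding) the value of register `L`;
register `3` has to hold the number `1`. -/
def countTo (i L : ℕ) (P : Prog) : Prog := .loop i L (.seq P (.add i i 3))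

/-- Repeat `P` with register `i` running from `0` up to the value of register `L`. -/
def forTo (i L : ℕ) (P : Prog) : Prog := .seq (.const i 0) (countTo i L P)

/-- The side conditions of the loop rules. -/
structure LoopVars (i L : ℕ) (P : Prog) : Prop where
  ne : i ≠ L
  ne_three : i ≠ 3
  limit : L ∉ wregs P
  three : 3 ∉ wregs P
  index : i ∉ wregs P

lemma wp_countTo {i L : ℕ} (hv : LoopVars i L P) (b e : ℕ) (Inv : ℕ → State → Prop)
    (f : ℕ → ℕ) (hb : σ.reg i = b) (he : σ.reg L = e) (hbe : b ≤ e) (h3 : σ.reg 3 = 1)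
    (h0 : Inv b σ)
    (hstep : ∀ j τ t', b ≤ j → j < e → Inv j τ → τ.reg i = j →
      Frame (i :: wregs P) (warrs P) σ τ →
      wp P τ t' fun τ' t'' => Inv (j + 1) (τ'.setReg i (j + 1)) ∧ t'' ≤ t' + f j)
    (hQ : ∀ τ t', Inv e τ → Frame (i :: wregs P) (warrs P) σ τ →
      t' ≤ t + 1 + ∑ j ∈ Finset.Ico b e, (f j + 2) → Q τ t') :
    wp (countTo i L P) σ t Q := by
  refine wp_loop (e - b) (fun j τ t' => Inv (b + j) τ ∧ τ.reg i = b + j ∧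
    Frame (i :: wregs P) (warrs P) σ τ ∧ t' ≤ t + ∑ j ∈ Finset.Ico b (b + j), (f j + 2))
    ⟨h0, hb, Frame.refl, by simp⟩ ?_ ?_ ?_
  · rintro j τ t' hj ⟨hI, hi, hF, ht⟩ -
    have h3τ : τ.reg 3 = 1 := by
      rw [hF.reg 3 (by simp [hv.three, hv.ne_three.symm]), h3]
    rw [wp_seq]
    refine (hstep (b + j) τ (t' + 1) (by omega) (by omega) hI hi hF).frame.mono ?_
    rintro τ' t'' ⟨⟨hI', ht'⟩, hF'⟩
    have e1 : τ'.reg i = b + j := by rw [hF'.reg i hv.index, hi]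
    have e2 : τ'.reg 3 = 1 := by rw [hF'.reg 3 hv.three, h3τ]
    rw [wp_add, e1, e2]
    refine ⟨by simpa [add_assoc] using hI', by simp [add_assoc], ?_, ?_⟩
    · have hF'' : Frame (i :: wregs P) (warrs P) σ τ' :=
        hF.trans hF' (by simp) (by simp) (by simp) (by simp)
      refine ⟨fun x hx => ?_, hF''.arr⟩
      rw [setReg_reg, if_neg (by rintro rfl; simp at hx)]
      exact hF''.reg x hx
    · rw [← add_assoc, Finset.sum_Ico_succ_top (by omega)]
      omega
  · rintro τ t' ⟨-, hi, hF, -⟩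
    rw [hi, hF.reg L (by simp [hv.limit, hv.ne.symm]), he]
    omega
  · rintro j τ t' hj ⟨hI, hi, hF, ht⟩ hc
    rw [hi, hF.reg L (by simp [hv.limit, hv.ne.symm]), he] at hc
    obtain rfl : e = b + j := by omega
    exact hQ τ _ hI hF (by omega)

lemma wp_forTo {i L : ℕ} (hv : LoopVars i L P) (N : ℕ) (Inv : ℕ → State → Prop)
    (f : ℕ → ℕ) (hL : σ.reg L = N) (h3 : σ.reg 3 = 1) (h0 : Inv 0 (σ.setReg i 0))
    (hstep : ∀ j τ t', j < N → Inv j τ → τ.reg i = j →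
      Frame (i :: wregs P) (warrs P) σ τ →
      wp P τ t' fun τ' t'' => Inv (j + 1) (τ'.setReg i (j + 1)) ∧ t'' ≤ t' + f j)
    (hQ : ∀ τ t', Inv N τ → Frame (i :: wregs P) (warrs P) σ τ →
      t' ≤ t + 2 + ∑ j ∈ Finset.range N, (f j + 2) → Q τ t') :
    wp (forTo i L P) σ t Q := by
  have hF0 : Frame (i :: wregs P) (warrs P) σ (σ.setReg i 0) :=
    ⟨fun x hx => by rw [setReg_reg, if_neg (by rintro rfl; simp at hx)], fun _ _ => rfl⟩
  rw [forTo, wp_seq, wp_const]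
  refine wp_countTo hv 0 N Inv f (by simp) (by simp [hv.ne.symm, hL]) (Nat.zero_le _)
    (by simp [hv.ne_three.symm, h3]) h0 ?_ ?_
  · intro j τ t' _ hj hI hi hF
    exact hstep j τ t' hj hI hi (hF0.trans hF (by simp) (by simp) (by simp) (by simp))
  · intro τ t' hI hF ht
    refine hQ τ t' hI (hF0.trans hF (by simp) (by simp) (by simp) (by simp)) ?_
    rw [Finset.range_eq_Ico]
    omega

lemma wp_forTo_const {i L : ℕ} (hv : LoopVars i L P) (N : ℕ) (Inv : ℕ → State → Prop)
    (c : ℕ) (hL : σ.reg L = N) (h3 : σ.reg 3 = 1) (h0 : Inv 0 (σ.setReg i 0))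
    (hstep : ∀ j τ t', j < N → Inv j τ → τ.reg i = j →
      Frame (i :: wregs P) (warrs P) σ τ →
      wp P τ t' fun τ' t'' => Inv (j + 1) (τ'.setReg i (j + 1)) ∧ t'' ≤ t' + c)
    (hQ : ∀ τ t', Inv N τ → Frame (i :: wregs P) (warrs P) σ τ →
      t' ≤ t + 2 + N * (c + 2) → Q τ t') :
    wp (forTo i L P) σ t Q :=
  wp_forTo hv N Inv (fun _ => c) hL h3 h0 hstep fun τ t' hI hF ht =>
    hQ τ t' hI hF (by simpa using ht)

end Machine

/-! ### Breadth-first search -/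

section Search

variable {V : Type*} {n : ℕ} {e : V ≃ Fin n} {G : SimpleGraph V} {st nb : ℕ → ℕ}
  {σ τ : State} {t : ℕ} {Q : State → ℕ → Prop}

/-- The arrays `st` and `nb` hold the adjacency lists of `G`. -/
structure AdjLists (e : V ≃ Fin n) (G : SimpleGraph V) (st nb : ℕ → ℕ) : Prop where
  start_zero : st 0 = 0
  start_le : ∀ i, i < n → st i ≤ st (i + 1)
  neighbors : ∀ v : V, Set.BijOn nb (Set.Ico (st (e v)) (st ((e v : ℕ) + 1)))
    ((fun w => (e w : ℕ)) '' G.neighborSet v)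

/-- The part of the memory that stays constant until the output is written. -/
structure Base (n m : ℕ) (st nb : ℕ → ℕ) (σ : State) : Prop where
  reg_zero : σ.reg 0 = n
  reg_two : σ.reg 2 = m
  one : σ.reg 3 = 1
  zero : σ.reg 4 = 0
  start : σ.arr 0 = st
  nbr : σ.arr 1 = nb

lemma Base.frame {m : ℕ} {rs as : List ℕ} (h : Base n m st nb σ) (hF : Frame rs as σ τ)
    (hrs : ∀ x ∈ [0, 2, 3, 4], x ∉ rs) (has : ∀ a ∈ [0, 1], a ∉ as) : Base n m st nb τ :=
  ⟨(hF.reg _ (hrs 0 (by simp))).trans h.1, (hF.reg _ (hrs 2 (by simp))).trans h.2,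
    (hF.reg _ (hrs 3 (by simp))).trans h.3, (hF.reg _ (hrs 4 (by simp))).trans h.4,
    (hF.arr _ (has 0 (by simp))).trans h.5, (hF.arr _ (has 1 (by simp))).trans h.6⟩

/-- The positive entries of `f` are those of the vertices that satisfy `P`. -/
def Rep (e : V ≃ Fin n) (f : ℕ → ℕ) (P : V → Prop) : Prop := ∀ v, 0 < f (e v) ↔ P v

lemma AdjLists.sum_eq (h : AdjLists e G st nb) :
    ∑ j ∈ Finset.range n, (st (j + 1) - st j) = st n := by
  have key : ∀ k ≤ n, ∑ j ∈ Finset.range k, (st (j + 1) - st j) = st k := by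
    intro k
    induction k with
    | zero => simp [h.start_zero]
    | succ k ih =>
      intro hk
      rw [Finset.sum_range_succ, ih (by omega)]
      have := h.start_le k (by omega)
      omega
  exact key n le_rfl

/-- Identifies the length of the adjacency lists, on which the search cost depends, with the
quantity bounded by the density theorem. -/
lemma AdjLists.start_eq_arcs [Fintype V] (h : AdjLists e G st nb) : st n = arcs G := by
  rw [← h.sum_eq, arcs, ← Fin.sum_univ_eq_sum_range (fun j => st (j + 1) - st j),
    ← Equiv.sum_comp e]
  refine Finset.sum_congr rfl fun v _ => ?_
  have hb := h.neighbors v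
  rw [← Nat.card_Ico, ← Set.ncard_coe_finset, Finset.coe_Ico, ← hb.injOn.ncard_image, hb.image_eq,
    Set.ncard_image_of_injective _ fun a b hab => e.injective (Fin.ext hab), deg,
    ← Set.ncard_coe_finset]
  congr 1
  ext w
  simp

/-- Scan the position `reg 12` of the adjacency lists: a neighbour outside the set with indicator
array `5` is marked in array `7` with the value of `reg 10`, unless its mark is larger. -/
def scanPos : Prog :=
  .seq (.load 15 1 12) (.seq (.load 16 5 15) (.ite 4 16 (.const 17 0)
    (.seq (.load 16 7 15) (.ite 16 10 (.store 7 15 10) (.const 17 0)))))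

/-- Scan all neighbours of the vertex number `reg 11`, if its mark exceeds `reg 10`. -/
def scanVertex : Prog :=
  .seq (.load 14 7 11) (.ite 10 14
    (.seq (.load 12 0 11) (.seq (.add 16 11 3) (.seq (.load 13 0 16) (countTo 12 13 scanPos))))
    (.const 17 0))

/-- Mark, in array `7`, the vertices at distance at most `reg 10` from the vertex number `reg 9`
after deleting the set with indicator array `5`. -/
def search : Prog :=
  .seq (forTo 11 0 (.store 7 11 4)) (.seq (.add 16 10 3) (.seq (.store 7 9 16)
    (.loop 4 10 (.seq (forTo 11 0 scanVertex) (.sub 10 10 3)))))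

/-- Marks above `θ` denote the previous ball `N`, and new vertices receive exactly `θ`. A vertex
found in the current round is therefore not expanded in the same round, whatever its number. -/
lemma wp_scanVertex (hadj : AdjLists e G st nb) {m : ℕ} (hbase : Base n m st nb σ) {v : V}
    (hv : σ.reg 11 = e v) {S : V → Prop} (hS : Rep e (σ.arr 5) S) {θ : ℕ} (hθ : σ.reg 10 = θ)
    (hθ0 : 0 < θ) {N : Set V} {P : V → Prop}
    (hN : ∀ w, θ < σ.arr 7 (e w) ↔ w ∈ N) (hP : Rep e (σ.arr 7) P)
    (hPθ : ∀ w, 0 < σ.arr 7 (e w) → θ ≤ σ.arr 7 (e w))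
    (hQ : ∀ τ t', (∀ w, θ < τ.arr 7 (e w) ↔ w ∈ N) →
      Rep e (τ.arr 7) (fun w => P w ∨ ¬ S w ∧ v ∈ N ∧ G.Adj v w) →
      (∀ w, 0 < τ.arr 7 (e w) → θ ≤ τ.arr 7 (e w)) →
      t' ≤ t + (8 + 8 * (st (e v + 1) - st (e v))) → Q τ t') :
    wp scanVertex σ t Q := by
  have h10 := hθ
  simp only [scanVertex, wp_seq, wp_load, wp_ite, wp_add, wp_const, setReg_reg, setReg_arr,
    hv, h10, hbase.one, hbase.start, Nat.reduceEqDiff, if_true, if_false]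
  split_ifs with hc
  · have hvN : v ∈ N := (hN v).1 hc
    refine wp_countTo ⟨by decide, by decide, by decide, by decide, by decide⟩
      (st (e v)) (st (e v + 1))
      (fun j τ => (∀ w, θ < τ.arr 7 (e w) ↔ w ∈ N) ∧
        Rep e (τ.arr 7) (fun w => P w ∨ ¬ S w ∧ ∃ q, st (e v) ≤ q ∧ q < j ∧ nb q = e w) ∧
        (∀ w, 0 < τ.arr 7 (e w) → θ ≤ τ.arr 7 (e w)))
      (fun _ => 6) (by simp) (by simp) (hadj.start_le _ (e v).2) (by simp [hbase.one]) ?_ ?_ ?_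
    · refine ⟨by simpa using hN, ?_, by simpa using hPθ⟩
      intro w
      simp only [setReg_arr, hP w]
      constructor
      · exact Or.inl
      · rintro (h | ⟨-, q, h1, h2, -⟩)
        · exact h
        · omega
    · rintro j τ t' hj1 hj2 ⟨hI1, hI2, hI3⟩ hj hF
      have f1 : τ.arr 1 = nb := by rw [hF.arr 1 (by decide)]; simp [hbase.nbr]
      have f5 : τ.arr 5 = σ.arr 5 := by rw [hF.arr 5 (by decide)]; simp
      have f4 : τ.reg 4 = 0 := by rw [hF.reg 4 (by decide)]; simp [hbase.zero]
      have f10 : τ.reg 10 = θ := by rw [hF.reg 10 (by decide)]; simp [hθ]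
      obtain ⟨u, hu, huj⟩ : nb j ∈ (fun w => (e w : ℕ)) '' G.neighborSet v :=
        (hadj.neighbors v).mapsTo ⟨hj1, hj2⟩
      have huj' : nb j = e u := huj.symm
      have hext : ∀ w, (∃ q, st (e v) ≤ q ∧ q < j + 1 ∧ nb q = e w) ↔
          (∃ q, st (e v) ≤ q ∧ q < j ∧ nb q = e w) ∨ w = u := by
        intro w
        constructor
        · rintro ⟨q, h1, h2, h3⟩
          rcases Nat.lt_succ_iff_lt_or_eq.1 h2 with h2 | rfl
          · exact Or.inl ⟨q, h1, h2, h3⟩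
          · exact Or.inr (e.injective (Fin.ext (h3.symm.trans huj')))
        · rintro (⟨q, h1, h2, h3⟩ | rfl)
          · exact ⟨q, h1, by omega, h3⟩
          · exact ⟨j, hj1, by omega, huj'⟩
      simp only [scanPos, wp_seq, wp_load, wp_ite, wp_const, wp_store, setReg_reg, setReg_arr,
        setArr_arr, hj, f1, f4, f5, f10, huj', Nat.reduceEqDiff, if_true, if_false,
        hS u]
      split_ifs with h1 h2
      · refine ⟨⟨hI1, fun w => ?_, hI3⟩, by omega⟩
        refine (hI2 w).trans ?_
        beta_reduce
        rw [hext w]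
        by_cases hwu : w = u
        · subst hwu; tauto
        · simp only [hwu, or_false]
      · have hne : ∀ w, w ≠ u → (e w : ℕ) ≠ e u := fun w hw h => hw (e.injective (Fin.ext h))
        refine ⟨⟨fun w => ?_, fun w => ?_, fun w => ?_⟩, by omega⟩
        · by_cases hwu : w = u
          · subst hwu
            rw [Function.update_self, ← hI1 w]
            omega
          · rw [Function.update_of_ne (hne w hwu), hI1 w]
        · beta_reduce
          rw [hext w]
          by_cases hwu : w = u
          · subst hwu
            rw [Function.update_self]
            tauto
          · rw [Function.update_of_ne (hne w hwu)]
            refine (hI2 w).trans ?_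
            simp only [hwu, or_false]
        · by_cases hwu : w = u
          · subst hwu
            rw [Function.update_self]
            tauto
          · rw [Function.update_of_ne (hne w hwu)]
            exact hI3 w
      · refine ⟨⟨hI1, fun w => ?_, hI3⟩, by omega⟩
        beta_reduce
        rw [hext w]
        by_cases hwu : w = u
        · subst hwu
          have : 0 < τ.arr 7 (e w) := by omega
          tauto
        · refine (hI2 w).trans ?_
          simp only [hwu, or_false]
    · rintro τ t' ⟨hI1, hI2, hI3⟩ hF ht
      refine hQ τ t' hI1 (fun w => ?_) hI3 ?_
      · refine (hI2 w).trans ?_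
        have : (∃ q, st (e v) ≤ q ∧ q < st (e v + 1) ∧ nb q = e w) ↔ G.Adj v w := by
          constructor
          · rintro ⟨q, h1, h2, h3⟩
            obtain ⟨x, hx, hxq⟩ := (hadj.neighbors v).mapsTo (x := q) ⟨h1, h2⟩
            have : x = w := e.injective (Fin.ext (hxq.trans h3))
            exact this ▸ hx
          · intro h
            obtain ⟨q, hq, hq'⟩ := (hadj.neighbors v).surjOn (Set.mem_image_of_mem _ h)
            exact ⟨q, hq.1, hq.2, hq'⟩
        beta_reduce
        rw [this]
        tauto
      · simp at ht
        omega
  · refine hQ _ _ (by simpa using hN) (fun w => ?_) (by simpa using hPθ) (by omega)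
    have hvN : v ∉ N := fun h => hc ((hN v).2 h)
    simp only [setReg_arr, hP w]
    tauto

/-- The number of steps of `search`. -/
def searchCost (n E d : ℕ) : ℕ := 20 * (d + 1) * (n + E + 1)

lemma exists_vertex (e : V ≃ Fin n) {j : ℕ} (hj : j < n) : ∃ v, j = e v :=
  ⟨e.symm ⟨j, hj⟩, by simp⟩

lemma lt_succ_vertex {v w : V} : (e w : ℕ) < e v + 1 ↔ (e w : ℕ) < e v ∨ w = v := by
  rw [Nat.lt_succ_iff_lt_or_eq]
  refine or_congr Iff.rfl ⟨fun h => e.injective (Fin.ext h), fun h => h ▸ rfl⟩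

lemma vertex_ne {v w : V} (h : w ≠ v) : (e w : ℕ) ≠ e v := fun h' => h (e.injective (Fin.ext h'))

/-- A loop over all vertices that modifies the entries of the array `a` one by one. -/
lemma wp_map {i : ℕ} {P : Prog} (hv : LoopVars i 0 P) {m : ℕ} (hbase : Base n m st nb σ) (a c : ℕ)
    (R : V → ℕ → Prop)
    (hstep : ∀ v τ t', τ.reg i = (e v : ℕ) → Frame (i :: wregs P) (warrs P) σ τ →
      τ.arr a (e v) = σ.arr a (e v) → wp P τ t' fun τ' t'' =>
        R v (τ'.arr a (e v)) ∧ (∀ k : ℕ, k ≠ e v → τ'.arr a k = τ.arr a k) ∧ t'' ≤ t' + c)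
    (hQ : ∀ τ t', (∀ v, R v (τ.arr a (e v))) → Frame (i :: wregs P) (warrs P) σ τ →
      t' ≤ t + 2 + n * (c + 2) → Q τ t') :
    wp (forTo i 0 P) σ t Q := by
  refine wp_forTo_const hv n (fun j τ => (∀ v, (e v : ℕ) < j → R v (τ.arr a (e v))) ∧
    ∀ v, j ≤ (e v : ℕ) → τ.arr a (e v) = σ.arr a (e v)) c hbase.reg_zero hbase.one
    ⟨by simp, by simp⟩ ?_ ?_
  · rintro j τ t' hj ⟨hI1, hI2⟩ hi hF
    obtain ⟨v, rfl⟩ := exists_vertex e hj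
    refine (hstep v τ t' hi hF (hI2 v le_rfl)).mono ?_
    rintro τ' t'' ⟨h1, h2, h3⟩
    refine ⟨⟨fun w hw => ?_, fun w hw => ?_⟩, h3⟩
    · rcases lt_succ_vertex.1 hw with hw | rfl
      · simp only [setReg_arr]
        rw [h2 _ hw.ne]; exact hI1 w hw
      · exact h1
    · simp only [setReg_arr]
      rw [h2 _ (by omega)]; exact hI2 w (by omega)
  · rintro τ t' ⟨hI, -⟩ hF ht
    exact hQ τ t' (fun v => hI v (e v).2) hF ht

lemma wp_search (hadj : AdjLists e G st nb) {m : ℕ} (hbase : Base n m st nb σ)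
    {s : V} {d : ℕ} {S : V → Prop} (hs : σ.reg 9 = e s) (hd : σ.reg 10 = d)
    (hS : Rep e (σ.arr 5) S) (hsS : ¬ S s)
    (hQ : ∀ τ t', Rep e (τ.arr 7) (· ∈ ballIn G {x | ¬ S x} d s) →
      Frame (wregs search) (warrs search) σ τ →
      t' ≤ t + searchCost n (st n) d → Q τ t') : wp search σ t Q := by
  suffices h : wp search σ t fun τ t' => Rep e (τ.arr 7) (· ∈ ballIn G {x | ¬ S x} d s) ∧
      t' ≤ t + searchCost n (st n) d from
    h.frame.mono fun τ t' h => hQ τ t' h.1.1 h.2 h.1.2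
  set X : Set V := {x | ¬ S x} with hX
  rw [search, wp_seq]
  refine wp_map (e := e) ⟨by decide, by decide, by decide, by decide, by decide⟩ hbase 7 1
    (fun _ x => x = 0) ?_ ?_
  · intro v τ t' hi hF _
    have f4 : τ.reg 4 = 0 := by rw [hF.reg 4 (by decide), hbase.zero]
    simp [hi, f4]
    intro k hk
    rw [Function.update_of_ne hk]
  intro τ t₁ hz hF ht₁
  have g9 : τ.reg 9 = e s := by rw [hF.reg 9 (by decide), hs]
  have g10 : τ.reg 10 = d := by rw [hF.reg 10 (by decide), hd]
  have gS : Rep e (τ.arr 5) S := by rw [hF.arr 5 (by decide)]; exact hS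
  have gb : Base n m st nb τ := hbase.frame hF (by decide) (by decide)
  simp only [wp_seq, wp_add, wp_store, setReg_reg, g9, g10, gb.one, Nat.reduceEqDiff,
    if_true, if_false]
  -- The source is marked `d + 1`. After `k` rounds every positive mark exceeds `d - k`, so the
  -- threshold `d - k` of the next round separates old vertices from new ones.
  refine wp_loop d (fun k ρ t' => Base n m st nb ρ ∧ Rep e (ρ.arr 5) S ∧ ρ.reg 10 = d - k ∧
    Rep e (ρ.arr 7) (· ∈ ballIn G X k s) ∧ (∀ w, 0 < ρ.arr 7 (e w) → d - k < ρ.arr 7 (e w)) ∧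
    t' ≤ t₁ + 2 + k * (10 * n + 8 * st n + 4)) ?_ ?_ ?_ ?_
  · refine ⟨?_, ?_, by simp [g10], ?_, ?_, by omega⟩
    · exact gb.frame (rs := [16]) (as := [7]) ⟨fun x hx => by simp at hx; simp [hx],
        fun a ha => by simp at ha; simp [ha]⟩ (by decide) (by decide)
    · simpa using gS
    · intro w
      by_cases hw : w = s
      · subst hw
        simp [mem_ballIn_zero, hX, hsS]
      · simp [mem_ballIn_zero, hw, Function.update_of_ne (vertex_ne hw), hz]
    · intro w hw
      by_cases hw' : w = s
      · subst hw'
        simp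
      · simp [Function.update_of_ne (vertex_ne hw'), hz] at hw
  · rintro k ρ t' hk ⟨hb, hS', h10, hR, hpos, ht'⟩ -
    set θ := d - k with hθ
    have hθ0 : 0 < θ := by omega
    rw [wp_seq]
    refine wp_forTo ⟨by decide, by decide, by decide, by decide, by decide⟩ n
      (fun j ρ' => (∀ w, θ < ρ'.arr 7 (e w) ↔ w ∈ ballIn G X k s) ∧
        Rep e (ρ'.arr 7) (fun w => w ∈ ballIn G X k s ∨
          ¬ S w ∧ ∃ v ∈ ballIn G X k s, (e v : ℕ) < j ∧ G.Adj v w) ∧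
        (∀ w, 0 < ρ'.arr 7 (e w) → θ ≤ ρ'.arr 7 (e w)))
      (fun j => 8 + 8 * (st (j + 1) - st j)) hb.reg_zero hb.one ?_ ?_ ?_
    · refine ⟨fun w => ?_, fun w => ?_, fun w hw => (hpos w hw).le⟩
      · refine Iff.trans ?_ (hR w)
        exact ⟨fun h => (Nat.zero_le _).trans_lt h, hpos w⟩
      · simp only [setReg_arr, hR w, Nat.not_lt_zero]
        simp
    · rintro j ρ' t'' hj ⟨hI1, hI2, hI3⟩ hi hF'
      obtain ⟨v, rfl⟩ := exists_vertex e hj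
      have hb' : Base n m st nb ρ' := hb.frame hF' (by decide) (by decide)
      have hS'' : Rep e (ρ'.arr 5) S := by rw [hF'.arr 5 (by decide)]; exact hS'
      refine wp_scanVertex hadj hb' hi hS'' (by rw [hF'.reg 10 (by decide), h10]) hθ0 hI1 hI2 hI3 ?_
      intro ρ₂ t₂ h1 h2 h3 h4
      refine ⟨⟨h1, fun w => ?_, h3⟩, h4⟩
      simp only [setReg_arr]
      rw [h2 w]
      constructor
      · rintro ((h | ⟨hw, x, hx, hxv, hxw⟩) | ⟨hw, hvN, hvw⟩)
        · exact Or.inl h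
        · exact Or.inr ⟨hw, x, hx, by omega, hxw⟩
        · exact Or.inr ⟨hw, v, hvN, by omega, hvw⟩
      · rintro (h | ⟨hw, x, hx, hxv, hxw⟩)
        · exact Or.inl (Or.inl h)
        · rcases lt_succ_vertex.1 hxv with hxv | rfl
          · exact Or.inl (Or.inr ⟨hw, x, hx, hxv, hxw⟩)
          · exact Or.inr ⟨hw, hx, hxw⟩
    · rintro ρ' t'' ⟨hI1, hI2, hI3⟩ hF' ht''
      have hb' : Base n m st nb ρ' := hb.frame hF' (by decide) (by decide)
      have h10' : ρ'.reg 10 = θ := by rw [hF'.reg 10 (by decide), h10]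
      rw [wp_sub, h10', hb'.one]
      refine ⟨?_, ?_, by simp; omega, ?_, ?_, ?_⟩
      · exact hb'.frame (frame_setReg 10 _) (by decide) (by decide)
      · simp only [setReg_arr]; rw [hF'.arr 5 (by decide)]; exact hS'
      · intro w
        simp only [setReg_arr]
        rw [hI2 w, mem_ballIn_succ]
        refine or_congr Iff.rfl (and_congr Iff.rfl ?_)
        constructor
        · rintro ⟨v, hv, -, hvw⟩; exact ⟨v, hv, hvw⟩
        · rintro ⟨v, hv, hvw⟩; exact ⟨v, hv, (e v).2, hvw⟩
      · intro w hw
        have := hI3 w hw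
        simp only [setReg_arr]
        omega
      · have hsum : ∑ j ∈ Finset.range n, (8 + 8 * (st (j + 1) - st j) + 2) =
            10 * n + 8 * st n := by
          rw [← hadj.sum_eq, Finset.mul_sum, Finset.sum_add_distrib, Finset.sum_add_distrib]
          simp
          ring
        rw [hsum] at ht''
        rw [add_mul]
        omega
  · rintro ρ t' ⟨hb, -, h10, -⟩
    rw [h10, hb.zero]; omega
  · rintro k ρ t' hk ⟨hb, -, h10, hR, -, ht'⟩ hc
    rw [h10, hb.zero] at hc
    obtain rfl : k = d := by omega
    refine ⟨hR, ?_⟩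
    have h1 : k * (10 * n + 8 * st n + 4) ≤ k * (20 * (n + st n + 1)) :=
      Nat.mul_le_mul_left _ (by omega)
    have h2 : searchCost n (st n) k = k * (20 * (n + st n + 1)) + 20 * (n + st n + 1) := by
      rw [searchCost]; ring
    omega

end Search

/-! ### Loops over vertex sets -/

section Loops

variable {V : Type*} {n m : ℕ} {e : V ≃ Fin n} {G : SimpleGraph V} {st nb : ℕ → ℕ}
  {σ τ : State} {t : ℕ} {Q : State → ℕ → Prop}

/-- The vertices satisfying `P` that have a number less than `j`. -/
noncomputable def pre [Fintype V] (e : V ≃ Fin n) (P : V → Prop) (j : ℕ) : Finset V :=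
  {v | (e v : ℕ) < j ∧ P v}

@[simp] lemma pre_zero [Fintype V] (P : V → Prop) : pre e P 0 = ∅ := by simp [pre]

@[simp] lemma pre_top [Fintype V] (P : V → Prop) : pre e P n = ({v | P v} : Finset V) := by
  ext v; simp [pre]

lemma notMem_pre [Fintype V] (P : V → Prop) (v : V) : v ∉ pre e P (e v) := by simp [pre]

lemma pre_succ [Fintype V] (P : V → Prop) (v : V) :
    pre e P (e v + 1) = if P v then insert v (pre e P (e v)) else pre e P (e v) := by
  ext w
  by_cases hw : w = v
  · subst hw
    by_cases hP : P w <;> simp [pre, hP]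
  · split_ifs <;> simp only [pre, Finset.mem_filter, Finset.mem_univ, true_and, lt_succ_vertex, hw,
      or_false, Finset.mem_insert, false_or]

lemma card_pre_succ [Fintype V] (P : V → Prop) (v : V) :
    #(pre e P (e v + 1)) = #(pre e P (e v)) + if P v then 1 else 0 := by
  rw [pre_succ]
  split_ifs
  · rw [Finset.card_insert_of_notMem (notMem_pre P v)]
  · rfl

/-- Execute `P` for all vertices with a positive entry in the array `a`. -/
def forEach (i x a : ℕ) (P : Prog) : Prog :=
  forTo i 0 (.seq (.load x a i) (.ite 4 x P (.const 17 0)))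

/-- The body may change the entry of the current vertex in the controlling array but no other, which
pruning needs. The cost of the body is charged only to members of `B`. -/
lemma wp_forEach [Fintype V] {i x a : ℕ} {P : Prog}
    (hv : LoopVars i 0 (.seq (.load x a i) (.ite 4 x P (.const 17 0))))
    (h4 : 4 ∉ i :: x :: 17 :: wregs P) (hbase : Base n m st nb σ) {B : Finset V}
    (hB : Rep e (σ.arr a) (· ∈ B)) (Inv : Finset V → State → Prop) (c : ℕ)
    (hpres : ∀ D ρ y w, y = i ∨ y = x ∨ y = 17 → Inv D ρ → Inv D (ρ.setReg y w))
    (h0 : Inv ∅ σ)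
    (hstep : ∀ D v τ t', D ⊆ B → v ∈ B → v ∉ D → Inv D τ → τ.reg i = (e v : ℕ) →
      Frame (i :: x :: 17 :: wregs P) (warrs P) σ τ → 0 < τ.arr a (e v) → wp P τ t' fun τ' t'' =>
        Inv (insert v D) τ' ∧ (∀ k : ℕ, k ≠ e v → τ'.arr a k = τ.arr a k) ∧ t'' ≤ t' + c)
    (hQ : ∀ τ t', Inv B τ → Frame (i :: x :: 17 :: wregs P) (warrs P) σ τ →
      t' ≤ t + (2 + 5 * n + #B * c) → Q τ t') :
    wp (forEach i x a P) σ t Q := by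
  have hw : ∀ τ, Frame (i :: wregs (.seq (.load x a i) (.ite 4 x P (.const 17 0))))
      (warrs (.seq (.load x a i) (.ite 4 x P (.const 17 0)))) σ τ →
      Frame (i :: x :: 17 :: wregs P) (warrs P) σ τ := by
    intro τ hF
    refine hF.trans (Frame.refl (rs := []) (as := [])) ?_ (by simp) ?_ (by simp)
    · intro y hy
      simp only [wregs, List.mem_cons, List.mem_append, List.not_mem_nil, or_false] at hy ⊢
      tauto
    · simp [warrs]
  -- Cost of the body as a function of the vertex number: zero outside `B`, so that summing gives
  -- `#B * c` rather than `n * c`.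
  obtain ⟨κ, hκ, hcost⟩ : ∃ κ : ℕ → ℕ, (∀ v, κ (e v) = if v ∈ B then c else 0) ∧
      ∑ j ∈ Finset.range n, (3 + κ j + 2) = 5 * n + #B * c := by
    refine ⟨fun j => if h : j < n then if e.symm ⟨j, h⟩ ∈ B then c else 0 else 0, by simp, ?_⟩
    rw [← Fin.sum_univ_eq_sum_range
      (fun j => 3 + (if h : j < n then if e.symm ⟨j, h⟩ ∈ B then c else 0 else 0) + 2),
      ← Equiv.sum_comp e]
    simp only [Fin.is_lt, dif_pos, Fin.eta, Equiv.symm_apply_apply, Finset.sum_add_distrib]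
    rw [← Finset.sum_filter]
    simp [Fintype.card_congr e]
    ring
  refine wp_forTo hv n (fun j τ => Inv (pre e (· ∈ B) j) τ ∧
      ∀ v, j ≤ (e v : ℕ) → τ.arr a (e v) = σ.arr a (e v))
    (fun j => 3 + κ j) hbase.reg_zero hbase.one ⟨by simpa using hpres _ _ _ _ (Or.inl rfl) h0, by
        simp⟩ ?_ ?_
  · rintro j τ t' hj ⟨hI, hI2⟩ hi hF
    obtain ⟨v, rfl⟩ := exists_vertex e hj
    have f4 : τ.reg 4 = 0 := by
      rw [(hw τ hF).reg 4 h4, hbase.zero]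
    have h4x : (4 : ℕ) ≠ x := fun h => h4 (by simp [h])
    simp only [wp_seq, wp_load, wp_ite, setReg_reg, if_true, if_neg h4x, f4, hi, hI2 v le_rfl, hB v,
      wp_const]
    split_ifs with hvB
    · have hF' : Frame (i :: x :: 17 :: wregs P) (warrs P) σ
          (τ.setReg x (σ.arr a (e v))) :=
        (hw τ hF).trans (frame_setReg _ _) (by simp) (by simp) (by simp) (by simp)
      refine (hstep _ v (τ.setReg x (σ.arr a (e v))) _ (by intro w; simp [pre]) hvB
        (notMem_pre _ v) (hpres _ _ _ _ (Or.inr (Or.inl rfl)) hI) ?_ hF' ?_).mono ?_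
      · rw [setReg_reg, if_neg, hi]
        exact fun h => hv.index (by simp [wregs, h])
      · simp only [setReg_arr]
        rw [hI2 v le_rfl]
        exact (hB v).2 hvB
      · rintro τ' t'' ⟨h1, h2, h3⟩
        refine ⟨⟨?_, fun w hw => ?_⟩, ?_⟩
        · rw [pre_succ, if_pos hvB]
          exact hpres _ _ _ _ (Or.inl rfl) h1
        · have h2' := h2 (e w) (by omega)
          simp only [setReg_arr] at h2' ⊢
          rw [h2']
          exact hI2 w (by omega)
        · rw [hκ, if_pos hvB]
          omega
    · refine ⟨⟨?_, fun w hw => ?_⟩, by omega⟩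
      · rw [pre_succ, if_neg hvB]
        exact hpres _ _ _ _ (Or.inl rfl) (hpres _ _ _ _ (Or.inr (Or.inr rfl))
          (hpres _ _ _ _ (Or.inr (Or.inl rfl)) hI))
      · simp only [setReg_arr]
        exact hI2 w (by omega)
  · rintro τ t' ⟨hI, -⟩ hF ht
    rw [hcost] at ht
    refine hQ τ t' ?_ (hw τ hF) (by omega)
    rw [pre_top] at hI
    convert hI using 1
    ext; simp

/-- A loop over all vertices that counts, in register `c`, those that satisfy `A`. -/
lemma wp_count [Fintype V] {i c : ℕ} {P : Prog} (hv : LoopVars i 0 P) (hic : c ≠ i)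
    (hbase : Base n m st nb σ) (hc : σ.reg c = 0) (A : V → Prop) (k : ℕ)
    (hstep : ∀ v τ t', τ.reg i = (e v : ℕ) → Frame (i :: wregs P) (warrs P) σ τ →
      wp P τ t' fun τ' t'' => τ'.reg c = τ.reg c + (if A v then 1 else 0) ∧ t'' ≤ t' + k)
    (hQ : ∀ τ t', τ.reg c = #{v | A v} → Frame (i :: wregs P) (warrs P) σ τ →
      t' ≤ t + (2 + n * (k + 2)) → Q τ t') :
    wp (forTo i 0 P) σ t Q := by
  refine wp_forTo_const hv n (fun j τ => τ.reg c = #(pre e A j)) k hbase.reg_zero hbase.one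
    (by simp [hic, hc]) ?_ ?_
  · intro j τ t' hj hI hi hF
    obtain ⟨v, rfl⟩ := exists_vertex e hj
    refine (hstep v τ t' hi hF).mono ?_
    rintro τ' t'' ⟨h1, h2⟩
    refine ⟨?_, h2⟩
    rw [setReg_reg, if_neg hic, h1, hI, card_pre_succ]
  · intro τ t' hI hF ht
    rw [pre_top] at hI
    exact hQ τ t' hI hF (by omega)

/-- Set all entries of array `a` to zero. -/
def clear (a : ℕ) : Prog := forTo 22 0 (.store a 22 4)

/-- Copy array `a` to array `b`. -/
def copy (a b : ℕ) : Prog := forTo 22 0 (.seq (.load 23 a 22) (.store b 22 23))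

/-- Remove the marked vertices from the set with indicator array `a`. -/
def removeMarked (a : ℕ) : Prog :=
  forTo 22 0 (.seq (.load 23 7 22) (.ite 4 23 (.store a 22 4) (.const 17 0)))

/-- Remove the unmarked vertices from the set with indicator array `a`. -/
def keepMarked (a : ℕ) : Prog :=
  forTo 22 0 (.seq (.load 23 7 22) (.ite 4 23 (.const 17 0) (.store a 22 4)))

/-- Add one to the entries of array `8` of the marked vertices. -/
def tally : Prog :=
  forTo 22 0 (.seq (.load 23 7 22) (.ite 4 23
    (.seq (.load 21 8 22) (.seq (.add 21 21 3) (.store 8 22 21))) (.const 17 0)))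

/-- Count, in register `c`, the marked vertices in the set with indicator array `a`. -/
def countMarked (a c : ℕ) : Prog :=
  .seq (.const c 0) (forTo 22 0 (.seq (.load 23 7 22) (.ite 4 23
    (.seq (.load 23 a 22) (.ite 4 23 (.add c c 3) (.const 17 0))) (.const 17 0))))

lemma wp_clear {a : ℕ} (hbase : Base n m st nb σ)
    (hQ : ∀ τ t', (∀ v, τ.arr a (e v) = 0) → Frame [22] [a] σ τ →
      t' ≤ t + (2 + 3 * n) → Q τ t') : wp (clear a) σ t Q := by
  refine wp_map (e := e) ⟨by decide, by decide, by simp [wregs], by simp [wregs], by simp [wregs]⟩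
    hbase a 1 (fun _ x => x = 0) ?_ ?_
  · intro v τ t' hi hF _
    have f4 : τ.reg 4 = 0 := by rw [hF.reg 4 (by simp [wregs]), hbase.zero]
    simp only [wp_store, setArr_arr, if_true, hi, f4, Function.update_self]
    exact ⟨trivial, fun k hk => Function.update_of_ne hk _ _, by omega⟩
  · intro τ t' h hF ht
    exact hQ τ t' h hF (by omega)

lemma wp_copy {a b : ℕ} (hab : a ≠ b) (hbase : Base n m st nb σ)
    (hQ : ∀ τ t', (∀ v, τ.arr b (e v) = σ.arr a (e v)) → Frame [22, 23] [b] σ τ →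
      t' ≤ t + (2 + 4 * n) → Q τ t') : wp (copy a b) σ t Q := by
  refine wp_map (e := e) ⟨by decide, by decide, by simp [wregs], by simp [wregs], by simp [wregs]⟩
    hbase b 2 (fun v x => x = σ.arr a (e v)) ?_ ?_
  · intro v τ t' hi hF _
    have fa : τ.arr a = σ.arr a := by rw [hF.arr a (by simp [warrs, hab])]
    simp only [wp_seq, wp_load, wp_store, setArr_arr, if_true, hi, setReg_reg, Nat.reduceEqDiff,
      if_false, Function.update_self, fa, setReg_arr]
    exact ⟨trivial, fun k hk => Function.update_of_ne hk _ _, by omega⟩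
  · intro τ t' h hF ht
    exact hQ τ t' h hF (by omega)

lemma wp_removeMarked {a : ℕ} (ha : a ≠ 7) (hbase : Base n m st nb σ) {A M : V → Prop}
    (hA : Rep e (σ.arr a) A) (hM : Rep e (σ.arr 7) M)
    (hQ : ∀ τ t', Rep e (τ.arr a) (fun v => A v ∧ ¬ M v) → Frame [22, 23, 17] [a] σ τ →
      t' ≤ t + (2 + 5 * n) → Q τ t') : wp (removeMarked a) σ t Q := by
  refine wp_map (e := e) ⟨by decide, by decide, by simp [wregs], by simp [wregs], by simp [wregs]⟩
    hbase a 3 (fun v x => 0 < x ↔ A v ∧ ¬ M v) ?_ ?_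
  · intro v τ t' hi hF hav
    have f4 : τ.reg 4 = 0 := by rw [hF.reg 4 (by simp [wregs]), hbase.zero]
    have f7 : τ.arr 7 = σ.arr 7 := by rw [hF.arr 7 (by simp [warrs, ha.symm])]
    simp only [wp_seq, wp_load, wp_store, wp_ite, wp_const, setArr_arr, if_true, hi, setReg_reg,
      Nat.reduceEqDiff, if_false, f4, f7, setReg_arr, hM v]
    split_ifs with h
    · exact ⟨by simp [h], fun k hk => Function.update_of_ne hk _ _, by omega⟩
    · rw [hav, hA v]
      exact ⟨by simp [h], fun _ _ => trivial, by omega⟩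
  · intro τ t' h hF ht
    exact hQ τ t' h hF (by omega)

lemma wp_keepMarked {a : ℕ} (ha : a ≠ 7) (hbase : Base n m st nb σ) {A M : V → Prop}
    (hA : Rep e (σ.arr a) A) (hM : Rep e (σ.arr 7) M)
    (hQ : ∀ τ t', Rep e (τ.arr a) (fun v => A v ∧ M v) → Frame [22, 23, 17] [a] σ τ →
      t' ≤ t + (2 + 5 * n) → Q τ t') : wp (keepMarked a) σ t Q := by
  refine wp_map (e := e) ⟨by decide, by decide, by simp [wregs], by simp [wregs], by simp [wregs]⟩
    hbase a 3 (fun v x => 0 < x ↔ A v ∧ M v) ?_ ?_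
  · intro v τ t' hi hF hav
    have f4 : τ.reg 4 = 0 := by rw [hF.reg 4 (by simp [wregs]), hbase.zero]
    have f7 : τ.arr 7 = σ.arr 7 := by rw [hF.arr 7 (by simp [warrs, ha.symm])]
    simp only [wp_seq, wp_load, wp_store, wp_ite, wp_const, setArr_arr, if_true, hi, setReg_reg,
      Nat.reduceEqDiff, if_false, f4, f7, setReg_arr, hM v]
    split_ifs with h
    · rw [hav, hA v]
      exact ⟨by simp [h], fun _ _ => trivial, by omega⟩
    · exact ⟨by simp [h], fun k hk => Function.update_of_ne hk _ _, by omega⟩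
  · intro τ t' h hF ht
    exact hQ τ t' h ⟨fun x hx => hF.reg x (by simp [wregs] at hx ⊢; tauto),
      fun x hx => hF.arr x (by simpa [warrs] using hx)⟩ (by omega)

lemma wp_tally (hbase : Base n m st nb σ) {M : V → Prop} (hM : Rep e (σ.arr 7) M)
    (hQ : ∀ τ t', (∀ v, τ.arr 8 (e v) = σ.arr 8 (e v) + if M v then 1 else 0) →
      Frame (wregs tally) (warrs tally) σ τ →
      t' ≤ t + (2 + 7 * n) → Q τ t') : wp tally σ t Q := by
  suffices h : wp tally σ t fun τ t' =>
      (∀ v, τ.arr 8 (e v) = σ.arr 8 (e v) + if M v then 1 else 0) ∧ t' ≤ t + (2 + 7 * n) from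
    h.frame.mono fun τ t' h => hQ τ t' h.1.1 h.2 h.1.2
  refine wp_map (e := e) ⟨by decide, by decide, by decide, by decide, by decide⟩
    hbase 8 5 (fun v x => x = σ.arr 8 (e v) + if M v then 1 else 0) ?_ ?_
  · intro v τ t' hi hF hav
    have f3 : τ.reg 3 = 1 := by rw [hF.reg 3 (by decide), hbase.one]
    have f4 : τ.reg 4 = 0 := by rw [hF.reg 4 (by decide), hbase.zero]
    have f7 : τ.arr 7 = σ.arr 7 := by rw [hF.arr 7 (by decide)]
    simp only [wp_seq, wp_load, wp_store, wp_ite, wp_const, wp_add, setArr_arr, if_true, hi,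
      setReg_reg, Nat.reduceEqDiff, if_false, f4, f7, f3, setReg_arr, hM v, hav]
    split_ifs with h
    · exact ⟨by simp, fun k hk => Function.update_of_ne hk _ _, by omega⟩
    · exact ⟨by simp, fun _ _ => trivial, by omega⟩
  · intro τ t' h hF ht
    exact ⟨h, by omega⟩

lemma wp_countMarked [Fintype V] {a c : ℕ} (hc : c ∉ [0, 2, 3, 4, 17, 22, 23]) (hbase : Base n m
    st nb σ)
    {A M : V → Prop} (hA : Rep e (σ.arr a) A) (hM : Rep e (σ.arr 7) M)
    (hQ : ∀ τ t', τ.reg c = #{v | A v ∧ M v} → Frame [c, 17, 22, 23] [] σ τ →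
      t' ≤ t + (3 + 8 * n) → Q τ t') : wp (countMarked a c) σ t Q := by
  simp only [List.mem_cons, List.not_mem_nil, or_false, not_or] at hc
  obtain ⟨c0, c2, c3, c4, c17, c22, c23⟩ := hc
  have hb : Base n m st nb (σ.setReg c 0) := hbase.frame (frame_setReg c 0)
    (by intro x hx; simp at hx ⊢; omega) (by simp)
  rw [countMarked, wp_seq, wp_const]
  refine wp_count (e := e) ⟨by decide, by decide, by simp [wregs, Ne.symm c0],
    by simp [wregs, Ne.symm c3], by simp [wregs, Ne.symm c22]⟩ c22 hb (by simp)
    (fun v => A v ∧ M v) 6 ?_ ?_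
  · intro v τ t' hi hF
    have f3 : τ.reg 3 = 1 := by rw [hF.reg 3 (by simp [wregs, Ne.symm c3]), hb.one]
    have f4 : τ.reg 4 = 0 := by rw [hF.reg 4 (by simp [wregs, Ne.symm c4]), hb.zero]
    have f7 : τ.arr 7 = σ.arr 7 := by rw [hF.arr 7 (by simp [warrs])]; rfl
    have fa : τ.arr a = σ.arr a := by rw [hF.arr a (by simp [warrs])]; rfl
    simp only [wp_seq, wp_load, wp_ite, wp_const, wp_add, if_true, hi, c23, c17,
      setReg_reg, Nat.reduceEqDiff, if_false, f4, f7, fa, f3, setReg_arr, hM v, hA v]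
    by_cases h1 : M v <;> by_cases h2 : A v <;>
      simp only [h1, h2, if_true, if_false, and_true, and_false] <;>
      exact ⟨by simp, by omega⟩
  · intro τ t' h hF ht
    refine hQ τ t' (by convert h) ⟨fun x hx => ?_, fun x hx => hF.arr x (by simp [warrs])⟩ (by
      omega)
    rw [hF.reg x (by simp [wregs] at hx ⊢; tauto), setReg_reg, if_neg (by simp at hx; tauto)]

/-- Search from the vertex with number `reg s` up to distance `reg d`. -/
def searchFrom (s d : ℕ) : Prog := .seq (.add 9 s 4) (.seq (.add 10 d 4) search)

lemma wp_searchFrom (hadj : AdjLists e G st nb) (hbase : Base n m st nb σ) {s d : ℕ} (hd9 : d ≠ 9)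
    {v : V} {k C : ℕ} {S : V → Prop} (hs : σ.reg s = e v) (hd : σ.reg d = k)
    (hS : Rep e (σ.arr 5) S) (hsS : ¬ S v) (hC : searchCost n (st n) k ≤ C)
    (hQ : ∀ τ t', Rep e (τ.arr 7) (· ∈ ballIn G {x | ¬ S x} k v) →
      Frame (9 :: 10 :: wregs search) (warrs search) σ τ →
      t' ≤ t + (2 + C) → Q τ t') : wp (searchFrom s d) σ t Q := by
  simp only [searchFrom, wp_seq, wp_add, setReg_reg, hs, hbase.zero, if_neg hd9, hd,
    Nat.reduceEqDiff, if_false, add_zero]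
  have hF0 : Frame [9, 10] [] σ ((σ.setReg 9 (e v)).setReg 10 k) :=
    (frame_setReg 9 _).trans (frame_setReg 10 _) (by simp) (by simp) (by simp) (by simp)
  refine wp_search hadj (hbase.frame hF0 (by decide) (by decide)) (s := v) (d := k) (by simp)
    (by simp) hS hsS ?_
  intro τ t' h hF ht
  exact hQ τ t' h (hF0.trans hF (by simp) (by intro x; simp; tauto) (by simp) (by simp)) (by omega)

end Loops

/-! ### One step of the algorithm -/

section Step

variable {V : Type*} {n m : ℕ} {e : V ≃ Fin n} {G : SimpleGraph V} {st nb : ℕ → ℕ}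
  {σ τ : State} {t : ℕ} {Q : State → ℕ → Prop} {S B T I : Finset V} {h k C : ℕ}

/-- Store in array `8`, for every vertex, the number of elements of the set with indicator array
`6` at distance at most `reg 6`. -/
def nearCounts : Prog := .seq (clear 8) (forEach 20 21 6 (.seq (searchFrom 20 6) tally))

/-- Find the largest entry of array `8`. -/
def argmax : Prog :=
  .seq (.const 24 0) (.seq (.const 25 0) (forTo 22 0 (.seq (.load 23 8 22)
    (.ite 24 23 (.seq (.add 24 23 4) (.add 25 22 4)) (.const 17 0)))))

/-- Find the element of the set with indicator array `9` that has the fewest elements of this set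
at distance at most `reg 5`. -/
def argmin : Prog :=
  .seq (.add 27 0 3) (forEach 20 21 9 (.seq (searchFrom 20 5) (.seq (countMarked 9 29)
    (.ite 29 27 (.seq (.add 27 29 4) (.add 28 20 4)) (.const 17 0)))))

/-- Move the result of `argmin` from the set `9` to the set `10`, and remove from the set `9` all
vertices at distance at most `reg 5` from it. -/
def pick : Prog :=
  .seq argmin (.ite 0 27 (.const 17 0) (.seq (.store 10 28 3) (.seq (.add 26 26 3)
    (.seq (searchFrom 28 5) (removeMarked 9)))))

/-- Select greedily a subset of the set `6` that is independent at distance `reg 5`. -/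
def greedy : Prog :=
  .seq (copy 6 9) (.seq (clear 10) (.seq (.const 26 0) (forTo 30 2 pick)))

/-- Either delete a vertex from the graph that is near to many elements of the set `6`, or make
this set independent at distance `reg 5`. -/
def step : Prog :=
  .seq nearCounts (.seq argmax (.seq greedy (.ite 26 24
    (.seq (searchFrom 25 6) (.seq (.store 5 25 3) (keepMarked 6)))
    (.seq (copy 10 6) (.const 7 0)))))

lemma le_searchCost (n E d : ℕ) : 20 * (n + 1) ≤ searchCost n E d := by
  rw [searchCost, mul_assoc]
  refine Nat.mul_le_mul_left _ ?_
  calc n + 1 ≤ 1 * (n + E + 1) := by omega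
    _ ≤ _ := Nat.mul_le_mul_right _ (by omega)

lemma wp_nearCounts [Fintype V] (hadj : AdjLists e G st nb) (hbase : Base n m st nb σ)
    (hS : Rep e (σ.arr 5) (· ∈ S)) (hB : Rep e (σ.arr 6) (· ∈ B)) (hBS : ∀ b ∈ B, b ∉ S)
    (hh : σ.reg 6 = h) (hC : searchCost n (st n) h ≤ C)
    (hQ : ∀ τ t', (∀ v, τ.arr 8 (e v) = #(near G {x | x ∉ S} h B v)) →
      Frame (wregs nearCounts) (warrs nearCounts) σ τ → t' ≤ t + (C + #B * (2 * C)) → Q τ t') :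
    wp nearCounts σ t Q := by
  suffices hs : wp nearCounts σ t fun τ t' =>
      (∀ v, τ.arr 8 (e v) = #(near G {x | x ∉ S} h B v)) ∧ t' ≤ t + (C + #B * (2 * C)) from
    hs.frame.mono fun τ t' hs => hQ τ t' hs.1.1 hs.2 hs.1.2
  have hCn := (le_searchCost n (st n) h).trans hC
  rw [nearCounts, wp_seq]
  refine wp_clear (e := e) hbase ?_
  intro τ t₁ hz hF ht₁
  have hb : Base n m st nb τ := hbase.frame hF (by decide) (by decide)
  refine wp_forEach ⟨by decide, by decide, by decide, by decide, by decide⟩ (by decide) hb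
    (B := B) (by rw [hF.arr 6 (by decide)]; exact hB)
    (fun D ρ => ∀ v, ρ.arr 8 (e v) = #(near G {x | x ∉ S} h D v)) (2 + C + (2 + 7 * n)) ?_ ?_ ?_ ?_
  · exact fun D ρ y w _ hI => hI
  · intro v
    rw [hz v]
    simp [near]
  · intro D b ρ t' hD hbB hbD hI hi hF' _
    rw [wp_seq]
    refine wp_searchFrom hadj (hb.frame hF' (by decide) (by decide)) (by decide) hi
      (by rw [hF'.reg 6 (by decide), hF.reg 6 (by decide), hh])
      (S := (· ∈ S)) (by rw [hF'.arr 5 (by decide), hF.arr 5 (by decide)]; exact hS)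
      (hBS b hbB) hC ?_
    intro ρ₁ t₂ hM hF₁ ht₂
    refine wp_tally ((hb.frame hF' (by decide) (by decide)).frame hF₁ (by decide) (by decide))
      hM ?_
    intro ρ₂ t₃ hR hF₂ ht₃
    refine ⟨fun v => ?_, fun j hj => ?_, by omega⟩
    · rw [hR v, hF₁.arr 8 (by decide), hI v, near_insert hbD]
    · rw [hF₂.arr 6 (by decide), hF₁.arr 6 (by decide)]
  · intro ρ t' hI _ ht'
    refine ⟨hI, ?_⟩
    have : #B * (2 + C + (2 + 7 * n)) ≤ #B * (2 * C) := Nat.mul_le_mul_left _ (by omega)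
    omega

lemma wp_argmax (hbase : Base n m st nb σ)
    (hQ : ∀ τ t', (∀ v, τ.arr 8 (e v) ≤ τ.reg 24) →
      (0 < τ.reg 24 → ∃ v, τ.reg 25 = (e v : ℕ) ∧ τ.arr 8 (e v) = τ.reg 24) →
      Frame (wregs argmax) (warrs argmax) σ τ → t' ≤ t + (4 + 6 * n) → Q τ t') :
    wp argmax σ t Q := by
  suffices hs : wp argmax σ t fun τ t' => (∀ v, τ.arr 8 (e v) ≤ τ.reg 24) ∧
      (0 < τ.reg 24 → ∃ v, τ.reg 25 = (e v : ℕ) ∧ τ.arr 8 (e v) = τ.reg 24) ∧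
      t' ≤ t + (4 + 6 * n) from
    hs.frame.mono fun τ t' hs => hQ τ t' hs.1.1 hs.1.2.1 hs.2 hs.1.2.2
  simp only [argmax, wp_seq, wp_const]
  have hF0 : Frame [24, 25] [] σ ((σ.setReg 24 0).setReg 25 0) :=
    (frame_setReg 24 _).trans (frame_setReg 25 _) (by simp) (by simp) (by simp) (by simp)
  have hb := hbase.frame hF0 (by decide) (by decide)
  refine wp_forTo_const ⟨by decide, by decide, by decide, by decide, by decide⟩ n
    (fun j τ => (∀ v, (e v : ℕ) < j → τ.arr 8 (e v) ≤ τ.reg 24) ∧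
      (0 < τ.reg 24 → ∃ v, τ.reg 25 = (e v : ℕ) ∧ τ.arr 8 (e v) = τ.reg 24)) 4 hb.reg_zero hb.one
          ?_ ?_ ?_
  · simp
  · rintro j τ t' hj ⟨hI1, hI2⟩ hi hF
    obtain ⟨v, rfl⟩ := exists_vertex e hj
    have f4 : τ.reg 4 = 0 := by rw [hF.reg 4 (by decide), hb.zero]
    simp only [wp_seq, wp_load, wp_ite, wp_add, wp_const, setReg_reg, setReg_arr, hi, f4,
      Nat.reduceEqDiff, if_true, if_false, add_zero]
    split_ifs with hc
    · refine ⟨⟨fun w hw => ?_, fun _ => ⟨v, rfl, rfl⟩⟩, by omega⟩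
      rcases lt_succ_vertex.1 hw with hw | rfl
      · exact (hI1 w hw).trans hc.le
      · exact le_rfl
    · refine ⟨⟨fun w hw => ?_, hI2⟩, by omega⟩
      rcases lt_succ_vertex.1 hw with hw | rfl
      · exact hI1 w hw
      · exact not_lt.1 hc
  · rintro τ t' ⟨hI1, hI2⟩ hF ht
    exact ⟨fun v => hI1 v (e v).2, hI2, by omega⟩

lemma wp_argmin [Fintype V] (hadj : AdjLists e G st nb) (hbase : Base n m st nb σ)
    (hS : Rep e (σ.arr 5) (· ∈ S)) (hT : Rep e (σ.arr 9) (· ∈ T)) (hTS : ∀ b ∈ T, b ∉ S)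
    (hk : σ.reg 5 = k) (hC : searchCost n (st n) k ≤ C)
    (hQ : ∀ τ t', (T = ∅ ∧ τ.reg 27 = n + 1 ∨ τ.reg 27 ≤ n ∧ ∃ v ∈ T, τ.reg 28 = (e v : ℕ) ∧
        ∀ w ∈ T, #{b ∈ T | b ∈ ballIn G {x | x ∉ S} k v} ≤
          #{b ∈ T | b ∈ ballIn G {x | x ∉ S} k w}) →
      Frame (wregs argmin) (warrs argmin) σ τ → t' ≤ t + (C + #T * (2 * C)) → Q τ t') :
    wp argmin σ t Q := by
  set f : V → ℕ := fun w => #{b ∈ T | b ∈ ballIn G {x | x ∉ S} k w} with hf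
  suffices hs : wp argmin σ t fun τ t' => (T = ∅ ∧ τ.reg 27 = n + 1 ∨ τ.reg 27 ≤ n ∧
      ∃ v ∈ T, τ.reg 28 = (e v : ℕ) ∧ ∀ w ∈ T, f v ≤ f w) ∧ t' ≤ t + (C + #T * (2 * C)) from
    hs.frame.mono fun τ t' hs => hQ τ t' hs.1.1 hs.2 hs.1.2
  have hCn := (le_searchCost n (st n) k).trans hC
  have hfn : ∀ v, f v ≤ n := fun v => by
    have := Finset.card_le_univ ({b ∈ T | b ∈ ballIn G {x | x ∉ S} k v} : Finset V)
    rwa [Fintype.card_congr e, Fintype.card_fin] at this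
  simp only [argmin, wp_seq, wp_add, hbase.reg_zero, hbase.one]
  have hF0 : Frame [27] [] σ (σ.setReg 27 (n + 1)) := frame_setReg 27 _
  have hb := hbase.frame hF0 (by decide) (by decide)
  refine wp_forEach ⟨by decide, by decide, by decide, by decide, by decide⟩ (by decide) hb
    (B := T) hT
    (fun D ρ => (∀ w ∈ D, ρ.reg 27 ≤ f w) ∧ (D = ∅ ∧ ρ.reg 27 = n + 1 ∨
      ∃ v ∈ D, ρ.reg 28 = (e v : ℕ) ∧ ρ.reg 27 = f v)) (2 + C + (3 + 8 * n) + 3) ?_ ?_ ?_ ?_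
  · intro D ρ y w hy hI
    simp only [setReg_reg]
    rw [if_neg (by omega), if_neg (by omega)]
    exact hI
  · simp
  · intro D v ρ t' hD hvT hvD hI hi hF' _
    have hb' := hb.frame hF' (by decide) (by decide)
    rw [wp_seq]
    refine wp_searchFrom hadj hb' (by decide) hi
      (by rw [hF'.reg 5 (by decide), hF0.reg 5 (by decide), hk])
      (S := (· ∈ S)) (by rw [hF'.arr 5 (by decide)]; exact hS) (hTS v hvT) hC ?_
    intro ρ₁ t₂ hM hF₁ ht₂
    have hb₁ := hb'.frame hF₁ (by decide) (by decide)
    rw [wp_seq]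
    refine wp_countMarked (a := 9) (c := 29) (A := (· ∈ T)) (by decide) hb₁
      (by rw [hF₁.arr 9 (by decide), hF'.arr 9 (by decide)]; exact hT) hM ?_
    intro ρ₂ t₃ hcnt hF₂ ht₃
    have hb₂ := hb₁.frame hF₂ (by decide) (by decide)
    have hcnt' : ρ₂.reg 29 = f v := by
      rw [hcnt, hf]
      congr 1
      ext; simp
    have g27 : ρ₂.reg 27 = ρ.reg 27 := by rw [hF₂.reg 27 (by decide), hF₁.reg 27 (by decide)]
    have g28 : ρ₂.reg 28 = ρ.reg 28 := by rw [hF₂.reg 28 (by decide), hF₁.reg 28 (by decide)]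
    have g20 : ρ₂.reg 20 = e v := by rw [hF₂.reg 20 (by decide), hF₁.reg 20 (by decide), hi]
    have g9 : ρ₂.arr 9 = ρ.arr 9 := by rw [hF₂.arr 9 (by decide), hF₁.arr 9 (by decide)]
    simp only [wp_ite, wp_seq, wp_add, wp_const, setReg_reg, setReg_arr, hcnt', g27, g28, g20, g9,
      hb₂.zero, Nat.reduceEqDiff, if_true, if_false, add_zero]
    split_ifs with hc
    · refine ⟨⟨fun w hw => ?_, Or.inr ⟨v, Finset.mem_insert_self _ _, rfl, rfl⟩⟩,
        fun _ _ => trivial, by omega⟩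
      rcases Finset.mem_insert.1 hw with rfl | hw
      · exact le_rfl
      · exact hc.le.trans (hI.1 w hw)
    · refine ⟨⟨fun w hw => ?_, Or.inr ?_⟩, fun _ _ => trivial, by omega⟩
      · rcases Finset.mem_insert.1 hw with rfl | hw
        · exact not_lt.1 hc
        · exact hI.1 w hw
      -- The initial value `n + 1` exceeds every count, so the first candidate is always accepted.
      · rcases hI.2 with ⟨-, h27⟩ | ⟨w, hw, h1, h2⟩
        · have := hfn v
          omega
        · exact ⟨w, Finset.mem_insert_of_mem hw, h1, h2⟩
  · rintro ρ t' ⟨hI1, hI2⟩ _ ht'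
    refine ⟨?_, ?_⟩
    · rcases hI2 with hI2 | ⟨v, hv, h1, h2⟩
      · exact Or.inl hI2
      · refine Or.inr ⟨h2 ▸ hfn v, v, hv, h1, fun w hw => ?_⟩
        rw [← h2]
        exact hI1 w hw
    · have : #T * (2 + C + (3 + 8 * n) + 3) ≤ #T * (2 * C) := Nat.mul_le_mul_left _ (by omega)
      omega

/-- The state of the greedy selection: `I` has been selected, `T` may still be used. -/
structure Selection (G : SimpleGraph V) (X : Set V) (k Δ : ℕ) (B T I : Finset V) : Prop where
  sub : T ⊆ B
  sub' : I ⊆ B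
  sep : ∀ x ∈ I, ∀ y ∈ T, y ∉ ballIn G X k x
  indep : IndepIn G X k I
  card : #B ≤ #I * Δ + #T

/-- Choosing `v` removes at most `Δ` elements of `T`, including `v` itself, so the inequality `#B ≤
#I * Δ + #T` survives and `T` shrinks strictly. -/
lemma Selection.pick {X : Set V} {Δ : ℕ} (hs : Selection G X k Δ B T I) (hBX : ∀ b ∈ B, b ∈ X)
    {v : V} (hv : v ∈ T) (hΔ : #{b ∈ T | b ∈ ballIn G X k v} ≤ Δ) :
    v ∉ I ∧ Selection G X k Δ B {b ∈ T | b ∉ ballIn G X k v} (insert v I) ∧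
      #{b ∈ T | b ∉ ballIn G X k v} < #T := by
  have hvX : v ∈ X := hBX v (hs.sub hv)
  have hvI : v ∉ I := fun h => hs.sep v h v hv (mem_ballIn_self hvX)
  have hcard : #{b ∈ T | b ∈ ballIn G X k v} + #{b ∈ T | b ∉ ballIn G X k v} = #T := by
    rw [Finset.card_filter_add_card_filter_not]
  have hpos : 0 < #{b ∈ T | b ∈ ballIn G X k v} :=
    Finset.card_pos.2 ⟨v, Finset.mem_filter.2 ⟨hv, mem_ballIn_self hvX⟩⟩
  refine ⟨hvI, ⟨(Finset.filter_subset _ _).trans hs.sub,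
    Finset.insert_subset (hs.sub hv) hs.sub', ?_, ?_, ?_⟩, by omega⟩
  · intro x hx y hy
    rw [Finset.mem_filter] at hy
    rcases Finset.mem_insert.1 hx with rfl | hx
    · exact hy.2
    · exact hs.sep x hx y hy.1
  · intro x hx y hy hxy
    rcases Finset.mem_insert.1 hx with rfl | hx' <;> rcases Finset.mem_insert.1 hy with rfl | hy'
    · rfl
    · exact absurd (mem_ballIn_symm hxy) (hs.sep y hy' x hv)
    · exact absurd hxy (hs.sep x hx' y hv)
    · exact hs.indep x hx' y hy' hxy
  · rw [Finset.card_insert_of_notMem hvI, add_mul]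
    have := hs.card
    omega

lemma wp_pick [Fintype V] (hadj : AdjLists e G st nb) (hbase : Base n m st nb σ)
    (hS : Rep e (σ.arr 5) (· ∈ S)) (hBS : ∀ b ∈ B, b ∉ S)
    (hT : Rep e (σ.arr 9) (· ∈ T)) (hI : Rep e (σ.arr 10) (· ∈ I)) (hcard : σ.reg 26 = #I)
    {Δ : ℕ} (hsel : Selection G {x | x ∉ S} k Δ B T I)
    (hΔ : ∀ T ⊆ B, T.Nonempty → ∃ b ∈ T, #{b' ∈ T | b' ∈ ballIn G {x | x ∉ S} k b} ≤ Δ)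
    (hk : σ.reg 5 = k) (hC : searchCost n (st n) k ≤ C)
    (hQ : ∀ τ t' T' I', Rep e (τ.arr 9) (· ∈ T') → Rep e (τ.arr 10) (· ∈ I') →
      τ.reg 26 = #I' → Selection G {x | x ∉ S} k Δ B T' I' → #T' ≤ #T - 1 →
      t' ≤ t + (3 * C + #T * (2 * C)) → Q τ t') :
    wp pick σ t Q := by
  have hCn := (le_searchCost n (st n) k).trans hC
  have hTS : ∀ b ∈ T, b ∉ S := fun b hb => hBS b (hsel.sub hb)
  rw [pick, wp_seq]
  refine wp_argmin hadj hbase hS hT hTS hk hC ?_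
  intro τ t₁ hmin hF ht₁
  have hb := hbase.frame hF (by decide) (by decide)
  have g26 : τ.reg 26 = #I := by rw [hF.reg 26 (by decide), hcard]
  have g9 : τ.arr 9 = σ.arr 9 := hF.arr 9 (by decide)
  have g10 : τ.arr 10 = σ.arr 10 := hF.arr 10 (by decide)
  simp only [wp_ite, wp_seq, wp_const, wp_store, wp_add, hb.reg_zero, hb.one, setArr_reg, g26]
  rcases hmin with ⟨hTe, h27⟩ | ⟨h27, v, hv, h28, hmin⟩
  -- The value `n + 1` left by `argmin` signals that `T` is empty; the round then changes nothing.
  · rw [if_pos (by omega)]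
    refine hQ _ _ T I ?_ ?_ ?_ hsel (by simp [hTe]) (by omega)
    · simpa [g9] using hT
    · simpa [g10] using hI
    · simpa using g26
  · rw [if_neg (by omega)]
    obtain ⟨b, hb', hbΔ⟩ := hΔ T hsel.sub ⟨v, hv⟩
    obtain ⟨hvI, hsel', hlt⟩ := hsel.pick hBS hv ((hmin b hb').trans hbΔ)
    set τ' := (τ.setArr 10 (τ.reg 28) 1).setReg 26 (#I + 1) with hτ'
    have hF' : Frame [26] [10] τ τ' :=
      (frame_setArr 10 _ _).trans (frame_setReg 26 _) (by simp) (by simp) (by simp) (by simp)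
    have hb₁ := hb.frame hF' (by decide) (by decide)
    refine wp_searchFrom hadj hb₁ (by decide) (v := v) (k := k)
      (by rw [hF'.reg 28 (by decide), h28])
      (by rw [hF'.reg 5 (by decide), hF.reg 5 (by decide), hk]) (S := (· ∈ S))
      (by rw [hF'.arr 5 (by decide), hF.arr 5 (by decide)]; exact hS) (hTS v hv) hC ?_
    intro ρ t₂ hM hF₂ ht₂
    have hb₂ := hb₁.frame hF₂ (by decide) (by decide)
    refine wp_removeMarked (a := 9) (A := (· ∈ T)) (by decide) hb₂
      (by rw [hF₂.arr 9 (by decide), hF'.arr 9 (by decide), g9]; exact hT) hM ?_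
    intro ρ' t₃ hR hF₃ ht₃
    refine hQ ρ' t₃ _ _ (fun w => ?_) (fun w => ?_) ?_ hsel' (by omega) (by omega)
    · beta_reduce
      rw [Finset.mem_filter]
      exact hR w
    · rw [hF₃.arr 10 (by decide), hF₂.arr 10 (by decide), hτ']
      simp only [setReg_arr, setArr_arr, if_true, h28, g10]
      by_cases hw : w = v
      · subst hw; simp
      · rw [Function.update_of_ne (vertex_ne hw)]
        refine (hI w).trans ?_
        simp [hw]
    · rw [hF₃.reg 26 (by decide), hF₂.reg 26 (by decide), Finset.card_insert_of_notMem hvI, hτ']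
      simp

lemma wp_greedy [Fintype V] (hadj : AdjLists e G st nb) (hbase : Base n m st nb σ)
    (hS : Rep e (σ.arr 5) (· ∈ S)) (hB : Rep e (σ.arr 6) (· ∈ B)) (hBS : ∀ b ∈ B, b ∉ S)
    {Δ : ℕ} (hΔ : ∀ T ⊆ B, T.Nonempty → ∃ b ∈ T,
      #{b' ∈ T | b' ∈ ballIn G {x | x ∉ S} k b} ≤ Δ)
    (hk : σ.reg 5 = k) (hC : searchCost n (st n) k ≤ C) (hBm : #B ≤ m)
    (hQ : ∀ τ t' I, Rep e (τ.arr 10) (· ∈ I) → τ.reg 26 = #I → I ⊆ B →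
      IndepIn G {x | x ∉ S} k I → #B ≤ #I * Δ →
      Frame (wregs greedy) (warrs greedy) σ τ →
      t' ≤ t + (C + m * (4 * C + m * (2 * C))) → Q τ t') :
    wp greedy σ t Q := by
  suffices hs : wp greedy σ t fun τ t' => ∃ I, Rep e (τ.arr 10) (· ∈ I) ∧ τ.reg 26 = #I ∧ I ⊆ B ∧
      IndepIn G {x | x ∉ S} k I ∧ #B ≤ #I * Δ ∧ t' ≤ t + (C + m * (4 * C + m * (2 * C))) from
    hs.frame.mono fun τ t' ⟨⟨I, h1, h2, h3, h4, h5, h6⟩, hF⟩ => hQ τ t' I h1 h2 h3 h4 h5 hF h6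
  have hCn := (le_searchCost n (st n) k).trans hC
  rw [greedy, wp_seq]
  refine wp_copy (e := e) (by decide) hbase ?_
  intro τ₁ t₁ h9 hF₁ ht₁
  have hb₁ := hbase.frame hF₁ (by decide) (by decide)
  rw [wp_seq]
  refine wp_clear (e := e) hb₁ ?_
  intro τ₂ t₂ h10 hF₂ ht₂
  have hb₂ := hb₁.frame hF₂ (by decide) (by decide)
  rw [wp_seq, wp_const]
  have hb₃ := hb₂.frame (frame_setReg 26 0) (by decide) (by decide)
  -- The available set has at most `m` elements and loses at least one in each round until it is
  -- empty, so `m` rounds suffice.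
  refine wp_forTo_const ⟨by decide, by decide, by decide, by decide, by decide⟩ m
    (fun j τ => ∃ T I, Rep e (τ.arr 9) (· ∈ T) ∧ Rep e (τ.arr 10) (· ∈ I) ∧ τ.reg 26 = #I ∧
      Selection G {x | x ∉ S} k Δ B T I ∧ #T + j ≤ m ∨ T = ∅ ∧ Rep e (τ.arr 9) (· ∈ T) ∧
        Rep e (τ.arr 10) (· ∈ I) ∧ τ.reg 26 = #I ∧ Selection G {x | x ∉ S} k Δ B T I)
    (3 * C + m * (2 * C)) hb₃.reg_two hb₃.one ?_ ?_ ?_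
  · refine ⟨B, ∅, Or.inl ⟨fun v => ?_, fun v => ?_, by simp, ⟨subset_rfl, by simp, by simp,
      by simp [IndepIn], by simp⟩, by simpa using hBm⟩⟩
    · simp only [setReg_arr]
      rw [hF₂.arr 9 (by decide), h9 v]
      exact hB v
    · simp [h10 v]
  · rintro j τ t' hj ⟨T, I, hI⟩ hi hF
    have hI' : Rep e (τ.arr 9) (· ∈ T) ∧ Rep e (τ.arr 10) (· ∈ I) ∧ τ.reg 26 = #I ∧
      Selection G {x | x ∉ S} k Δ B T I ∧ (#T + j ≤ m ∨ T = ∅) := by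
      rcases hI with ⟨h1, h2, h3, h4, h5⟩ | ⟨h5, h1, h2, h3, h4⟩
      · exact ⟨h1, h2, h3, h4, Or.inl h5⟩
      · exact ⟨h1, h2, h3, h4, Or.inr h5⟩
    obtain ⟨h1, h2, h3, h4, h5⟩ := hI'
    have hb := hb₃.frame hF (by decide) (by decide)
    refine wp_pick hadj hb (S := S) (B := B) ?_ hBS h1 h2 h3 h4 hΔ ?_ hC ?_
    · rw [hF.arr 5 (by decide)]
      simp only [setReg_arr]
      rw [hF₂.arr 5 (by decide), hF₁.arr 5 (by decide)]
      exact hS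
    · rw [hF.reg 5 (by decide), setReg_reg, if_neg (by decide), hF₂.reg 5 (by decide),
        hF₁.reg 5 (by decide), hk]
    · intro τ' t'' T' I' h1' h2' h3' h4' h5' ht
      refine ⟨⟨T', I', ?_⟩, ?_⟩
      · by_cases hT' : T' = ∅
        · exact Or.inr ⟨hT', h1', h2', by simpa using h3', h4'⟩
        · refine Or.inl ⟨h1', h2', by simpa using h3', h4', ?_⟩
          have := Finset.card_pos.2 (Finset.nonempty_iff_ne_empty.2 hT')
          rcases h5 with h5 | rfl
          · omega
          · simp at h5'; exact absurd h5' hT'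
      · have : #T * (2 * C) ≤ m * (2 * C) :=
          Nat.mul_le_mul_right _ ((Finset.card_le_card h4.sub).trans hBm)
        omega
  · rintro τ t' ⟨T, I, hI⟩ hF ht
    have hI' : Rep e (τ.arr 10) (· ∈ I) ∧ τ.reg 26 = #I ∧
      Selection G {x | x ∉ S} k Δ B T I ∧ #T = 0 := by
      rcases hI with ⟨h1, h2, h3, h4, h5⟩ | ⟨h5, h1, h2, h3, h4⟩
      · exact ⟨h2, h3, h4, by omega⟩
      · exact ⟨h2, h3, h4, by simp [h5]⟩
    obtain ⟨h1, h2, h3, h4⟩ := hI'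
    refine ⟨I, h1, h2, h3.sub', h3.indep, by have := h3.card; omega, ?_⟩
    have : m * (3 * C + m * (2 * C) + 2) ≤ m * (4 * C + m * (2 * C)) :=
      Nat.mul_le_mul_left _ (by omega)
    omega

/-- The program compares the hub degree `D` with the size of the greedy set and keeps the larger
alternative. It needs no knowledge of `Δ`, which enters only the analysis. -/
lemma wp_step [Fintype V] (hadj : AdjLists e G st nb) (hbase : Base n m st nb σ)
    (hS : Rep e (σ.arr 5) (· ∈ S)) (hB : Rep e (σ.arr 6) (· ∈ B)) (hBS : ∀ b ∈ B, b ∉ S)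
    {Δ : ℕ → ℕ} (hΔ : ∀ D, (∀ v, #(near G {x | x ∉ S} h B v) ≤ D) → ∀ T ⊆ B, T.Nonempty →
      ∃ b ∈ T, #{b' ∈ T | b' ∈ ballIn G {x | x ∉ S} k b} ≤ Δ D)
    (hk : σ.reg 5 = k) (hh : σ.reg 6 = h) (hhk : h ≤ k) (hC : searchCost n (st n) k ≤ C)
    (hBm : #B ≤ m) (hm : 1 ≤ m)
    (hQ : ∀ τ t' D I, I ⊆ B → IndepIn G {x | x ∉ S} k I → #B ≤ #I * Δ D →
      ((∃ v, #I < D ∧ #(near G {x | x ∉ S} h B v) = D ∧ Rep e (τ.arr 5) (· ∈ insert v S) ∧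
          Rep e (τ.arr 6) (· ∈ near G {x | x ∉ S} h B v) ∧ τ.reg 7 = σ.reg 7) ∨
        D ≤ #I ∧ Rep e (τ.arr 5) (· ∈ S) ∧ Rep e (τ.arr 6) (· ∈ I) ∧ τ.reg 7 = 0) →
      Frame (wregs step) (warrs step) σ τ →
      t' ≤ t + 16 * m ^ 2 * C → Q τ t') :
    wp step σ t Q := by
  suffices hs : wp step σ t fun τ t' => ∃ D I, I ⊆ B ∧ IndepIn G {x | x ∉ S} k I ∧
      #B ≤ #I * Δ D ∧
      ((∃ v, #I < D ∧ #(near G {x | x ∉ S} h B v) = D ∧ Rep e (τ.arr 5) (· ∈ insert v S) ∧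
          Rep e (τ.arr 6) (· ∈ near G {x | x ∉ S} h B v) ∧ τ.reg 7 = σ.reg 7) ∨
        D ≤ #I ∧ Rep e (τ.arr 5) (· ∈ S) ∧ Rep e (τ.arr 6) (· ∈ I) ∧ τ.reg 7 = 0) ∧
      t' ≤ t + 16 * m ^ 2 * C from
    hs.frame.mono fun τ t' ⟨⟨D, I, h1, h2, h3, h4, h5⟩, hF⟩ => hQ τ t' D I h1 h2 h3 h4 hF h5
  have hCn := (le_searchCost n (st n) k).trans hC
  have hC' : searchCost n (st n) h ≤ C := le_trans (by unfold searchCost; gcongr) hC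
  have htime : C + #B * (2 * C) + (4 + 6 * n) + (C + m * (4 * C + m * (2 * C))) +
      (1 + (2 + C) + 1 + (2 + 5 * n)) ≤ 16 * m ^ 2 * C := by
    have e1 : #B * (2 * C) ≤ m * (2 * C) := Nat.mul_le_mul_right _ hBm
    have e2 : C + m * (2 * C) + C + (C + m * (4 * C + m * (2 * C))) + (2 * C) ≤
        16 * m ^ 2 * C := by nlinarith [Nat.zero_le (C * m), Nat.zero_le (C * (m - 1) ^ 2),
          Nat.mul_le_mul_left C hm, Nat.mul_le_mul_left (C * m) hm]
    omega
  rw [step, wp_seq]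
  refine wp_nearCounts hadj hbase hS hB hBS hh hC' ?_
  intro τ₁ t₁ hcnt hF₁ ht₁
  have hb₁ := hbase.frame hF₁ (by decide) (by decide)
  rw [wp_seq]
  refine wp_argmax (e := e) hb₁ ?_
  intro τ₂ t₂ hmax1 hmax2 hF₂ ht₂
  have hb₂ := hb₁.frame hF₂ (by decide) (by decide)
  have hcnt' : ∀ v, τ₂.arr 8 (e v) = #(near G {x | x ∉ S} h B v) := fun v => by
    rw [hF₂.arr 8 (by decide)]; exact hcnt v
  set D := τ₂.reg 24 with hD
  have hnear : ∀ v, #(near G {x | x ∉ S} h B v) ≤ D := fun v => hcnt' v ▸ hmax1 v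
  have hS₂ : τ₂.arr 5 = σ.arr 5 := by rw [hF₂.arr 5 (by decide), hF₁.arr 5 (by decide)]
  have hB₂ : τ₂.arr 6 = σ.arr 6 := by rw [hF₂.arr 6 (by decide), hF₁.arr 6 (by decide)]
  rw [wp_seq]
  refine wp_greedy hadj hb₂ (S := S) (B := B) (by rw [hS₂]; exact hS) (by rw [hB₂]; exact hB) hBS
    (hΔ D hnear) (by rw [hF₂.reg 5 (by decide), hF₁.reg 5 (by decide), hk]) hC hBm ?_
  intro τ₃ t₃ I hI h26 hIB hind hcard hF₃ ht₃
  have hb₃ := hb₂.frame hF₃ (by decide) (by decide)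
  have g24 : τ₃.reg 24 = D := hF₃.reg 24 (by decide)
  have g7 : τ₃.reg 7 = σ.reg 7 := by
    rw [hF₃.reg 7 (by decide), hF₂.reg 7 (by decide), hF₁.reg 7 (by decide)]
  have hS₃ : Rep e (τ₃.arr 5) (· ∈ S) := by rw [hF₃.arr 5 (by decide), hS₂]; exact hS
  have hB₃ : Rep e (τ₃.arr 6) (· ∈ B) := by rw [hF₃.arr 6 (by decide), hB₂]; exact hB
  rw [wp_ite, h26, g24]
  split_ifs with hc
  · obtain ⟨v, h25, hv⟩ := hmax2 (by omega)
    rw [hcnt' v] at hv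
    have hvS : v ∉ S := by
      obtain ⟨b, hb⟩ := Finset.card_pos.1 (by omega : 0 < #(near G {x | x ∉ S} h B v))
      exact ballIn_subset (mem_near.1 hb).2
    rw [wp_seq]
    refine wp_searchFrom hadj hb₃ (by decide) (v := v) (k := h)
      (by rw [hF₃.reg 25 (by decide), h25])
      (by rw [hF₃.reg 6 (by decide), hF₂.reg 6 (by decide), hF₁.reg 6 (by decide), hh])
      (S := (· ∈ S)) hS₃ hvS hC' ?_
    intro τ₄ t₄ hM hF₄ ht₄
    have hb₄ := hb₃.frame hF₄ (by decide) (by decide)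
    have g25 : τ₄.reg 25 = e v := by rw [hF₄.reg 25 (by decide), hF₃.reg 25 (by decide), h25]
    rw [wp_seq, wp_store, g25, hb₄.one]
    have hF₅ := frame_setArr (σ := τ₄) 5 (e v : ℕ) 1
    refine wp_keepMarked (a := 6) (A := (· ∈ B)) (by decide)
      (hb₄.frame hF₅ (by decide) (by decide))
      (by rw [hF₅.arr 6 (by decide), hF₄.arr 6 (by decide)]; exact hB₃)
      (by rw [hF₅.arr 7 (by decide)]; exact hM) ?_
    intro τ₆ t₆ hR hF₆ ht₆
    refine ⟨D, I, hIB, hind, hcard, Or.inl ⟨v, hc, hv, fun w => ?_, fun w => ?_, ?_⟩, by omega⟩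
    · rw [hF₆.arr 5 (by decide), setArr_arr, if_pos rfl]
      by_cases hw : w = v
      · subst hw; simp
      · rw [Function.update_of_ne (vertex_ne hw), hF₄.arr 5 (by decide)]
        refine (hS₃ w).trans ?_
        simp [hw]
    · beta_reduce
      rw [mem_near, mem_ballIn_comm]
      exact hR w
    · rw [hF₆.reg 7 (by decide), setArr_reg, hF₄.reg 7 (by decide), g7]
  · rw [wp_seq]
    refine wp_copy (e := e) (by decide) hb₃ ?_
    intro τ₄ t₄ hR hF₄ ht₄
    rw [wp_const]
    refine ⟨D, I, hIB, hind, hcard, Or.inr ⟨not_lt.1 hc, ?_, fun w => ?_, by simp⟩, by omega⟩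
    · simp only [setReg_arr]
      rw [hF₄.arr 5 (by decide)]
      exact hS₃
    · simp only [setReg_arr]
      rw [hR w]
      exact hI w

end Step

/-! ### Reading the input and writing the output -/

section InputOutput

variable {V : Type*} {n m : ℕ} {e : V ≃ Fin n} {G : SimpleGraph V} {st nb : ℕ → ℕ}
  {σ τ : State} {t : ℕ} {Q : State → ℕ → Prop} {A B : Finset V}

/-- Write a list of the elements of the set with indicator array `a` to the array `b`, and their
number to register `c`. -/
def listTo (a b c : ℕ) : Prog :=
  .seq (.const c 0) (forTo 22 0 (.seq (.load 23 a 22) (.ite 4 23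
    (.seq (.store b c 22) (.add c c 3)) (.const 17 0))))

lemma lists_insert {f : ℕ → ℕ} (h : Lists e f #B (B : Set V)) {v : V} (hv : v ∉ B) :
    Lists e (Function.update f #B (e v)) #(insert v B) ((insert v B : Finset V) : Set V) := by
  have h1 : Set.BijOn (Function.update f #B (e v)) (Set.Iio #B) ((fun v => (e v : ℕ)) '' B) :=
    Set.BijOn.congr h fun i hi => (Function.update_of_ne (ne_of_lt hi) _ _).symm
  have h2 : Function.update f #B (e v) #B ∉ (fun v => (e v : ℕ)) '' (B : Set V) := by
    rw [Function.update_self]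
    rintro ⟨w, hw, hwv⟩
    exact hv (e.injective (Fin.ext hwv) ▸ hw)
  have h3 := h1.insert h2
  rw [Function.update_self] at h3
  rw [RAM.Lists, Finset.card_insert_of_notMem hv, Finset.coe_insert, Set.image_insert_eq]
  convert h3 using 1
  ext i
  simp

lemma wp_listTo [Fintype V] {a b c : ℕ} (hab : a ≠ b) (hc : c ∉ [0, 2, 3, 4, 17, 22, 23])
    (hbase : Base n m st nb σ) (hB : Rep e (σ.arr a) (· ∈ B))
    (hQ : ∀ τ t', τ.reg c = #B → Lists e (τ.arr b) #B (B : Set V) →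
      Frame [c, 17, 22, 23] [b] σ τ → t' ≤ t + (3 + 6 * n) → Q τ t') :
    wp (listTo a b c) σ t Q := by
  simp only [List.mem_cons, List.not_mem_nil, or_false, not_or] at hc
  obtain ⟨c0, c2, c3, c4, c17, c22, c23⟩ := hc
  have hb : Base n m st nb (σ.setReg c 0) := hbase.frame (frame_setReg c 0)
    (by intro x hx; simp at hx ⊢; omega) (by simp)
  rw [listTo, wp_seq, wp_const]
  refine wp_forTo_const ⟨by decide, by decide, by simp [wregs, Ne.symm c0],
    by simp [wregs, Ne.symm c3], by simp [wregs, Ne.symm c22]⟩ n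
    (fun j τ => τ.reg c = #(pre e (· ∈ B) j) ∧
      Lists e (τ.arr b) #(pre e (· ∈ B) j) (pre e (· ∈ B) j : Set V)) 4 hb.reg_zero hb.one
    ?_ ?_ ?_
  · rw [pre_zero]
    simp [c22, RAM.Lists, Set.bijOn_empty_iff_left]
  · rintro j τ t' hj ⟨hI1, hI2⟩ hi hF
    obtain ⟨v, rfl⟩ := exists_vertex e hj
    have f3 : τ.reg 3 = 1 := by rw [hF.reg 3 (by simp [wregs, Ne.symm c3]), hb.one]
    have f4 : τ.reg 4 = 0 := by rw [hF.reg 4 (by simp [wregs, Ne.symm c4]), hb.zero]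
    have fa : τ.arr a = σ.arr a := by rw [hF.arr a (by simp [warrs, hab])]; rfl
    simp only [wp_seq, wp_load, wp_ite, wp_const, wp_add, wp_store, if_true, hi, c22, c23, c17,
      setReg_reg, Nat.reduceEqDiff, if_false, f4, fa, f3, setReg_arr, setArr_reg, setArr_arr,
      hB v, hI1, pre_succ]
    split_ifs with h
    · exact ⟨⟨(Finset.card_insert_of_notMem (notMem_pre _ v)).symm,
        lists_insert hI2 (notMem_pre _ v)⟩, by omega⟩
    · exact ⟨⟨rfl, hI2⟩, by omega⟩
  · rintro τ t' ⟨hI1, hI2⟩ hF ht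
    have hpre : pre e (· ∈ B) n = B := by
      rw [pre_top]
      ext; simp
    rw [hpre] at hI1 hI2
    refine hQ τ t' hI1 hI2 ⟨fun x hx => ?_, fun x hx => ?_⟩ (by omega)
    · rw [hF.reg x (by simp [wregs] at hx ⊢; tauto), setReg_reg, if_neg (by simp at hx; tauto)]
    · exact hF.arr x (by simpa [warrs] using hx)

/-- Store the number `1` in register `3`, and the indicator function of the input set in
array `6`. -/
def readInput : Prog := .seq (.const 3 1) (forTo 20 2 (.seq (.load 21 2 20) (.store 6 21 3)))

lemma wp_readInput {r : ℕ} (hσ : IsInput e G A r σ)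
    (hQ : ∀ τ t', Base n #A (σ.arr 0) (σ.arr 1) τ → Rep e (τ.arr 6) (· ∈ A) →
      Frame [3, 20, 21] [6] σ τ → t' ≤ t + (3 + 4 * #A) → Q τ t') :
    wp readInput σ t Q := by
  have hb : Base n #A (σ.arr 0) (σ.arr 1) (σ.setReg 3 1) :=
    ⟨by simp [hσ.reg_zero], by simp [hσ.reg_two], by simp, by simp [hσ.reg_rest], rfl, rfl⟩
  rw [readInput, wp_seq, wp_const]
  refine wp_forTo_const ⟨by decide, by decide, by decide, by decide, by decide⟩ #A
    (fun j τ => ∀ i, 0 < τ.arr 6 i ↔ ∃ j' < j, σ.arr 2 j' = i) 2 hb.reg_two hb.one ?_ ?_ ?_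
  · simp [hσ.arr_rest]
  · intro j τ t' hj hI hi hF
    have f3 : τ.reg 3 = 1 := by rw [hF.reg 3 (by decide), hb.one]
    have f2 : τ.arr 2 = σ.arr 2 := by rw [hF.arr 2 (by decide)]; rfl
    simp only [wp_seq, wp_load, wp_store, setReg_reg, setReg_arr, setArr_arr, hi, f2, f3,
      Nat.reduceEqDiff, if_true, if_false]
    refine ⟨fun i => ?_, by omega⟩
    by_cases h : i = σ.arr 2 j
    · subst h
      rw [Function.update_self]
      exact ⟨fun _ => ⟨j, by omega, rfl⟩, fun _ => one_pos⟩
    · rw [Function.update_of_ne h, hI i]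
      constructor
      · rintro ⟨j', h1, h2⟩
        exact ⟨j', by omega, h2⟩
      · rintro ⟨j', h1, h2⟩
        refine ⟨j', ?_, h2⟩
        rcases Nat.lt_succ_iff_lt_or_eq.1 h1 with h1 | rfl
        · exact h1
        · exact absurd h2.symm h
  · intro τ t' hI hF ht
    refine hQ τ t' (hb.frame hF (by decide) (by decide)) (fun v => ?_) ⟨fun x hx => ?_,
      fun x hx => hF.arr x (by simpa [warrs] using hx)⟩ (by omega)
    · rw [hI]
      constructor
      · rintro ⟨j, hj, hjv⟩
        obtain ⟨w, hw, hwj⟩ := hσ.list_A.mapsTo (Set.mem_Iio.2 hj)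
        exact e.injective (Fin.ext (hwj.trans hjv)) ▸ hw
      · intro hv
        obtain ⟨j, hj, hjv⟩ := hσ.list_A.surjOn (Set.mem_image_of_mem _ hv)
        exact ⟨j, hj, hjv⟩
    · rw [hF.reg x (by simp [wregs] at hx ⊢; tauto), setReg_reg, if_neg (by simp at hx; tauto)]

/-- Write the sets with indicator arrays `5` and `6` to the output. -/
def writeOutput : Prog :=
  .seq (listTo 5 3 33) (.seq (listTo 6 4 34) (.seq (.add 0 33 4) (.add 1 34 4)))

lemma wp_writeOutput [Fintype V] {S : Finset V} (hbase : Base n m st nb σ)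
    (hS : Rep e (σ.arr 5) (· ∈ S)) (hB : Rep e (σ.arr 6) (· ∈ B))
    (hQ : ∀ τ t', IsOutput e S B τ → t' ≤ t + (8 + 12 * n) → Q τ t') :
    wp writeOutput σ t Q := by
  rw [writeOutput, wp_seq]
  refine wp_listTo (by decide) (by decide) hbase hS ?_
  intro τ₁ t₁ h1 h2 hF₁ ht₁
  have hb₁ := hbase.frame hF₁ (by decide) (by decide)
  rw [wp_seq]
  refine wp_listTo (by decide) (by decide) hb₁
    (by rw [hF₁.arr 6 (by decide)]; exact hB) ?_
  intro τ₂ t₂ h3 h4 hF₂ ht₂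
  have hb₂ := hb₁.frame hF₂ (by decide) (by decide)
  have g33 : τ₂.reg 33 = #S := by rw [hF₂.reg 33 (by decide), h1]
  simp only [wp_seq, wp_add, setReg_reg, Nat.reduceEqDiff, if_false, hb₂.zero, g33, h3, add_zero]
  refine hQ _ _ ⟨by simp, by simp, ?_, ?_⟩ (by omega)
  · simp only [setReg_arr]
    rw [hF₂.arr 3 (by decide)]
    exact h2
  · exact h4

end InputOutput

/-! ### The algorithm -/

section Main

variable {V : Type*} {n m : ℕ} {e : V ≃ Fin n} {G : SimpleGraph V} {st nb : ℕ → ℕ}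
  {σ τ : State} {t : ℕ} {Q : State → ℕ → Prop} {A S B : Finset V} {k r c C K J : ℕ}

/-- Raise by one the distance `reg 5` at which the set `6` is independent. -/
def level : Prog := .seq (.sub 6 5 6) (.seq (.add 5 5 3) (.seq (.const 7 1) (.loop 4 7 step)))

/-- Undo the deletion of a vertex if at least half of the set `6` is not near to it, and otherwise
restrict this set to the vertices near to it. -/
def pruneVertex : Prog :=
  .seq (.store 5 30 4) (.seq (searchFrom 30 6) (.seq (countMarked 6 29) (.seq (listTo 6 4 32)
    (.seq (.sub 32 32 29) (.ite 29 32 (removeMarked 6) (.seq (.store 5 30 3) (keepMarked 6)))))))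

/-- The whole algorithm. -/
def main : Prog :=
  .seq readInput (.seq (.loop 5 1 level) (.seq (forEach 30 31 5 pruneVertex) writeOutput))

/-- The memory holds a set `S` of at most `J` vertices and a set `B ⊆ A` that is still large after
`J` rounds. -/
structure Found (e : V ≃ Fin n) (A : Finset V) (K J : ℕ) (S B : Finset V) (σ : State) :
    Prop where
  rep : Rep e (σ.arr 5) (· ∈ S)
  rep' : Rep e (σ.arr 6) (· ∈ B)
  sub : B ⊆ A
  card_le : #S ≤ J
  large : #A ≤ (K * #B) ^ 4 ^ J

lemma Found.congr (h : Found e A K J S B σ) (h5 : τ.arr 5 = σ.arr 5) (h6 : τ.arr 6 = σ.arr 6) :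
    Found e A K J S B τ :=
  ⟨h5 ▸ h.rep, h6 ▸ h.rep', h.sub, h.card_le, h.large⟩

lemma large_mono {N J' : ℕ} (hA : 1 ≤ #A) (h : #A ≤ N ^ 4 ^ J) (hJ : J ≤ J') :
    #A ≤ N ^ 4 ^ J' := by
  refine h.trans (Nat.pow_le_pow_right ?_ (Nat.pow_le_pow_right (by omega) hJ))
  rcases Nat.eq_zero_or_pos N with rfl | h0
  · rw [zero_pow (by positivity)] at h
    omega
  · exact h0

/-- A round that loses at most a fourth power, measured after scaling by `K`, raises the exponent
from `4 ^ J` to `4 ^ (J + 1)`. -/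
lemma large_step {N N' : ℕ} (h : #A ≤ (K * N) ^ 4 ^ J) (hN : K * N ≤ (K * N') ^ 4) :
    #A ≤ (K * N') ^ 4 ^ (J + 1) := by
  refine h.trans ((Nat.pow_le_pow_left hN _).trans (le_of_eq ?_))
  rw [← pow_mul, pow_succ, mul_comm 4]

/-- Keeps the current set larger than `c` as long as the number of rounds stays within the budget
`q`; the clique arguments need at least `c` elements. -/
lemma lt_of_large {N q : ℕ} (hK : 1 ≤ K) (hc : 1 ≤ c) (hq : J ≤ q) (hA : (K * c) ^ 4 ^ q < #A)
    (h : #A ≤ (K * N) ^ 4 ^ J) : c < N := by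
  by_contra! hNc
  have h1 : (K * N) ^ 4 ^ J ≤ (K * c) ^ 4 ^ J := Nat.pow_le_pow_left (Nat.mul_le_mul_left _ hNc) _
  have h2 : (K * c) ^ 4 ^ J ≤ (K * c) ^ 4 ^ q :=
    Nat.pow_le_pow_right (Nat.mul_pos hK hc) (Nat.pow_le_pow_right (by omega) hq)
  omega

lemma mul_le_of_mul_sqrt {N M K : ℕ} (h : N ≤ M * (Nat.sqrt (K * M ^ 2 * N) + 1)) :
    (2 * K + 2) * N ≤ ((2 * K + 2) * M) ^ 4 := by
  have := card_le_of_mul_sqrt h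
  calc (2 * K + 2) * N ≤ (2 * K + 2) * ((2 * K + 2) * M ^ 4) := Nat.mul_le_mul_left _ this
    _ = (2 * K + 2) ^ 2 * M ^ 4 := by ring
    _ ≤ (2 * K + 2) ^ 4 * M ^ 4 :=
      Nat.mul_le_mul_right _ (Nat.pow_le_pow_right (by omega) (by omega))
    _ = _ := by ring

lemma exists_few_conflicts_of_subset [Fintype V] (hk : 1 ≤ k) (hkr : k ≤ r)
    (hB : IndepIn G {x | x ∉ S} (k - 1) B) (hBS : ∀ b ∈ B, b ∉ S)
    (hK : ∀ (T : Finset V) (H : SimpleGraph T), Minor H G r → arcs H ^ 2 ≤ K * #T ^ 3) {D : ℕ}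
    (hD : ∀ v, #(near G {x | x ∉ S} (k / 2) B v) ≤ D) (T : Finset V) (hTB : T ⊆ B)
    (hT : T.Nonempty) :
    ∃ b ∈ T, #{b' ∈ T | b' ∈ ballIn G {x | x ∉ S} k b} ≤ Nat.sqrt (K * D ^ 2 * #B) + 1 := by
  obtain ⟨b, hb, hle⟩ := exists_few_conflicts (X := {x | x ∉ S}) hk hkr
    (hB.mono subset_rfl le_rfl hTB) (fun b hb => hBS b (hTB hb))
    (fun v => (Finset.card_le_card (Finset.filter_subset_filter _ hTB)).trans (hD v)) hT (hK T)
  refine ⟨b, hb, hle.trans (Nat.succ_le_succ (Nat.sqrt_le_sqrt ?_))⟩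
  exact Nat.mul_le_mul_left _ (Finset.card_le_card hTB)

/-- Each iteration either deletes one more hub or reaches independence at distance `k + 1`. Since
there are fewer than `c` hubs, `c` iterations are enough. -/
lemma wp_level [Fintype V] (hadj : AdjLists e G st nb) (hbase : Base n #A st nb σ)
    (hkr : k < r) (hC : searchCost n (st n) r ≤ C) (hc : 1 ≤ c)
    (hG : ¬ Minor (⊤ : SimpleGraph (Fin c)) G r)
    (hK : ∀ (T : Finset V) (H : SimpleGraph T), Minor H G r → arcs H ^ 2 ≤ K * #T ^ 3)
    {q : ℕ} (hA : ((2 * K + 2) * c) ^ 4 ^ q < #A) (hJ : J + c ≤ q)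
    (h5 : σ.reg 5 = k) (h6 : σ.reg 6 = k / 2) (hf : Found e A (2 * K + 2) J S B σ)
    (hBS : ∀ b ∈ B, b ∉ S) (hind : IndepIn G {x | x ∉ S} k B)
    (hQ : ∀ τ t' S B, τ.reg 5 = k + 1 → τ.reg 6 = (k + 1) / 2 →
      Found e A (2 * K + 2) (J + c) S B τ → (∀ b ∈ B, b ∉ S) →
      IndepIn G {x | x ∉ S} (k + 1) B → Frame (wregs level) (warrs level) σ τ →
      t' ≤ t + (4 + c * (16 * #A ^ 2 * C + 1)) → Q τ t') :
    wp level σ t Q := by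
  suffices hs : wp level σ t fun τ t' => ∃ S B, τ.reg 5 = k + 1 ∧ τ.reg 6 = (k + 1) / 2 ∧
      Found e A (2 * K + 2) (J + c) S B τ ∧ (∀ b ∈ B, b ∉ S) ∧
      IndepIn G {x | x ∉ S} (k + 1) B ∧ t' ≤ t + (4 + c * (16 * #A ^ 2 * C + 1)) from
    hs.frame.mono fun τ t' ⟨⟨S, B, h1, h2, h3, h4, h5, h6⟩, hF⟩ =>
      hQ τ t' S B h1 h2 h3 h4 h5 hF h6
  have hA1 : 1 ≤ #A := by omega
  have hC' : searchCost n (st n) (k + 1) ≤ C := le_trans (by unfold searchCost; gcongr; omega) hC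
  simp only [level, wp_seq, wp_sub, wp_add, wp_const, setReg_reg, Nat.reduceEqDiff, if_false,
    h5, h6, hbase.one]
  set σ₁ := ((σ.setReg 6 (k - k / 2)).setReg 5 (k + 1)).setReg 7 1 with hσ₁
  have hF₁ : Frame [5, 6, 7] [] σ σ₁ :=
    ((frame_setReg 6 _).trans (frame_setReg 5 _) (rs'' := [5, 6, 7]) (as'' := []) (by simp)
      (by simp) (by simp) (by simp)).trans (frame_setReg 7 _) (by simp) (by simp) (by simp)
      (by simp)
  have hb₁ := hbase.frame hF₁ (by decide) (by decide)
  have g5 : σ₁.reg 5 = k + 1 := by simp [hσ₁]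
  -- Register `6` is halved without division: `k - k / 2 = (k + 1) / 2`.
  have g6 : σ₁.reg 6 = (k + 1) / 2 := by simp [hσ₁]; omega
  refine wp_loop c (fun j τ t' => Frame (wregs step) (warrs step) σ₁ τ ∧
    t' ≤ t + 3 + j * (16 * #A ^ 2 * C + 1) ∧ ∃ S B, Found e A (2 * K + 2) (J + j) S B τ ∧
      ((∃ T, τ.reg 7 = 1 ∧ Stage G (k + 1) S B T ∧ #T = j) ∨
        τ.reg 7 = 0 ∧ (∀ b ∈ B, b ∉ S) ∧ IndepIn G {x | x ∉ S} (k + 1) B)) ?_ ?_ ?_ ?_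
  · exact ⟨Frame.refl, by omega, S, B, hf.congr rfl rfl, Or.inl ⟨∅, by simp [hσ₁],
      ⟨hBS, hind, by simp, by simp, by simp⟩, rfl⟩⟩
  · rintro j τ t' hj ⟨hF, ht, S, B, hf, hcase⟩ hlt
    have hb := hb₁.frame hF (by decide) (by decide)
    obtain ⟨T, h7, hs, hT⟩ | ⟨h7, -⟩ := hcase
    swap
    · rw [h7] at hlt; omega
    have hi := hs.indep
    refine wp_step hadj hb hf.rep hf.rep' hs.disj (k := k + 1) (h := (k + 1) / 2)
      (Δ := fun D => Nat.sqrt (K * D ^ 2 * #B) + 1)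
      (fun D hD T hTB hT => exists_few_conflicts_of_subset (by omega) (by omega) hi hs.disj hK
        hD T hTB hT)
      (by rw [hF.reg 5 (by decide), g5]) (by rw [hF.reg 6 (by decide), g6]) (by omega) hC'
      (Finset.card_le_card hf.sub) hA1 ?_
    intro τ' t'' D I hIB hIind hcard hcase hF' ht'
    refine ⟨hF.trans hF' (List.Subset.refl _) (List.Subset.refl _) (List.Subset.refl _)
      (List.Subset.refl _), by rw [add_mul]; omega, ?_⟩
    -- Whichever alternative is chosen, the new size is `max(D, #I)`; bounding both by `M` treats
    -- the two cases together.
    have hM : ∀ M, D ≤ M → #I ≤ M → #A ≤ ((2 * K + 2) * M) ^ 4 ^ (J + j + 1) := by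
      intro M hDM hIM
      refine large_step hf.large (mul_le_of_mul_sqrt (hcard.trans (Nat.mul_le_mul hIM ?_)))
      exact Nat.succ_le_succ (Nat.sqrt_le_sqrt (by gcongr))
    rcases hcase with ⟨v, hID, hv, hr5, hr6, h7'⟩ | ⟨hDI, hr5, hr6, h7'⟩
    · have hD := hM D le_rfl hID.le
      have hcD := lt_of_large (by omega) hc (by omega) hA hD
      obtain ⟨hvS, hs'⟩ := hs.insert_hub (by omega) (v := v) (by omega)
      refine ⟨_, _, ⟨hr5, hr6, (Finset.filter_subset _ _).trans hf.sub, ?_, by rw [hv]; exact hD⟩,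
        Or.inl ⟨_, h7'.trans h7, hs', ?_⟩⟩
      · rw [Finset.card_insert_of_notMem hvS]
        have := hf.card_le
        omega
      · rw [Finset.card_insert_of_notMem fun h => hvS (hs.sub h), hT]
    · exact ⟨S, I, ⟨hr5, hr6, hIB.trans hf.sub, hf.card_le.trans (by omega), hM _ hDI le_rfl⟩,
        Or.inr ⟨h7', fun b hb => hs.disj b (hIB hb), hIind⟩⟩
  -- Still being in the deletion phase after `c` iterations would mean `c` hubs.
  · rintro τ t' ⟨hF, ht, S, B, hf, ⟨T, h7, hs, hT⟩ | ⟨h7, -⟩⟩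
    · have hcB := lt_of_large (by omega) hc (by omega) hA hf.large
      have := hs.card_lt (by omega) (by omega) hG hcB.le hc
      omega
    · omega
  · rintro j τ t' hj ⟨hF, ht, S, B, hf, ⟨T, h7, hs, hT⟩ | ⟨h7, hd, hi⟩⟩ hlt
    · rw [h7, hF.reg 4 (by decide), hb₁.zero] at hlt
      omega
    · refine ⟨S, B, by rw [hF.reg 5 (by decide), g5], by rw [hF.reg 6 (by decide), g6],
        ⟨hf.rep, hf.rep', hf.sub, hf.card_le.trans (by omega),
          large_mono hA1 hf.large (by omega)⟩, hd, hi, ?_⟩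
      have : j * (16 * #A ^ 2 * C + 1) ≤ c * (16 * #A ^ 2 * C + 1) := Nat.mul_le_mul_right _ hj
      omega

/-- The state of the pruning phase, in which the vertices of `R` have not been treated. -/
structure Pruned (e : V ≃ Fin n) (G : SimpleGraph V) (r : ℕ) (A : Finset V) (K J : ℕ)
    (R S B : Finset V) (σ : State) : Prop where
  rep : Rep e (σ.arr 5) (· ∈ S)
  rep' : Rep e (σ.arr 6) (· ∈ B)
  sub : B ⊆ A
  pruning : Pruning G r S B R
  sub' : R ⊆ S
  large : #A ≤ (K * #B) ^ 4 ^ J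

/-- A round of pruning only halves the set, but is charged like a hub round so that one exponent
governs both phases. -/
lemma le_pow_four_of_le_two_mul {N N' : ℕ} (hK : 2 ≤ K) (h : N ≤ 2 * N') :
    K * N ≤ (K * N') ^ 4 := by
  rcases Nat.eq_zero_or_pos N' with rfl | hN'
  · obtain rfl : N = 0 := by omega
    simp
  · calc K * N ≤ K * (2 * N') := Nat.mul_le_mul_left _ h
      _ ≤ (K * N') * (K * N') := by
        rw [show K * (2 * N') = (K * N') * 2 by ring]
        exact Nat.mul_le_mul_left _ (hK.trans (Nat.le_mul_of_pos_right _ hN'))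
      _ = (K * N') ^ 2 := (sq _).symm
      _ ≤ _ := Nat.pow_le_pow_right (by positivity) (by omega)

lemma wp_pruneVertex [Fintype V] (hadj : AdjLists e G st nb) (hbase : Base n m st nb σ)
    (hC : searchCost n (st n) r ≤ C) (hK : 2 ≤ K) (h6 : σ.reg 6 = r / 2) {v : V}
    (hv : σ.reg 30 = e v) {R : Finset V} (hp : Pruned e G r A K J R S B σ) (hvR : v ∈ R)
    (hQ : ∀ τ t' S B, Pruned e G r A K (J + 1) (R.erase v) S B τ →
      (∀ k : ℕ, k ≠ e v → τ.arr 5 k = σ.arr 5 k) → t' ≤ t + (3 * C) → Q τ t') :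
    wp pruneVertex σ t Q := by
  have hCn := (le_searchCost n (st n) r).trans hC
  have hC' : searchCost n (st n) (r / 2) ≤ C :=
    le_trans (by unfold searchCost; gcongr; omega) hC
  rw [pruneVertex, wp_seq, wp_store, hv, hbase.zero]
  set σ₁ := σ.setArr 5 (e v) 0 with hσ₁
  have hF₁ : Frame [] [5] σ σ₁ := frame_setArr 5 _ _
  have hb₁ := hbase.frame hF₁ (by decide) (by decide)
  have hS₁ : Rep e (σ₁.arr 5) (· ∈ S.erase v) := by
    intro w
    simp only [hσ₁, setArr_arr, if_true]
    by_cases hw : w = v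
    · subst hw; simp
    · rw [Function.update_of_ne (vertex_ne hw)]
      exact (hp.rep w).trans (by simp [hw])
  rw [wp_seq]
  refine wp_searchFrom hadj hb₁ (by decide) (v := v) (k := r / 2) (S := (· ∈ S.erase v))
    (by rw [hF₁.reg 30 (by decide), hv]) (by rw [hF₁.reg 6 (by decide), h6]) hS₁ (by simp) hC' ?_
  intro σ₂ t₂ hM hF₂ ht₂
  have hb₂ := hb₁.frame hF₂ (by decide) (by decide)
  have hB₂ : Rep e (σ₂.arr 6) (· ∈ B) := by
    rw [hF₂.arr 6 (by decide), hF₁.arr 6 (by decide)]; exact hp.rep'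
  rw [wp_seq]
  refine wp_countMarked (by decide) hb₂ hB₂ hM ?_
  intro σ₃ t₃ hnear hF₃ ht₃
  have hb₃ := hb₂.frame hF₃ (by decide) (by decide)
  have hB₃ : Rep e (σ₃.arr 6) (· ∈ B) := by rw [hF₃.arr 6 (by decide)]; exact hB₂
  rw [wp_seq]
  -- Only the count in register `32` is used; array `4` is scratch space here and is overwritten
  -- when the output is written.
  refine wp_listTo (by decide) (by decide) hb₃ hB₃ ?_
  intro σ₄ t₄ hall _ hF₄ ht₄
  have hb₄ := hb₃.frame hF₄ (by decide) (by decide)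
  have hB₄ : Rep e (σ₄.arr 6) (· ∈ B) := by rw [hF₄.arr 6 (by decide)]; exact hB₃
  have hM₄ : Rep e (σ₄.arr 7) (· ∈ ballIn G {x | x ∉ S.erase v} (r / 2) v) := by
    rw [hF₄.arr 7 (by decide), hF₃.arr 7 (by decide)]; exact hM
  have h5₄ : σ₄.arr 5 = σ₁.arr 5 := by
    rw [hF₄.arr 5 (by decide), hF₃.arr 5 (by decide), hF₂.arr 5 (by decide)]
  have h30 : σ₄.reg 30 = e v := by
    rw [hF₄.reg 30 (by decide), hF₃.reg 30 (by decide), hF₂.reg 30 (by decide),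
      hF₁.reg 30 (by decide), hv]
  have g29 : σ₄.reg 29 = #{b ∈ B | b ∈ ballIn G {x | x ∉ S.erase v} (r / 2) v} := by
    rw [hF₄.reg 29 (by decide), hnear]
    congr 1
    ext; simp
  have hsplit : #{b ∈ B | b ∈ ballIn G {x | x ∉ S.erase v} (r / 2) v} +
      #{b ∈ B | b ∉ ballIn G {x | x ∉ S.erase v} (r / 2) v} = #B := by
    rw [Finset.card_filter_add_card_filter_not]
  simp only [wp_seq, wp_sub, wp_ite, setReg_reg, Nat.reduceEqDiff, if_false, if_true, hall, g29]
  set σ₅ := σ₄.setReg 32 (#B - #{b ∈ B | b ∈ ballIn G {x | x ∉ S.erase v} (r / 2) v}) with hσ₅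
  have hb₅ := hb₄.frame (frame_setReg 32 _) (by decide) (by decide) (τ := σ₅)
  split_ifs with hc
  · refine wp_removeMarked (a := 6) (A := (· ∈ B)) (by decide) hb₅ hB₄ hM₄ ?_
    intro σ₆ t₆ hR hF₆ ht₆
    have h5₆ : σ₆.arr 5 = σ₁.arr 5 := by rw [hF₆.arr 5 (by decide)]; exact h5₄
    refine hQ σ₆ t₆ (S.erase v) _ ⟨by rw [h5₆]; exact hS₁, fun w => ?_,
      (Finset.filter_subset _ _).trans hp.sub, hp.pruning.drop,
      Finset.erase_subset_erase _ hp.sub', large_step hp.large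
        (le_pow_four_of_le_two_mul hK (by omega))⟩ (fun k hk => ?_) (by omega)
    · beta_reduce
      rw [Finset.mem_filter]
      exact hR w
    · rw [h5₆, hσ₁, setArr_arr, if_pos rfl, Function.update_of_ne hk]
  · rw [wp_store]
    have g30 : σ₅.reg 30 = e v := by rw [hσ₅]; simpa using h30
    rw [g30, hb₅.one]
    have hF' := frame_setArr (σ := σ₅) 5 (e v : ℕ) 1
    refine wp_keepMarked (a := 6) (A := (· ∈ B)) (by decide)
      (hb₅.frame hF' (by decide) (by decide)) (by rw [hF'.arr 6 (by decide)]; exact hB₄)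
      (by rw [hF'.arr 7 (by decide)]; exact hM₄) ?_
    intro σ₆ t₆ hR hF₆ ht₆
    have h5₆ : σ₆.arr 5 = Function.update (σ₁.arr 5) (e v) 1 := by
      rw [hF₆.arr 5 (by decide), setArr_arr, if_pos rfl]
      exact congrArg (fun f => Function.update f (e v : ℕ) 1) h5₄
    refine hQ σ₆ t₆ S _ ⟨fun w => ?_, fun w => ?_, (Finset.filter_subset _ _).trans hp.sub,
      hp.pruning.keep, (Finset.erase_subset _ _).trans hp.sub', large_step hp.large
        (le_pow_four_of_le_two_mul hK (by omega))⟩ (fun k hk => ?_) (by omega)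
    · rw [h5₆]
      by_cases hw : w = v
      · subst hw
        simp [hp.sub' hvR]
      · rw [Function.update_of_ne (vertex_ne hw)]
        exact (hS₁ w).trans (by simp [hw])
    · beta_reduce
      rw [Finset.mem_filter]
      exact hR w
    · rw [h5₆, hσ₁, setArr_arr, if_pos rfl, Function.update_of_ne hk, Function.update_of_ne hk]

/-- Of the `2 * r * c` rounds in the exponent, at most `r * c` are spent on the levels and at most
as many on pruning, one for each deleted vertex. -/
lemma wp_main [Fintype V] (hσ : IsInput e G A r σ) (hc : 1 ≤ c)
    (hG : ¬ Minor (⊤ : SimpleGraph (Fin c)) G r)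
    (hK : ∀ (T : Finset V) (H : SimpleGraph T), Minor H G r → arcs H ^ 2 ≤ K * #T ^ 3)
    (hA : ((2 * K + 2) * c) ^ 4 ^ (2 * r * c) < #A) :
    wp main σ 0 fun τ t => ∃ S B, IsOutput e S B τ ∧ #S < c ∧ B ⊆ A ∧
      #A ≤ ((2 * K + 2) * #B) ^ 4 ^ (2 * r * c) ∧ RIndependentAfterDeleting G S r B ∧
      t ≤ 24 * (r + 1) * c * #A ^ 2 * searchCost n (arcs G) r := by
  have hadj : AdjLists e G (σ.arr 0) (σ.arr 1) := ⟨hσ.start_zero, hσ.start_le, hσ.neighbors⟩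
  rw [← hadj.start_eq_arcs]
  set C := searchCost n (σ.arr 0 n) r with hC
  have hCn : 20 * (n + 1) ≤ C := le_searchCost n _ r
  have hA1 : 1 ≤ #A := by omega
  have hA2 : 1 ≤ #A ^ 2 := Nat.one_le_pow _ _ hA1
  rw [main, wp_seq]
  refine wp_readInput hσ ?_
  intro σ₁ t₁ hb₁ hr₁ hF₁ ht₁
  rw [wp_seq]
  refine wp_loop r (fun k τ t' => Base n #A (σ.arr 0) (σ.arr 1) τ ∧ τ.reg 1 = r ∧ τ.reg 5 = k ∧
    τ.reg 6 = k / 2 ∧ t' ≤ t₁ + k * (c * (16 * #A ^ 2 * C + 1) + 5) ∧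
    ∃ S B, Found e A (2 * K + 2) (k * c) S B τ ∧ (∀ b ∈ B, b ∉ S) ∧
      IndepIn G {x | x ∉ S} k B) ?_ ?_ ?_ ?_
  · refine ⟨hb₁, by rw [hF₁.reg 1 (by decide), hσ.reg_one],
      by rw [hF₁.reg 5 (by decide), hσ.reg_rest _ (by omega)],
      by rw [hF₁.reg 6 (by decide), hσ.reg_rest _ (by omega)], by omega, ∅, A,
      ⟨fun v => ?_, hr₁, subset_rfl, by simp, ?_⟩, by simp, ?_⟩
    · rw [hF₁.arr 5 (by decide), hσ.arr_rest _ _ (by omega)]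
      simp
    · simp only [zero_mul, pow_zero, pow_one]
      exact Nat.le_mul_of_pos_left _ (by omega)
    · intro x _ y _ hxy
      exact (mem_ballIn_zero.1 hxy).1.symm
  · rintro k τ t' hk ⟨hb, h1, h5, h6, ht, S, B, hf, hBS, hind⟩ -
    refine wp_level hadj hb hk hC.ge hc hG hK hA ?_ h5 h6 hf hBS hind ?_
    · calc k * c + c = (k + 1) * c := by ring
        _ ≤ (2 * r) * c := Nat.mul_le_mul_right _ (by omega)
    · intro τ' t'' S' B' h5' h6' hf' hBS' hind' hF' ht'
      refine ⟨hb.frame hF' (by decide) (by decide), by rw [hF'.reg 1 (by decide), h1], h5', h6',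
        by rw [add_mul]; omega, S', B', by rwa [add_mul, one_mul], hBS', hind'⟩
  · rintro τ t' ⟨hb, h1, h5, -⟩
    omega
  · rintro k τ t' hk ⟨hb, h1, h5, h6, ht, S₀, B₀, hf, hBS, hind⟩ hlt
    obtain rfl : k = r := by omega
    rw [wp_seq]
    refine wp_forEach (B := S₀) ⟨by decide, by decide, by decide, by decide, by decide⟩ (by decide)
      hb hf.rep (fun D ρ => ∃ S B, Pruned e G k A (2 * K + 2) (k * c + #D) (S₀ \ D) S B ρ) (3 * C)
      ?_ ?_ ?_ ?_
    · rintro D ρ y w - ⟨S, B, hp⟩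
      exact ⟨S, B, hp.rep, hp.rep', hp.sub, hp.pruning, hp.sub', hp.large⟩
    · refine ⟨S₀, B₀, hf.rep, hf.rep', hf.sub, ⟨hBS, hind, ?_⟩, by simp, by simpa using hf.large⟩
      intro v hv hv'
      simp [hv] at hv'
    · rintro D v ρ t₂ hD hv hvD ⟨S, B, hp⟩ hi hF _
      refine wp_pruneVertex hadj (hb.frame hF (by decide) (by decide)) hC.ge (by omega)
        (by rw [hF.reg 6 (by decide), h6]) hi hp (Finset.mem_sdiff.2 ⟨hv, hvD⟩) ?_
      intro ρ' t₃ S' B' hp' harr ht₃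
      refine ⟨⟨S', B', ?_⟩, harr, ht₃⟩
      rw [Finset.card_insert_of_notMem hvD, Finset.sdiff_insert, ← add_assoc]
      exact hp'
    · rintro ρ t₂ ⟨S, B, hp⟩ hF ht₂
      refine wp_writeOutput (hb.frame hF (by decide) (by decide)) hp.rep hp.rep' ?_
      intro ρ' t₃ hout ht₃
      have hpr : Pruning G k S B ∅ := by simpa using hp.pruning
      have hJ : k * c + #S₀ ≤ 2 * k * c := by
        have := hf.card_le
        rw [mul_assoc]
        omega
      have hcB := lt_of_large (by omega) hc hJ hA hp.large
      refine ⟨S, B, hout, hpr.card_lt hG hcB.le hc, hp.sub, large_mono hA1 hp.large hJ,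
        hpr.indep.rIndependentAfterDeleting hpr.disj, ?_⟩
      have e1 : #S₀ * (3 * C) ≤ k * c * (3 * C) := Nat.mul_le_mul_right _ hf.card_le
      have e2 : t₃ ≤ 3 + 4 * #A + k * (c * (16 * #A ^ 2 * C + 1) + 5) + k * c * (3 * C) + C := by
        omega
      refine e2.trans ?_
      have e3 : #A ≤ #A ^ 2 := Nat.le_self_pow (by omega) _
      have e4 : C ≤ c * #A ^ 2 * C := Nat.le_mul_of_pos_left _ (Nat.mul_pos hc hA2)
      have e5 : 3 + 4 * #A ≤ c * #A ^ 2 * C := by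
        calc 3 + 4 * #A ≤ #A ^ 2 * 20 := by omega
          _ ≤ #A ^ 2 * C := Nat.mul_le_mul_left _ (by omega)
          _ ≤ c * (#A ^ 2 * C) := Nat.le_mul_of_pos_left _ hc
          _ = _ := by ring
      have e6 : c * (16 * #A ^ 2 * C + 1) + 5 + c * (3 * C) ≤ 24 * (c * #A ^ 2 * C) := by
        have h1 : c * C ≤ c * #A ^ 2 * C := by
          rw [mul_right_comm]
          exact Nat.le_mul_of_pos_right _ hA2
        have h2 : c ≤ c * C := Nat.le_mul_of_pos_right _ (by omega)
        nlinarith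
      calc 3 + 4 * #A + k * (c * (16 * #A ^ 2 * C + 1) + 5) + k * c * (3 * C) + C
          = 3 + 4 * #A + C + k * (c * (16 * #A ^ 2 * C + 1) + 5 + c * (3 * C)) := by ring
        _ ≤ c * #A ^ 2 * C + c * #A ^ 2 * C + k * (24 * (c * #A ^ 2 * C)) := by gcongr
        _ ≤ _ := by nlinarith [Nat.zero_le (c * #A ^ 2 * C)]

end Main

/-! ### Existence of an input -/

section Input

lemma exists_enumeration (s : Finset ℕ) (a : ℕ) :
    ∃ g : ℕ → ℕ, Set.BijOn g (Set.Ico a (a + #s)) s ∧ ∀ i, a + #s ≤ i → g i = 0 := by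
  obtain ⟨g, hg⟩ := (Set.finite_Ico a (a + #s)).exists_bijOn_of_encard_eq (t := (s : Set ℕ)) (by
    rw [Set.encard_coe_eq_coe_finsetCard, ← Finset.coe_Ico, Set.encard_coe_eq_coe_finsetCard]
    simp)
  refine ⟨fun i => if i < a + #s then g i else 0, hg.congr fun i hi => (if_pos hi.2).symm,
    fun i hi => if_neg (by omega)⟩

lemma exists_concatenation (L : ℕ → Finset ℕ) (n : ℕ) :
    ∃ g : ℕ → ℕ, (∀ i < n, Set.BijOn g (Set.Ico (∑ j ∈ range i, #(L j))
      (∑ j ∈ range (i + 1), #(L j))) (L i)) ∧ ∀ i, ∑ j ∈ range n, #(L j) ≤ i → g i = 0 := by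
  induction n with
  | zero => exact ⟨fun _ => 0, by simp, by simp⟩
  | succ n ih =>
    obtain ⟨g, hg, -⟩ := ih
    obtain ⟨g', hg', hz⟩ := exists_enumeration (L n) (∑ j ∈ range n, #(L j))
    refine ⟨fun i => if i < ∑ j ∈ range n, #(L j) then g i else g' i, fun i hi => ?_, fun i hi =>
      ?_⟩
    · rcases Nat.lt_succ_iff_lt_or_eq.1 hi with hi | rfl
      · refine (hg i hi).congr fun p hp => (if_pos ?_).symm
        refine hp.2.trans_le ?_
        exact Finset.sum_le_sum_of_subset (Finset.range_mono hi)
      · rw [Finset.sum_range_succ]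
        exact hg'.congr fun p hp => (if_neg (not_lt.2 hp.1)).symm
    · rw [Finset.sum_range_succ] at hi
      beta_reduce
      rw [if_neg (by omega), hz i hi]

/-- Needed for the purely existential part of the theorem, which is read off a run of the program.
-/
lemma exists_isInput {V : Type*} [Fintype V] {n : ℕ} (e : V ≃ Fin n) (G : SimpleGraph V)
    (A : Finset V) (r : ℕ) : ∃ σ, IsInput e G A r σ := by
  let L : ℕ → Finset ℕ := fun i =>
    if h : i < n then ({w | G.Adj (e.symm ⟨i, h⟩) w} : Finset V).image (fun w => (e w : ℕ)) else ∅
  have hL : ∀ v, (L (e v) : Set ℕ) = (fun w => (e w : ℕ)) '' G.neighborSet v := by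
    intro v
    ext i
    simp [L]
  obtain ⟨nb, hnb, hnb0⟩ := exists_concatenation L n
  obtain ⟨g, hg, hg0⟩ := exists_enumeration (A.image fun v => (e v : ℕ)) 0
  rw [Finset.card_image_of_injective _ fun a b hab => e.injective (Fin.ext hab), zero_add]
    at hg hg0
  refine ⟨⟨fun x => if x = 0 then n else if x = 1 then r else if x = 2 then #A else 0,
    fun a i => if a = 0 then (if i ≤ n then ∑ j ∈ range i, #(L j) else 0) else
      if a = 1 then nb i else if a = 2 then g i else 0⟩, by simp, by simp, by simp, ?_, by simp, ?_,
      ?_, ?_, ?_, ?_, ?_, ?_⟩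
  · intro x hx
    simp only
    rw [if_neg (by omega), if_neg (by omega), if_neg (by omega)]
  · intro i hi
    simp only [if_true, if_pos hi.le, if_pos (Nat.succ_le_of_lt hi), Finset.sum_range_succ]
    omega
  · intro v
    have hv := (e v).2
    simp only [if_true, if_pos hv.le, if_pos (Nat.succ_le_of_lt hv), one_ne_zero, if_false,
      ← hL v]
    exact hnb _ hv
  · have : Set.Ico 0 #A = Set.Iio #A := by ext; simp
    rw [this, Finset.coe_image] at hg
    simpa [RAM.Lists] using hg
  · intro i hi
    simp [hi]
  · intro i hi
    simp at hi ⊢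
    exact hnb0 i hi
  · intro i hi
    simpa using hg0 i hi
  · intro a i ha
    simp only
    rw [if_neg (by omega), if_neg (by omega), if_neg (by omega)]

end Input

/-! ### Nowhere dense classes -/

section Classes

variable {C : GraphClass.{u}}

lemma _root_.ExcludesClique.not_minor {c r : ℕ} (h : ExcludesClique C c r) {V : Type u} [Fintype V]
    {G : SimpleGraph V} (hG : C V G) : ¬ Minor (⊤ : SimpleGraph (Fin c)) G r :=
  fun hm => h V G hG hm.isDepthMinor

/-- The cliques on zero and one vertices are minors of every nonempty graph. The bound makes `|A| ^
(c + 1)` at least cubic, which the running time needs. -/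
lemma _root_.ExcludesClique.two_le {c r : ℕ} (h : ExcludesClique C c r) {V : Type u} [Fintype V]
    {G : SimpleGraph V} (hG : C V G) (v : V) : 2 ≤ c := by
  by_contra! hc
  have : Subsingleton (Fin c) := Fin.subsingleton_iff_le_one.2 (by omega)
  refine h.not_minor hG ⟨fun _ => {v}, fun _ => v, fun i j _ _ _ => Subsingleton.elim i j,
    fun _ => rfl, fun i x hx => ?_, fun i j hij => absurd (Subsingleton.elim i j) hij.ne⟩
  rw [Set.mem_singleton_iff.1 hx]
  exact mem_ballIn_self rfl

/-- A shallow minor of a shallow minor is shallow, so the depth-`r` minors of the class again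
exclude a clique at the depth required by the density bound. -/
lemma _root_.NowhereDense.exists_density (hC : NowhereDense C) (k : ℕ) (hk : 1 ≤ k) (r : ℕ) :
    ∃ K : ℕ, ∀ (V : Type u) [Fintype V] (G : SimpleGraph V), C V G →
      ∀ (W : Type u) [Fintype W] (H : SimpleGraph W), Minor H G r →
        arcs H ^ k ≤ K * Fintype.card W ^ (k + 1) := by
  obtain ⟨f, hf⟩ := hC
  obtain ⟨d, hd⟩ := exists_density_bound.{u} k hk
  obtain ⟨K, hK⟩ := hd (f ((2 * r + 1) * d + r))
  exact ⟨K, fun V _ G hG W _ H hH => hK W H fun hm => (hf _).not_minor hG (hm.trans hH)⟩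

lemma _root_.NowhereDense.exists_arcs_le (hC : NowhereDense C) {ε : ℝ} (hε : 0 < ε) :
    ∃ K : ℕ, ∀ (V : Type u) [Fintype V] (G : SimpleGraph V), C V G →
      (arcs G : ℝ) ≤ K * (Fintype.card V : ℝ) ^ (1 + ε) := by
  obtain ⟨k, hk⟩ := exists_nat_gt (1 / ε)
  have hk0 : (0 : ℝ) < k := (by positivity : (0 : ℝ) < 1 / ε).trans hk
  have hk1 : 1 ≤ k := by exact_mod_cast hk0
  obtain ⟨K, hK⟩ := hC.exists_density k hk1 0
  refine ⟨K + 1, fun V _ G hG => ?_⟩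
  -- A graph is a depth-zero minor of itself, with singleton branch sets.
  have h1 : arcs G ^ k ≤ K * Fintype.card V ^ (k + 1) := by
    refine hK V G hG V G ⟨fun x => {x}, fun x => x,
      fun _ _ _ hx hy => (Set.mem_singleton_iff.1 hx).symm.trans hy, fun _ => rfl,
      fun _ _ hx => ?_, fun i j hij => ⟨i, rfl, j, rfl, hij⟩⟩
    rw [Set.mem_singleton_iff.1 hx]
    exact mem_ballIn_self rfl
  set n := Fintype.card V with hn
  rcases Nat.eq_zero_or_pos n with h0 | h0
  · have : arcs G = 0 := by
      have := arcs_le_sq (G := G)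
      rw [← hn, h0] at this
      simpa using this
    rw [this]
    push_cast
    positivity
  have hn1 : (1 : ℝ) ≤ n := by exact_mod_cast h0
  refine le_of_pow_le_pow_left₀ (n := k) (by omega) (by positivity) ?_
  calc (arcs G : ℝ) ^ k ≤ K * (n : ℝ) ^ (k + 1) := by exact_mod_cast h1
    _ ≤ ((K + 1 : ℕ) : ℝ) ^ k * ((n : ℝ) ^ (1 + ε)) ^ k := by
      gcongr
      · exact_mod_cast (Nat.le_succ K).trans (Nat.le_self_pow (by omega) _)
      · rw [← Real.rpow_natCast, ← Real.rpow_natCast, ← Real.rpow_mul (by positivity)]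
        refine Real.rpow_le_rpow_of_exponent_le hn1 ?_
        -- The choice `k > 1 / ε` gives `k + 1 ≤ (1 + ε) * k`.
        rw [div_lt_iff₀ hε] at hk
        push_cast
        nlinarith
    _ = _ := (mul_pow _ _ _).symm

/-- The running time in the form stated in the theorem. -/
lemma running_time {r c s m n E L t : ℕ} {ε : ℝ} (hε : 0 < ε) (hs : s ≤ c) (hc : 2 ≤ c)
    (hm : r + 1 ≤ m) (hn : 1 ≤ n) (hE : (E : ℝ) ≤ L * (n : ℝ) ^ (1 + ε))
    (ht : t ≤ 24 * (r + 1) * s * m ^ 2 * searchCost n E r) :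
    (t : ℝ) ≤ (960 * (L + 2)) * (max r 1 : ℕ) * c * (m : ℝ) ^ (c + 1) * (n : ℝ) ^ (1 + ε) := by
  have h1 : t ≤ 960 * max r 1 * c * m ^ (c + 1) * (n + E + 1) := by
    -- One factor `r + 1` comes from the number of rounds and one from the search depth; the second
    -- is absorbed by `|A| ≥ r + 1`.
    have e1 : (r + 1) * (r + 1) ≤ (2 * max r 1) * m := Nat.mul_le_mul (by omega) hm
    have e2 : m ^ 3 ≤ m ^ (c + 1) := Nat.pow_le_pow_right (by omega) (by omega)
    calc t ≤ 24 * (r + 1) * s * m ^ 2 * (20 * (r + 1) * (n + E + 1)) := ht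
      _ = 480 * ((r + 1) * (r + 1)) * s * m ^ 2 * (n + E + 1) := by ring
      _ ≤ 480 * ((2 * max r 1) * m) * c * m ^ 2 * (n + E + 1) := by gcongr
      _ = 960 * max r 1 * c * m ^ 3 * (n + E + 1) := by ring
      _ ≤ _ := by gcongr
  have hn1 : (1 : ℝ) ≤ n := by exact_mod_cast hn
  have h2 : (n : ℝ) ≤ (n : ℝ) ^ (1 + ε) := by
    conv_lhs => rw [← Real.rpow_one (n : ℝ)]
    exact Real.rpow_le_rpow_of_exponent_le hn1 (by linarith)
  have h3 : ((n + E + 1 : ℕ) : ℝ) ≤ (L + 2) * (n : ℝ) ^ (1 + ε) := by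
    push_cast
    linarith
  calc (t : ℝ) ≤ ((960 * max r 1 * c * m ^ (c + 1) * (n + E + 1) : ℕ) : ℝ) := by exact_mod_cast h1
    _ = 960 * (max r 1 : ℕ) * c * (m : ℝ) ^ (c + 1) * ((n + E + 1 : ℕ) : ℝ) := by push_cast; ring
    _ ≤ 960 * (max r 1 : ℕ) * c * (m : ℝ) ^ (c + 1) * ((L + 2) * (n : ℝ) ^ (1 + ε)) := by gcongr
    _ = _ := by ring

end Classes

end QuasiWide

/-! ### Assembling the theorem -/

theorem theorem1p2 (C : GraphClass.{u}) (hC : NowhereDense C) :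
    ∃ (p : ℕ → Polynomial ℕ) (s : ℕ → ℕ),
      (∀ (r m : ℕ) (V : Type u) [Fintype V] (G : SimpleGraph V), C V G →
        ∀ A : Finset V, (p r).eval m ≤ A.card →
          ∃ S B : Finset V, S.card ≤ s r ∧ B ⊆ A ∧ m ≤ B.card ∧
            RIndependentAfterDeleting G S r B) ∧
      (∀ r c : ℕ, ExcludesClique C c r → s r ≤ c) ∧
      ∃ P : RAM.Prog, ∀ ε : ℝ, 0 < ε → ∃ K : ℝ,
        ∀ r c : ℕ, ExcludesClique C c r →
          ∀ (V : Type u) [Fintype V] (G : SimpleGraph V), C V G →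
          ∀ (A : Finset V) (m : ℕ), (p r).eval m ≤ A.card →
          ∀ (e : V ≃ Fin (Fintype.card V)) (σ : RAM.State), RAM.IsInput e G A r σ →
            ∃ (τ : RAM.State) (t : ℕ) (S B : Finset V),
              RAM.Runs P σ τ t ∧ RAM.IsOutput e S B τ ∧
              S.card ≤ s r ∧ B ⊆ A ∧ m ≤ B.card ∧ RIndependentAfterDeleting G S r B ∧
              (t : ℝ) ≤ K * (max r 1 : ℕ) * c * (A.card : ℝ) ^ (c + 1) *
                (Fintype.card V : ℝ) ^ (1 + ε) := by
  classical
  choose K hK using fun r => hC.exists_density 2 (by omega) r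
  have hex : ∀ r, ∃ c, ExcludesClique C c r := fun r =>
    let ⟨f, hf⟩ := hC
    ⟨f r, hf r⟩
  -- The least excluded clique size, so that the second statement holds for every admissible `c` at
  -- once.
  let s : ℕ → ℕ := fun r => Nat.find (hex r)
  let q : ℕ → ℕ := fun r => 4 ^ (2 * r * s r)
  -- Adding `s r` to `m` makes `A` large enough for the clique arguments even when `m` is small. The
  -- summand `r + 1` gives the strict inequality required by `wp_main` and the bound `r + 1 ≤ |A|`
  -- used for the running time.
  let p : ℕ → Polynomial ℕ := fun r => (Polynomial.C (2 * K r + 2) *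
    (Polynomial.X + Polynomial.C (s r))) ^ q r + Polynomial.C (r + 1)
  have hp : ∀ r m, (p r).eval m = ((2 * K r + 2) * (m + s r)) ^ q r + (r + 1) := by
    intro r m
    simp [p]
  have hrun : ∀ (r m : ℕ) (V : Type u) [Fintype V] (G : SimpleGraph V), C V G →
      ∀ A : Finset V, (p r).eval m ≤ A.card →
      ∀ (e : V ≃ Fin (Fintype.card V)) (σ : RAM.State), RAM.IsInput e G A r σ →
      ∃ (τ : RAM.State) (t : ℕ) (S B : Finset V),
        RAM.Runs QuasiWide.main σ τ t ∧ RAM.IsOutput e S B τ ∧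
        S.card ≤ s r ∧ B ⊆ A ∧ m ≤ B.card ∧ RIndependentAfterDeleting G S r B ∧
        t ≤ 24 * (r + 1) * s r * A.card ^ 2 *
          QuasiWide.searchCost (Fintype.card V) (QuasiWide.arcs G) r := by
    intro r m V _ G hG A hA e σ hσ
    rw [hp] at hA
    have hs : ExcludesClique C (s r) r := Nat.find_spec (hex r)
    obtain ⟨v, -⟩ := Finset.card_pos.1 (by omega : 0 < A.card)
    have hs2 := hs.two_le hG v
    have hlow : ((2 * K r + 2) * s r) ^ q r ≤ ((2 * K r + 2) * (m + s r)) ^ q r :=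
      Nat.pow_le_pow_left (Nat.mul_le_mul_left _ (by omega)) _
    simp only [q] at hA hlow
    obtain ⟨τ, t, hr, S, B, hout, hSc, hBA, hlarge, hind, ht⟩ := QuasiWide.wp_main (K := K r) hσ
      (by omega) (hs.not_minor hG)
      (fun T H hH => by simpa using hK r V G hG T H hH) (by omega)
    refine ⟨τ, t, S, B, hr, hout, hSc.le, hBA, ?_, hind, by simpa using ht⟩
    by_contra! hlt
    have : ((2 * K r + 2) * B.card) ^ 4 ^ (2 * r * s r) ≤
        ((2 * K r + 2) * (m + s r)) ^ 4 ^ (2 * r * s r) :=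
      Nat.pow_le_pow_left (Nat.mul_le_mul_left _ (by omega)) _
    omega
  refine ⟨p, s, ?_, fun r c hc => Nat.find_min' (hex r) hc, QuasiWide.main, ?_⟩
  · intro r m V _ G hG A hA
    obtain ⟨σ, hσ⟩ := QuasiWide.exists_isInput (Fintype.equivFin V) G A r
    obtain ⟨-, -, S, B, -, -, h1, h2, h3, h4, -⟩ := hrun r m V G hG A hA _ σ hσ
    exact ⟨S, B, h1, h2, h3, h4⟩
  · intro ε hε
    obtain ⟨L, hL⟩ := hC.exists_arcs_le hε
    refine ⟨960 * (L + 2), fun r c hc V _ G hG A m hA e σ hσ => ?_⟩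
    obtain ⟨τ, t, S, B, h0, h1, h2, h3, h4, h5, ht⟩ := hrun r m V G hG A hA e σ hσ
    rw [hp] at hA
    obtain ⟨v, -⟩ := Finset.card_pos.1 (by omega : 0 < A.card)
    exact ⟨τ, t, S, B, h0, h1, h2, h3, h4, h5, QuasiWide.running_time hε
      (Nat.find_min' (hex r) hc) (hc.two_le hG v) (by omega) (Fintype.card_pos_iff.2 ⟨v⟩)
      (hL V G hG) ht⟩
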